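/- **Theorem 3.1 (semi-homogenization with linear growth).** Let $m,d\ge 1$ be integers, let $Y=\,]0,1[^d$, let $\Omega\subset\mathbb R^d$ be a bounded open set, and let $\mathbb M^{m\times d}$ be the space of real $m\times d$ matrices with the Euclidean norm $|\cdot|$. Let $f:\mathbb R^d\times\mathbb M^{m\times d}\to[0,+\infty]$ be Borel measurable and such that $f(\cdot,\xi)$ is $Y$-periodic for every $\xi$ (that is, $1$-periodic in each coordinate direction), and such that for some $c>0$ we have $f(x,\xi)\le c(1+|\xi|)$ for all $(x,\xi)$. For $u\in W^{1,\infty}(\Omega;\mathbb R^m)$ and $r\in[0,+\infty]$ put $$G_r(u)=\inf\Big\{\liminf_{\varepsilon\to0}\int_\Omega f\big(\tfrac x\varepsilon,\nabla u_\varepsilon(x)\big)\,dx\Big\},\qquad H_r(u)=\inf\Big\{\limsup_{\varepsilon\to0}\int_\Omega f\big(\tfrac x\varepsilon,\nabla u_\varepsilon(x)\big)\,dx\Big\}\ \ (r<+\infty),$$ both infima being over all families $(u_\varepsilon)_{\varepsilon>0}\subset W^{1,\infty}(\Omega;\mathbb R^m)$ such that $\sup_{\varepsilon>0}\|\nabla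 u_\varepsilon\|_\infty\le r$ and $u_\varepsilon\stackrel{*}{\rightharpoonup}u$ in $W^{1,\infty}(\Omega;\mathbb R^m)$ as $\varepsilon\to0^+$ (that is, $u_\varepsilon\stackrel{*}{\rightharpoonup}u$ and $\nabla u_\varepsilon\stackrel{*}{\rightharpoonup}\nabla u$ in $L^\infty(\Omega)$), with $\inf\emptyset=+\infty$. For a bounded open set $D$ let $W^{1,\infty}_0(D;\mathbb R^m)$ be the set of $\varphi\in W^{1,\infty}(D;\mathbb R^m)$ that are continuous up to $\partial D$ with $\varphi=0$ on $\partial D$. For $r\in[0,+\infty]$ and $\xi\in\mathbb M^{m\times d}$ put $$\mathcal H_rf(\xi)=\inf_{n\ge1}\frac1{n^d}\inf\Big\{\int_{nY}f(x,\xi+\nabla\phi(x))\,dx:\ \phi\in W^{1,\infty}_0(nY;\mathbb R^m),\ \|\nabla\phi\|_\infty\le r\Big\},\qquad \mathcal Hf=\mathcal H_\infty f.$$ Let $\mathrm{Aff}(\Omega;\mathbb R^m)$ be the set of continuous $u\in W^{1,\infty}(\Omega;\mathbb R^m)$ for which there are finitely many disjoint open sets $D_i\subset\Omega$ with $|\partial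 D_i|=0$ and $|\Omega\setminus\bigcup_iD_i|=0$, and matrices $\xi_i\in\mathbb M^{m\times d}$, such that $\nabla u=\xi_i$ a.e. in $D_i$ for each $i$. Then: 1. for every $u\in W^{1,\infty}(\Omega;\mathbb R^m)$ and every $r\in[0,+\infty]$, $\displaystyle G_r(u)\ge\int_\Omega\mathcal Hf(\nabla u(x))\,dx$; 2. for every $u\in\mathrm{Aff}(\Omega;\mathbb R^m)$ and every $r\in[0,+\infty[$, $\displaystyle H_{r+\|\nabla u\|_\infty}(u)\le\int_\Omega\mathcal H_rf(\nabla u(x))\,dx$; 3. $\mathcal Hf$ is quasiconvex, that is, it is finite, Borel measurable, and for every $\xi\in\mathbb M^{m\times d}$ $$\mathcal Hf(\xi)=\inf\Big\{\int_Y\mathcal Hf(\xi+\nabla\phi(x))\,dx:\ \phi\in W^{1,\infty}_0(Y;\mathbb R^m)\Big\}.$$ -/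

import Mathlib

open MeasureTheory Filter Topology
open scoped ENNReal NNReal ContDiff

noncomputable section

namespace SemiHom

/-- `ℝ^d` with its Euclidean norm. -/
abbrev Vec (d : ℕ) : Type := EuclideanSpace ℝ (Fin d)

/-- The space of real `m × d` matrices with the Euclidean (Frobenius) norm; the entry of `ξ` in
row `i` and column `j` is `ξ (i, j)`. -/
abbrev Mat (m d : ℕ) : Type := EuclideanSpace ℝ (Fin m × Fin d)

/-- The open cube `]0,n[^d`. The unit cell `Y` is `cube d 1`. -/
def cube (d n : ℕ) : Set (Vec d) := {x | ∀ j, 0 < x j ∧ x j < n}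

/-- `g` is the distributional gradient of `u` in the open set `Ω`: for every `φ ∈ C_c^∞(Ω)`,
`∫_Ω u_i ∂_j φ = - ∫_Ω g_{ij} φ`. -/
def HasWeakGradient {m d : ℕ} (Ω : Set (Vec d)) (u : Vec d → Vec m) (g : Vec d → Mat m d) : Prop :=
  ∀ φ : Vec d → ℝ, ContDiff ℝ ∞ φ → HasCompactSupport φ → tsupport φ ⊆ Ω →
    ∀ (i : Fin m) (j : Fin d),
      ∫ x in Ω, u x i * fderiv ℝ φ x (EuclideanSpace.single j 1) = -∫ x in Ω, g x (i, j) * φ x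

/-- An element of the Sobolev space `W^{1,∞}(Ω; ℝ^m)`, given by an essentially bounded
representative `toFun` and a representative `grad` of its essentially bounded weak gradient.
Values outside `Ω` play no role. -/
structure W1inf {d : ℕ} (Ω : Set (Vec d)) (m : ℕ) where
  toFun : Vec d → Vec m
  grad : Vec d → Mat m d
  memLp_toFun : MemLp toFun ⊤ (volume.restrict Ω)
  memLp_grad : MemLp grad ⊤ (volume.restrict Ω)
  hasWeakGradient : HasWeakGradient Ω toFun grad

namespace W1inf

variable {m d : ℕ} {Ω : Set (Vec d)}

/-- `‖∇u‖_∞`, the essential supremum over `Ω` of the norm of the gradient. -/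
def gradNorm (u : W1inf Ω m) : ℝ≥0∞ := eLpNorm u.grad ⊤ (volume.restrict Ω)

/-- `u ∈ W^{1,∞}_0(Ω; ℝ^m)`, i.e. `u = 0` on `∂Ω`: the function `u` has a representative that is
continuous up to the boundary and vanishes there. -/
def IsZeroOnBoundary (u : W1inf Ω m) : Prop :=
  ∃ v : Vec d → Vec m, ContinuousOn v (closure Ω) ∧ (∀ x ∈ frontier Ω, v x = 0) ∧
    u.toFun =ᵐ[volume.restrict Ω] v

/-- `u ∈ Aff(Ω; ℝ^m)`: continuous, with gradient constant on each of finitely many disjoint open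
sets with negligible boundaries that cover `Ω` up to a null set. -/
def IsPiecewiseAffine (u : W1inf Ω m) : Prop :=
  (∃ v : Vec d → Vec m, ContinuousOn v Ω ∧ u.toFun =ᵐ[volume.restrict Ω] v) ∧
  ∃ (k : ℕ) (D : Fin k → Set (Vec d)) (ξ : Fin k → Mat m d),
    (∀ i, IsOpen (D i) ∧ D i ⊆ Ω ∧ volume (frontier (D i)) = 0) ∧
    Pairwise (fun i j => Disjoint (D i) (D j)) ∧
    volume (Ω \ ⋃ i, D i) = 0 ∧
    ∀ i, ∀ᵐ x ∂(volume.restrict (D i)), u.grad x = ξ i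

/-- Weak* convergence `v_ε ⇀ u` in `W^{1,∞}(Ω; ℝ^m)` as `ε → 0⁺`: both the functions and their
gradients converge weakly* in `L^∞(Ω)`, i.e. when tested against `L¹(Ω)`. -/
def WeakStarTendsto (v : ℝ → W1inf Ω m) (u : W1inf Ω m) : Prop :=
  ∀ h : Vec d → ℝ, Integrable h (volume.restrict Ω) →
    (∀ i : Fin m, Tendsto (fun ε => ∫ x in Ω, (v ε).toFun x i * h x) (𝓝[>] 0)
      (𝓝 (∫ x in Ω, u.toFun x i * h x))) ∧
    (∀ (i : Fin m) (j : Fin d), Tendsto (fun ε => ∫ x in Ω, (v ε).grad x (i, j) * h x) (𝓝[>] 0)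
      (𝓝 (∫ x in Ω, u.grad x (i, j) * h x)))

end W1inf

variable {m d : ℕ}

/-- `∫_Ω f(x/ε, ∇v(x)) dx`. -/
def energy (f : Vec d → Mat m d → ℝ≥0∞) {Ω : Set (Vec d)} (ε : ℝ) (v : W1inf Ω m) : ℝ≥0∞ :=
  ∫⁻ x in Ω, f (ε⁻¹ • x) (v.grad x)

/-- `G_r(u)`: the infimum of `liminf_{ε → 0} ∫_Ω f(x/ε, ∇v_ε)` over the families `(v_ε)_{ε > 0}`
converging weakly* to `u` in `W^{1,∞}` with `sup_{ε > 0} ‖∇v_ε‖_∞ ≤ r`. -/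
def G (f : Vec d → Mat m d → ℝ≥0∞) {Ω : Set (Vec d)} (r : ℝ≥0∞) (u : W1inf Ω m) : ℝ≥0∞ :=
  ⨅ (v : ℝ → W1inf Ω m) (_ : W1inf.WeakStarTendsto v u) (_ : ∀ ε > 0, (v ε).gradNorm ≤ r),
    liminf (fun ε => energy f ε (v ε)) (𝓝[>] 0)

/-- `H_r(u)`: the same with `limsup`. -/
def H (f : Vec d → Mat m d → ℝ≥0∞) {Ω : Set (Vec d)} (r : ℝ≥0∞) (u : W1inf Ω m) : ℝ≥0∞ :=
  ⨅ (v : ℝ → W1inf Ω m) (_ : W1inf.WeakStarTendsto v u) (_ : ∀ ε > 0, (v ε).gradNorm ≤ r),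
    limsup (fun ε => energy f ε (v ε)) (𝓝[>] 0)

/-- `𝓗_r f(ξ)`, the cell formula with the gradients of the competitors bounded by `r`. -/
def homogBdd (r : ℝ≥0∞) (f : Vec d → Mat m d → ℝ≥0∞) (ξ : Mat m d) : ℝ≥0∞ :=
  ⨅ (n : ℕ) (_ : 1 ≤ n), ((n : ℝ≥0∞) ^ d)⁻¹ *
    ⨅ (φ : W1inf (cube d n) m) (_ : φ.IsZeroOnBoundary) (_ : φ.gradNorm ≤ r),
      ∫⁻ x in cube d n, f x (ξ + φ.grad x)

/-- `𝓗 f(ξ)`, the cell formula. -/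
def homog (f : Vec d → Mat m d → ℝ≥0∞) (ξ : Mat m d) : ℝ≥0∞ :=
  ⨅ (n : ℕ) (_ : 1 ≤ n), ((n : ℝ≥0∞) ^ d)⁻¹ *
    ⨅ (φ : W1inf (cube d n) m) (_ : φ.IsZeroOnBoundary),
      ∫⁻ x in cube d n, f x (ξ + φ.grad x)

/-- Quasiconvexity of `g : 𝕄^{m×d} → [0,+∞[` (finiteness is part of the notion). -/
def IsQuasiconvex (g : Mat m d → ℝ≥0∞) : Prop :=
  (∀ ξ, g ξ ≠ ⊤) ∧ Measurable g ∧
    ∀ ξ, g ξ = ⨅ (φ : W1inf (cube d 1) m) (_ : φ.IsZeroOnBoundary),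
      ∫⁻ x in cube d 1, g (ξ + φ.grad x)

end SemiHom

end

/-
On a piece where `∇u = ξ` one adds to `u` the `ε`-rescaled copies of a competitor for the cell
formula at `ξ`, placed on a grid of cubes filling the piece: this gives the upper bound. For the
lower bound, blow up at a differentiability point `x₀` of `u`: on a small cube around `x₀` the
functions `v_ε` are uniformly close to an affine function of slope `∇u(x₀)`, and cutting off the
difference near the boundary turns them into competitors for the cell formula. Hence `𝓗f(∇u(x₀))`
is at most the asymptotic average of the energy density over small cubes, and averaging over cubes
preserves integrals, so that Fatou's lemma concludes. For quasiconvexity, a Lipschitz `φ` vanishing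
on the boundary of the cell is replaced, on small balls of a Vitali covering where it is almost
affine, by near-optimal rescaled cell functions; upper semicontinuity of `𝓗f` controls the error.
-/

noncomputable section

namespace SemiHom

variable {m d : ℕ}

section Coordinates

variable {ι : Type*} [Fintype ι]

lemma norm_le_card_mul (x : EuclideanSpace ℝ ι) {C : ℝ} (h : ∀ i, |x i| ≤ C) :
    ‖x‖ ≤ Fintype.card ι * C := by
  classical
  have hx : x = ∑ i, x i • EuclideanSpace.single i (1 : ℝ) := by
    ext k
    simp [Pi.single_apply]
  calc ‖x‖ ≤ ∑ i, ‖x i • EuclideanSpace.single i (1 : ℝ)‖ := by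
        conv_lhs => rw [hx]
        exact norm_sum_le _ _
    _ ≤ ∑ _i : ι, C := Finset.sum_le_sum fun i _ => by simpa [norm_smul] using h i
    _ = Fintype.card ι * C := by simp

lemma opNorm_le_card_mul [DecidableEq ι] (A : EuclideanSpace ℝ ι →L[ℝ] ℝ) {C : ℝ} (hC : 0 ≤ C)
    (h : ∀ i, |A (EuclideanSpace.single i 1)| ≤ C) : ‖A‖ ≤ Fintype.card ι * C := by
  refine A.opNorm_le_bound (by positivity) fun x => ?_
  have hx : x = ∑ i, x i • EuclideanSpace.single i (1 : ℝ) := by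
    ext k
    simp [Pi.single_apply]
  calc ‖A x‖ = ‖∑ i, x i * A (EuclideanSpace.single i 1)‖ := by
        conv_lhs => rw [hx]
        simp [map_sum]
    _ ≤ ∑ i, ‖x i * A (EuclideanSpace.single i 1)‖ := norm_sum_le _ _
    _ ≤ ∑ _i : ι, ‖x‖ * C := by
        refine Finset.sum_le_sum fun i _ => ?_
        rw [norm_mul]
        exact mul_le_mul (PiLp.norm_apply_le x i) (h i) (norm_nonneg _) (norm_nonneg _)
    _ = Fintype.card ι * C * ‖x‖ := by
        simp only [Finset.sum_const, Finset.card_univ, nsmul_eq_mul]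
        ring

lemma memLp_apply {α : Type*} [MeasurableSpace α] {μ : Measure α} {p : ℝ≥0∞}
    {u : α → EuclideanSpace ℝ ι} (hu : MemLp u p μ) (i : ι) : MemLp (fun x => u x i) p μ :=
  (EuclideanSpace.proj i : EuclideanSpace ℝ ι →L[ℝ] ℝ).comp_memLp' hu

lemma lipschitzWith_apply {α : Type*} [PseudoMetricSpace α] {K : ℝ≥0}
    {w : α → EuclideanSpace ℝ ι} (hw : LipschitzWith K w) (i : ι) :
    LipschitzWith K (fun x => w x i) :=
  LipschitzWith.of_dist_le_mul fun x y =>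
    (PiLp.dist_apply_le (w x) (w y) i).trans (hw.dist_le_mul x y)

end Coordinates

/-- The open cube with lower corner `a` and side `s`. -/
def box (a : Vec d) (s : ℝ) : Set (Vec d) := {x | ∀ j, a j < x j ∧ x j < a j + s}

lemma box_eq_preimage (a : Vec d) (s : ℝ) :
    box a s = WithLp.ofLp ⁻¹' (Set.univ.pi fun j => Set.Ioo (a j) (a j + s)) := by
  ext x
  simp [box]

lemma isOpen_box (a : Vec d) (s : ℝ) : IsOpen (box a s) := by
  rw [box_eq_preimage]
  exact (isOpen_set_pi Set.finite_univ fun _ _ => isOpen_Ioo).preimage (PiLp.continuous_ofLp 2 _)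

lemma measurableSet_box (a : Vec d) (s : ℝ) : MeasurableSet (box a s) :=
  (isOpen_box a s).measurableSet

lemma convex_box (a : Vec d) (s : ℝ) : Convex ℝ (box a s) := by
  rw [box_eq_preimage]
  exact (convex_pi fun _ _ => convex_Ioo _ _).linear_preimage (WithLp.linearEquiv 2 ℝ _).toLinearMap

lemma volume_box (a : Vec d) (s : ℝ) : volume (box a s) = ENNReal.ofReal s ^ d := by
  have h := (EuclideanSpace.volume_preserving_symm_measurableEquiv_toLp (Fin d)).measure_preimage
    (s := Set.univ.pi fun j => Set.Ioo (a j) (a j + s))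
    (MeasurableSet.univ_pi fun j => measurableSet_Ioo).nullMeasurableSet
  rw [box_eq_preimage]
  refine h.trans ?_
  rw [volume_pi_pi]
  simp

lemma box_subset_closedBall (a : Vec d) (s : ℝ) : box a s ⊆ Metric.closedBall a (d * s) := by
  intro x hx
  rw [Metric.mem_closedBall, dist_eq_norm]
  refine (norm_le_card_mul _ fun j => ?_).trans_eq (by rw [Fintype.card_fin])
  have := hx j
  rw [PiLp.sub_apply, abs_le]
  constructor <;> linarith

lemma isBounded_box (a : Vec d) (s : ℝ) : Bornology.IsBounded (box a s) :=
  Metric.isBounded_closedBall.subset (box_subset_closedBall a s)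

lemma closedBall_subset_box {a x : Vec d} {s t : ℝ}
    (hx : ∀ j, a j + t < x j ∧ x j < a j + s - t) : Metric.closedBall x t ⊆ box a s := by
  intro y hy j
  have h : |y j - x j| ≤ t := (PiLp.dist_apply_le y x j).trans hy
  have := hx j
  rw [abs_le] at h
  constructor <;> linarith

lemma cube_eq_box (n : ℕ) : cube d n = box 0 n := by
  simp [cube, box]

lemma volume_cube (n : ℕ) : volume (cube d n) = (n : ℝ≥0∞) ^ d := by
  rw [cube_eq_box, volume_box, ENNReal.ofReal_natCast]

lemma isOpen_cube (n : ℕ) : IsOpen (cube d n) :=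
  cube_eq_box (d := d) n ▸ isOpen_box _ _

lemma measurableSet_cube (n : ℕ) : MeasurableSet (cube d n) := (isOpen_cube n).measurableSet

lemma convex_cube (n : ℕ) : Convex ℝ (cube d n) :=
  cube_eq_box (d := d) n ▸ convex_box _ _

lemma isBounded_cube (n : ℕ) : Bornology.IsBounded (cube d n) :=
  cube_eq_box (d := d) n ▸ isBounded_box _ _

lemma setLIntegral_comp_scale {ε : ℝ} (hε : 0 < ε) (b : Vec d) (S : Set (Vec d))
    (F : Vec d → ℝ≥0∞) :
    ∫⁻ x in {x | ε⁻¹ • x - b ∈ S}, F (ε⁻¹ • x - b) = ENNReal.ofReal ε ^ d * ∫⁻ y in S, F y := by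
  let e : Vec d ≃ᵐ Vec d := ((Homeomorph.smulOfNeZero ε⁻¹ (inv_ne_zero hε.ne')).trans
    (Homeomorph.subRight b)).toMeasurableEquiv
  have hmap : Measure.map e volume = ENNReal.ofReal ε ^ d • (volume : Measure (Vec d)) := by
    have he : (e : Vec d → Vec d) = (fun x => x - b) ∘ (fun x => ε⁻¹ • x) := rfl
    rw [he, ← Measure.map_map (by fun_prop) (by fun_prop),
      Measure.map_addHaar_smul _ (inv_ne_zero hε.ne'), Measure.map_smul,
      (measurePreserving_sub_right volume b).map_eq]
    congr 1
    rw [finrank_euclideanSpace, Fintype.card_fin, inv_pow, inv_inv, abs_of_pos (by positivity),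
      ENNReal.ofReal_pow hε.le]
  calc ∫⁻ x in {x | ε⁻¹ • x - b ∈ S}, F (ε⁻¹ • x - b) = ∫⁻ x in e ⁻¹' S, F (e x) := rfl
    _ = ∫⁻ y in S, F y ∂(Measure.map e volume) := by rw [e.restrict_map, lintegral_map_equiv]
    _ = ENNReal.ofReal ε ^ d * ∫⁻ y in S, F y := by
        rw [hmap, Measure.restrict_smul, lintegral_smul_measure, smul_eq_mul]

lemma volume_scale {ε : ℝ} (hε : 0 < ε) (b : Vec d) (S : Set (Vec d)) :
    volume {x | ε⁻¹ • x - b ∈ S} = ENNReal.ofReal ε ^ d * volume S := by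
  simpa using setLIntegral_comp_scale hε b S (fun _ => 1)

/-- The vector of `ℝ^d` with integer coordinates `z`. -/
def intVec (z : Fin d → ℤ) : Vec d := WithLp.toLp 2 fun j => (z j : ℝ)

@[simp] lemma intVec_apply (z : Fin d → ℤ) (j : Fin d) : intVec z j = z j := rfl

lemma intVec_eq_sum (z : Fin d → ℤ) :
    intVec z = ∑ j, z j • EuclideanSpace.single j (1 : ℝ) := by
  ext k
  simp [Pi.single_apply]

/-- The cube `ε (z + ]0,n[^d)` with vertices in the lattice `ε ℤ^d`. -/
def scaledCube (ε : ℝ) (n : ℕ) (z : Fin d → ℤ) : Set (Vec d) :=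
  {x | ε⁻¹ • x - intVec z ∈ cube d n}

lemma mem_scaledCube_iff {ε : ℝ} {n : ℕ} {z : Fin d → ℤ} {x : Vec d} :
    x ∈ scaledCube ε n z ↔ ∀ j, (z j : ℝ) < ε⁻¹ * x j ∧ ε⁻¹ * x j < z j + n := by
  simp only [scaledCube, cube, Set.mem_ofPred_eq, PiLp.sub_apply, PiLp.smul_apply, smul_eq_mul,
    intVec_apply, sub_pos, sub_lt_iff_lt_add']

lemma isOpen_scaledCube (ε : ℝ) (n : ℕ) (z : Fin d → ℤ) : IsOpen (scaledCube ε n z) :=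
  (isOpen_cube n).preimage (by fun_prop : Continuous fun x : Vec d => ε⁻¹ • x - intVec z)

lemma measurableSet_scaledCube (ε : ℝ) (n : ℕ) (z : Fin d → ℤ) :
    MeasurableSet (scaledCube ε n z) :=
  (isOpen_scaledCube ε n z).measurableSet

lemma convex_scaledCube (ε : ℝ) (n : ℕ) (z : Fin d → ℤ) : Convex ℝ (scaledCube ε n z) := by
  have h := ((convex_cube n).translate_preimage_left (-intVec z)).smul_preimage ε⁻¹
  simp only [Set.preimage_preimage, ← sub_eq_add_neg] at h
  exact h

lemma volume_scaledCube {ε : ℝ} (hε : 0 < ε) (n : ℕ) (z : Fin d → ℤ) :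
    volume (scaledCube ε n z) = ENNReal.ofReal ε ^ d * (n : ℝ≥0∞) ^ d := by
  rw [scaledCube, volume_scale hε, volume_cube]

lemma dist_le_of_mem_scaledCube {ε : ℝ} (hε : 0 < ε) {n : ℕ} {z : Fin d → ℤ}
    {x y : Vec d} (hx : x ∈ scaledCube ε n z) (hy : y ∈ scaledCube ε n z) :
    dist x y ≤ d * (ε * n) := by
  rw [dist_eq_norm]
  refine (norm_le_card_mul _ fun j => ?_).trans_eq (by rw [Fintype.card_fin])
  have hxj := mem_scaledCube_iff.1 hx j
  have hyj := mem_scaledCube_iff.1 hy j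
  have h : |ε⁻¹ * x j - ε⁻¹ * y j| ≤ n := by
    rw [abs_le]
    constructor <;> linarith
  rwa [← mul_sub, abs_mul, abs_of_pos (inv_pos.2 hε), inv_mul_le_iff₀ hε] at h

lemma exists_box_subset_scaledCube (a : Vec d) {ρ ε : ℝ} (hρ : 0 < ρ) (hε : 0 < ε) :
    ∃ (n : ℕ) (z : Fin d → ℤ), 1 ≤ n ∧ ε * n ≤ ρ + 2 * ε ∧ box a ρ ⊆ scaledCube ε n z := by
  have hle := Nat.le_ceil (ρ / ε)
  have hlt := Nat.ceil_lt_add_one (div_pos hρ hε).le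
  have hρε : ε * (ρ / ε) = ρ := by field_simp
  refine ⟨⌈ρ / ε⌉₊ + 1, fun j => ⌊ε⁻¹ * a j⌋, by omega, ?_, fun x hx =>
    mem_scaledCube_iff.2 fun j => ?_⟩
  · push_cast
    nlinarith
  · have hfloor := Int.floor_le (ε⁻¹ * a j)
    have hfloor' := Int.lt_floor_add_one (ε⁻¹ * a j)
    have hlow : ε⁻¹ * a j < ε⁻¹ * x j := mul_lt_mul_of_pos_left (hx j).1 (inv_pos.2 hε)
    have hupp : ε⁻¹ * x j < ε⁻¹ * (a j + ρ) := mul_lt_mul_of_pos_left (hx j).2 (inv_pos.2 hε)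
    rw [mul_add, ← div_eq_inv_mul ρ] at hupp
    push_cast
    constructor <;> linarith

/-- The cubes `ε n (z + ]0,1[^d)`, which tile `ℝ^d` up to a null set as `z` ranges over `ℤ^d`. -/
abbrev tile (ε : ℝ) (n : ℕ) (z : Fin d → ℤ) : Set (Vec d) := scaledCube ε n (n • z)

lemma mem_tile_iff {ε : ℝ} {n : ℕ} {z : Fin d → ℤ} {x : Vec d} :
    x ∈ tile ε n z ↔ ∀ j, (n * z j : ℝ) < ε⁻¹ * x j ∧ ε⁻¹ * x j < n * (z j + 1) := by
  simp [mem_scaledCube_iff, mul_add]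

lemma pairwise_disjoint_tile (ε : ℝ) {n : ℕ} (hn : 1 ≤ n) :
    Pairwise (Function.onFun Disjoint (tile (d := d) ε n)) := by
  intro z z' hzz
  rw [Function.onFun, Set.disjoint_left]
  intro x hx hx'
  refine hzz (funext fun j => ?_)
  have hxj := mem_tile_iff.1 hx j
  have hxj' := mem_tile_iff.1 hx' j
  have hlt : (z j : ℝ) < z' j + 1 := lt_of_mul_lt_mul_left (hxj.1.trans hxj'.2) (by positivity)
  have hlt' : (z' j : ℝ) < z j + 1 := lt_of_mul_lt_mul_left (hxj'.1.trans hxj.2) (by positivity)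
  norm_cast at hlt hlt'
  omega

lemma volume_coord_eq (j : Fin d) (c : ℝ) : volume {x : Vec d | x j = c} = 0 := by
  have h := (EuclideanSpace.volume_preserving_symm_measurableEquiv_toLp (Fin d)).measure_preimage
    (s := {y : Fin d → ℝ | y j = c})
    (measurableSet_eq_fun (by fun_prop) (by fun_prop)).nullMeasurableSet
  refine h.trans ?_
  rw [volume_pi]
  exact Measure.pi_hyperplane (fun _ : Fin d => (volume : Measure ℝ)) j c

lemma ae_exists_mem_tile {ε : ℝ} (hε : 0 < ε) {n : ℕ} (hn : 1 ≤ n) :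
    ∀ᵐ x : Vec d, ∃ z, x ∈ tile ε n z := by
  have hn' : (0 : ℝ) < n := by exact_mod_cast hn
  have hgrid : ∀ᵐ x : Vec d, ∀ (j : Fin d) (k : ℤ), x j ≠ ε * (n * k) := by
    simp only [ae_all_iff]
    exact fun j k => measure_mono_null (fun x hx => by simpa using hx)
      (volume_coord_eq j (ε * (n * k)))
  filter_upwards [hgrid] with x hx
  refine ⟨fun j => ⌊ε⁻¹ * x j / n⌋, mem_tile_iff.2 fun j => ⟨?_, ?_⟩⟩
  · refine lt_of_le_of_ne ?_ fun h => hx j ⌊ε⁻¹ * x j / n⌋ ?_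
    · have := Int.floor_le (ε⁻¹ * x j / n)
      rw [le_div_iff₀ hn'] at this
      linarith
    · rw [h]
      field_simp
  · have := Int.lt_floor_add_one (ε⁻¹ * x j / n)
    rw [div_lt_iff₀ hn'] at this
    linarith

section Gradient

/-- Linear maps `ℝ^d → ℝ^m` as matrices. -/
def matEquiv : (Vec d →L[ℝ] Vec m) ≃L[ℝ] Mat m d :=
  LinearEquiv.toContinuousLinearEquiv
    { toFun := fun A => WithLp.toLp 2 fun p => A (EuclideanSpace.single p.2 1) p.1
      map_add' := fun A B => by
        ext p
        simp
      map_smul' := fun c A => by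
        ext p
        simp
      invFun := fun ξ => LinearMap.toContinuousLinearMap
        { toFun := fun x => WithLp.toLp 2 fun i => ∑ j, ξ (i, j) * x j
          map_add' := fun x y => by
            ext i
            simp [mul_add, Finset.sum_add_distrib]
          map_smul' := fun c x => by
            ext i
            simp [Finset.mul_sum, mul_left_comm] }
      left_inv := fun A => by
        ext x i
        have hx : x = ∑ j, x j • EuclideanSpace.single j (1 : ℝ) := by
          ext k
          simp [Pi.single_apply]
        conv_rhs => rw [hx]
        simp [map_sum, mul_comm]
      right_inv := fun ξ => by
        ext p
        simp }

/-- The matrix of the Fréchet derivative of `w` at `x`; it is `0` where `w` is not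
differentiable. For Lipschitz `w` it represents the weak gradient. -/
def grad (w : Vec d → Vec m) (x : Vec d) : Mat m d := matEquiv (fderiv ℝ w x)

lemma grad_apply (w : Vec d → Vec m) (x : Vec d) (i : Fin m) (j : Fin d) :
    grad w x (i, j) = fderiv ℝ w x (EuclideanSpace.single j 1) i := rfl

lemma grad_eq_of_hasFDerivAt {w : Vec d → Vec m} {A : Vec d →L[ℝ] Vec m} {x : Vec d}
    (h : HasFDerivAt w A x) : grad w x = matEquiv A := by rw [grad, h.fderiv]

lemma grad_congr_of_eqOn {w w' : Vec d → Vec m} {U : Set (Vec d)} (hU : IsOpen U)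
    (h : Set.EqOn w w' U) {x : Vec d} (hx : x ∈ U) : grad w x = grad w' x := by
  rw [grad, grad, (h.eventuallyEq_of_mem (hU.mem_nhds hx)).fderiv_eq]

lemma grad_add {w w' : Vec d → Vec m} {x : Vec d} (h : DifferentiableAt ℝ w x)
    (h' : DifferentiableAt ℝ w' x) : grad (fun y => w y + w' y) x = grad w x + grad w' x := by
  rw [grad_eq_of_hasFDerivAt (h.hasFDerivAt.fun_add h'.hasFDerivAt), map_add, grad, grad]

lemma grad_const (c : Vec m) (x : Vec d) : grad (fun _ => c) x = 0 := by
  rw [grad_eq_of_hasFDerivAt (hasFDerivAt_const c x), map_zero]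

lemma grad_eq_zero_of_eqOn {w : Vec d → Vec m} {U : Set (Vec d)} (hU : IsOpen U)
    (h : ∀ y ∈ U, w y = 0) {x : Vec d} (hx : x ∈ U) : grad w x = 0 := by
  rw [grad_congr_of_eqOn hU (w' := fun _ => 0) h hx, grad_const]

lemma grad_ae_eq_zero {w : Vec d → Vec m} {D : Set (Vec d)} (hD : volume (frontier D) = 0)
    (hw : ∀ x ∉ D, w x = 0) : ∀ᵐ x, x ∉ D → grad w x = 0 := by
  filter_upwards [compl_mem_ae_iff.2 hD] with x hx hxD
  refine grad_eq_zero_of_eqOn isClosed_closure.isOpen_compl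
    (fun y hy => hw y fun hyD => hy (subset_closure hyD)) fun hx' => hx ?_
  exact ⟨hx', fun hi => hxD (interior_subset hi)⟩

lemma measurable_grad (w : Vec d → Vec m) : Measurable (grad w) :=
  matEquiv.continuous.measurable.comp (measurable_fderiv ℝ w)

/-- The operator norm of `matEquiv`, which bounds the Frobenius norm of a matrix by its operator
norm. -/
def frobConst (m d : ℕ) : ℝ := ‖((matEquiv : (Vec d →L[ℝ] Vec m) ≃L[ℝ] Mat m d) :
  (Vec d →L[ℝ] Vec m) →L[ℝ] Mat m d)‖

lemma frobConst_nonneg : 0 ≤ frobConst m d := by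
  rw [frobConst]
  positivity

lemma norm_matEquiv_le (A : Vec d →L[ℝ] Vec m) : ‖matEquiv A‖ ≤ frobConst m d * ‖A‖ :=
  ContinuousLinearMap.le_opNorm ((matEquiv : (Vec d →L[ℝ] Vec m) ≃L[ℝ] Mat m d) :
    (Vec d →L[ℝ] Vec m) →L[ℝ] Mat m d) A

lemma norm_grad_le {w : Vec d → Vec m} {K : ℝ≥0} (hw : LipschitzWith K w) (x : Vec d) :
    ‖grad w x‖ ≤ frobConst m d * K :=
  (norm_matEquiv_le _).trans
    (mul_le_mul_of_nonneg_left (norm_fderiv_le_of_lipschitz ℝ hw) frobConst_nonneg)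

/-- The affine map with gradient `ξ` taking the value `c` at `a`. -/
def aff (ξ : Mat m d) (a : Vec d) (c : Vec m) (x : Vec d) : Vec m := c + matEquiv.symm ξ (x - a)

lemma hasFDerivAt_aff (ξ : Mat m d) (a : Vec d) (c : Vec m) (x : Vec d) :
    HasFDerivAt (aff ξ a c) (matEquiv.symm ξ) x := by
  exact (((matEquiv.symm ξ).hasFDerivAt (x := x - a)).comp x
    ((hasFDerivAt_id x).sub_const a)).const_add c

lemma grad_aff (ξ : Mat m d) (a : Vec d) (c : Vec m) (x : Vec d) : grad (aff ξ a c) x = ξ := by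
  rw [grad_eq_of_hasFDerivAt (hasFDerivAt_aff ξ a c x), ContinuousLinearEquiv.apply_symm_apply]

lemma lipschitzWith_aff (ξ : Mat m d) (a : Vec d) (c : Vec m) :
    LipschitzWith ‖matEquiv.symm ξ‖₊ (aff ξ a c) := by
  refine LipschitzWith.of_dist_le_mul fun x y => ?_
  have hsub : aff ξ a c x - aff ξ a c y = matEquiv.symm ξ (x - y) := by
    simp only [aff, map_sub]
    abel
  rw [dist_eq_norm, dist_eq_norm, hsub]
  exact ContinuousLinearMap.le_opNorm _ _

lemma grad_scale {ε : ℝ} (hε : ε ≠ 0) (b : Vec d) (w : Vec d → Vec m) (x : Vec d) :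
    grad (fun y => ε • w (ε⁻¹ • y - b)) x = grad w (ε⁻¹ • x - b) := by
  have houter : fderiv ℝ (fun y => ε • w (ε⁻¹ • y - b)) x
      = ε • fderiv ℝ (fun y => w (ε⁻¹ • y - b)) x :=
    congrFun (fderiv_const_smul_field (f := fun y => w (ε⁻¹ • y - b)) ε) x
  have hinner : fderiv ℝ (fun y => w (ε⁻¹ • y - b)) x
      = ε⁻¹ • fderiv ℝ (fun y => w (y - b)) (ε⁻¹ • x) :=
    fderiv_comp_smul (f := fun y => w (y - b)) (x := x) ε⁻¹
  rw [grad, grad, houter, hinner, fderiv_comp_sub, smul_smul, mul_inv_cancel₀ hε, one_smul]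

lemma lipschitzWith_scale {E F : Type*} [NormedAddCommGroup E] [NormedSpace ℝ E]
    [NormedAddCommGroup F] [NormedSpace ℝ F] {ε : ℝ} (hε : ε ≠ 0) (b : E) {w : E → F} {K : ℝ≥0}
    (hw : LipschitzWith K w) : LipschitzWith K (fun y => ε • w (ε⁻¹ • y - b)) := by
  refine LipschitzWith.of_dist_le_mul fun x y => ?_
  rw [dist_smul₀]
  calc ‖ε‖ * dist (w (ε⁻¹ • x - b)) (w (ε⁻¹ • y - b))
      ≤ ‖ε‖ * (K * dist (ε⁻¹ • x - b) (ε⁻¹ • y - b)) := by gcongr; exact hw.dist_le_mul _ _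
    _ = K * dist x y := by
      have : ‖ε‖ ≠ 0 := norm_ne_zero_iff.2 hε
      rw [dist_sub_right, dist_smul₀, norm_inv]
      field_simp

end Gradient

section WeakDirectionalDerivative

section

variable {X : Type*} [TopologicalSpace X] [MeasurableSpace X] {μ : Measure X} {D : Set X}
  {g φ : X → ℝ}

lemma setIntegral_mul_of_tsupport_subset (hφ : tsupport φ ⊆ D) :
    ∫ x in D, g x * φ x ∂μ = ∫ x, g x * φ x ∂μ :=
  setIntegral_eq_integral_of_forall_compl_eq_zero fun x hx => by
    rw [image_eq_zero_of_notMem_tsupport fun h => hx (hφ h), mul_zero]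

lemma integrable_mul_of_hasCompactSupport [OpensMeasurableSpace X] [IsFiniteMeasureOnCompacts μ]
    (hg : MemLp g ⊤ (μ.restrict D)) (hφ : Continuous φ) (hc : HasCompactSupport φ) :
    Integrable (fun x => g x * φ x) (μ.restrict D) :=
  (hφ.integrable_of_hasCompactSupport hc).restrict.mul_of_top_right hg

end

variable {E : Type*} [NormedAddCommGroup E] [NormedSpace ℝ E] [MeasurableSpace E] {μ : Measure E}
  {D D' : Set E} {v v' g g' : E → ℝ} {e : E}

/-- `g` is the distributional derivative of the scalar function `v` in the direction `e`, in the
set `D`. `HasWeakGradient` is this notion for each entry of a matrix-valued `g`. -/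
def HasWeakDirDeriv (μ : Measure E) (D : Set E) (v g : E → ℝ) (e : E) : Prop :=
  ∀ φ : E → ℝ, ContDiff ℝ ∞ φ → HasCompactSupport φ → tsupport φ ⊆ D →
    ∫ x in D, v x * fderiv ℝ φ x e ∂μ = -∫ x in D, g x * φ x ∂μ

lemma hasWeakDirDeriv_iff : HasWeakDirDeriv μ D v g e ↔
    ∀ φ : E → ℝ, ContDiff ℝ ∞ φ → HasCompactSupport φ → tsupport φ ⊆ D →
      ∫ x, v x * fderiv ℝ φ x e ∂μ = -∫ x, g x * φ x ∂μ := by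
  refine forall₄_congr fun φ _ _ hD => ?_
  rw [setIntegral_mul_of_tsupport_subset hD,
    setIntegral_mul_of_tsupport_subset ((tsupport_fderiv_apply_subset ℝ e).trans hD)]

lemma HasWeakDirDeriv.mono (h : HasWeakDirDeriv μ D v g e) (hD : D' ⊆ D) :
    HasWeakDirDeriv μ D' v g e :=
  hasWeakDirDeriv_iff.2 fun φ hφ hc hs => hasWeakDirDeriv_iff.1 h φ hφ hc (hs.trans hD)

lemma HasWeakDirDeriv.congr_left (h : HasWeakDirDeriv μ D v g e) (hv : v =ᵐ[μ.restrict D] v') :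
    HasWeakDirDeriv μ D v' g e := by
  intro φ hφ hc hs
  rw [← h φ hφ hc hs]
  refine integral_congr_ae ?_
  filter_upwards [hv] with x hx
  rw [hx]

lemma HasWeakDirDeriv.add [OpensMeasurableSpace E] [IsFiniteMeasureOnCompacts μ]
    (h : HasWeakDirDeriv μ D v g e) (h' : HasWeakDirDeriv μ D v' g' e)
    (hv : MemLp v ⊤ (μ.restrict D)) (hv' : MemLp v' ⊤ (μ.restrict D))
    (hg : MemLp g ⊤ (μ.restrict D)) (hg' : MemLp g' ⊤ (μ.restrict D)) :
    HasWeakDirDeriv μ D (fun x => v x + v' x) (fun x => g x + g' x) e := by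
  intro φ hφ hc hs
  have hdφ : Continuous fun x => fderiv ℝ φ x e :=
    (hφ.continuous_fderiv (by simp)).clm_apply continuous_const
  have hdc : HasCompactSupport fun x => fderiv ℝ φ x e := hc.fderiv_apply ℝ e
  simp only [add_mul]
  rw [integral_add (integrable_mul_of_hasCompactSupport hv hdφ hdc)
      (integrable_mul_of_hasCompactSupport hv' hdφ hdc),
    integral_add (integrable_mul_of_hasCompactSupport hg hφ.continuous hc)
      (integrable_mul_of_hasCompactSupport hg' hφ.continuous hc),
    h φ hφ hc hs, h' φ hφ hc hs]
  ring

variable [FiniteDimensional ℝ E] [BorelSpace E]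

lemma HasWeakDirDeriv.ae_eq [IsLocallyFiniteMeasure μ] (hD : IsOpen D)
    (h : HasWeakDirDeriv μ D v g e) (h' : HasWeakDirDeriv μ D v g' e)
    (hg : MemLp g ⊤ (μ.restrict D)) (hg' : MemLp g' ⊤ (μ.restrict D)) :
    g =ᵐ[μ.restrict D] g' := by
  have hdiff : ∀ᵐ x ∂μ, x ∈ D → g x - g' x = 0 := by
    refine hD.ae_eq_zero_of_integral_contDiff_smul_eq_zero
      (locallyIntegrableOn_of_locallyIntegrable_restrict
        ((hg.sub hg').locallyIntegrable le_top)) fun φ hφ hc hs => ?_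
    calc ∫ x, φ x • (g x - g' x) ∂μ = ∫ x, (g x - g' x) * φ x ∂μ := by
          simp only [smul_eq_mul, mul_comm]
      _ = ∫ x in D, (g x * φ x - g' x * φ x) ∂μ := by
          rw [← setIntegral_mul_of_tsupport_subset hs]
          simp only [sub_mul]
      _ = (∫ x in D, g x * φ x ∂μ) - ∫ x in D, g' x * φ x ∂μ :=
          integral_sub (integrable_mul_of_hasCompactSupport hg hφ.continuous hc)
            (integrable_mul_of_hasCompactSupport hg' hφ.continuous hc)
      _ = 0 := by linarith [h φ hφ hc hs, h' φ hφ hc hs]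
  filter_upwards [ae_restrict_of_ae hdiff, ae_restrict_mem hD.measurableSet] with x hx hxD
    using sub_eq_zero.1 (hx hxD)

variable [μ.IsAddHaarMeasure]

lemma hasWeakDirDeriv_of_lipschitz {K : ℝ≥0} (hv : LipschitzWith K v) (D : Set E) (e : E) :
    HasWeakDirDeriv μ D v (fun x => lineDeriv ℝ v x e) e := by
  refine hasWeakDirDeriv_iff.2 fun φ hφ hc _ => ?_
  obtain ⟨L, hL⟩ : ∃ L, LipschitzWith L φ :=
    ContDiff.lipschitzWith_of_hasCompactSupport hc hφ (by simp)
  rw [hv.integral_lineDeriv_mul_eq hL hc, ← integral_neg]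
  congr 1 with x
  rw [((hφ.differentiable (by simp)).differentiableAt).lineDeriv_eq_fderiv, map_neg]
  ring

lemma tsupport_normed_comp_sub_subset (η : ContDiffBump (0 : E)) (z : E) :
    tsupport (fun t => η.normed μ (z - t)) ⊆ Metric.closedBall z η.rOut := by
  refine closure_minimal (fun t ht => ?_) Metric.isClosed_closedBall
  have hzt : z - t ∈ Function.support (η.normed μ) := ht
  rw [η.support_normed_eq, mem_ball_zero_iff] at hzt
  rw [Metric.mem_closedBall, dist_comm, dist_eq_norm]
  exact hzt.le

lemma HasWeakDirDeriv.convolution_fderiv_apply (hD : MeasurableSet D)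
    (h : HasWeakDirDeriv μ D v g e) (hv : LocallyIntegrable (D.indicator v) μ) {ρ : E → ℝ}
    (hρ : ContDiff ℝ ∞ ρ) (hc : HasCompactSupport ρ) {z : E}
    (hz : tsupport (fun t => ρ (z - t)) ⊆ D) :
    convolution (fderiv ℝ ρ) (D.indicator v) ((ContinuousLinearMap.lsmul ℝ ℝ).precompL E) μ z e
      = ∫ t in D, g t * ρ (z - t) ∂μ := by
  have hrefl : ∀ t, fderiv ℝ (fun s => ρ (z - s)) t e = -fderiv ℝ ρ (z - t) e := fun t => by
    have hcomp : HasFDerivAt (fun s => ρ (z - s)) ((fderiv ℝ ρ (z - t)).comp (-.id ℝ E)) t :=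
      ((hρ.differentiable (by simp)) (z - t)).hasFDerivAt.comp t ((hasFDerivAt_id t).const_sub z)
    simp [hcomp.fderiv]
  have hcz : HasCompactSupport fun t => ρ (z - t) :=
    hc.comp_homeomorph (Homeomorph.subLeft z)
  have hex := (hc.fderiv ℝ).convolutionExists_left
    ((ContinuousLinearMap.lsmul ℝ ℝ).precompL E) (hρ.continuous_fderiv (by simp)) hv z
  rw [convolution_def, ContinuousLinearMap.integral_apply hex,
    ← integral_sub_left_eq_self (μ := μ) _ z, ← neg_neg (∫ t in D, g t * ρ (z - t) ∂μ),
    ← h (fun t => ρ (z - t)) (hρ.comp (contDiff_const.sub contDiff_id)) hcz hz,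
    ← integral_indicator hD, ← integral_neg]
  congr 1 with t
  by_cases ht : t ∈ D
  · simp only [sub_sub_cancel, ContinuousLinearMap.precompL_apply,
      ContinuousLinearMap.lsmul_apply, smul_eq_mul, Set.indicator_of_mem ht, hrefl]
    ring
  · simp [Set.indicator_of_notMem ht]

lemma abs_setIntegral_mul_normed_le {C : ℝ} (hg : ∀ᵐ x ∂(μ.restrict D), |g x| ≤ C)
    (η : ContDiffBump (0 : E)) {z : E} (hz : Metric.closedBall z η.rOut ⊆ D) :
    |∫ t in D, g t * η.normed μ (z - t) ∂μ| ≤ C := by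
  have hint : Integrable (fun t => η.normed μ (z - t)) μ :=
    (integrable_comp_sub_left _ z).2 η.integrable_normed
  calc |∫ t in D, g t * η.normed μ (z - t) ∂μ| ≤ ∫ t in D, C * η.normed μ (z - t) ∂μ := by
        rw [← Real.norm_eq_abs]
        refine norm_integral_le_of_norm_le (hint.restrict.const_mul C) ?_
        filter_upwards [hg] with t ht
        rw [norm_mul, Real.norm_eq_abs, Real.norm_eq_abs, abs_of_nonneg (η.nonneg_normed _)]
        exact mul_le_mul_of_nonneg_right ht (η.nonneg_normed _)
    _ = C := by
        rw [setIntegral_mul_of_tsupport_subset ((tsupport_normed_comp_sub_subset η z).trans hz),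
          integral_const_mul, integral_sub_left_eq_self (μ := μ) (η.normed μ) z,
          η.integral_normed, mul_one]

end WeakDirectionalDerivative

section LipschitzRepresentative

variable {D : Set (Vec d)} {v : Vec d → ℝ} {g : Fin d → Vec d → ℝ} {C : ℝ}

lemma abs_convolution_normed_sub_le (hD : IsOpen D) (hC : 0 ≤ C)
    (hv : LocallyIntegrable (D.indicator v))
    (hg : ∀ j, ∀ᵐ x ∂(volume.restrict D), |g j x| ≤ C)
    (hvg : ∀ j, HasWeakDirDeriv volume D v (g j) (EuclideanSpace.single j 1))
    (η : ContDiffBump (0 : Vec d)) {x y : Vec d}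
    (hxy : ∀ z ∈ segment ℝ x y, Metric.closedBall z η.rOut ⊆ D) :
    |convolution (η.normed volume) (D.indicator v) (ContinuousLinearMap.lsmul ℝ ℝ) volume x
      - convolution (η.normed volume) (D.indicator v) (ContinuousLinearMap.lsmul ℝ ℝ) volume y|
      ≤ d * C * ‖x - y‖ := by
  refine (convex_segment (𝕜 := ℝ) x y).norm_image_sub_le_of_norm_hasFDerivWithin_le
    (fun z _ => (η.hasCompactSupport_normed.hasFDerivAt_convolution_left
      (ContinuousLinearMap.lsmul ℝ ℝ) η.contDiff_normed hv z).hasFDerivWithinAt)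
    (fun z hz => ?_) (right_mem_segment ℝ x y) (left_mem_segment ℝ x y)
  have hpartial : ∀ j, |convolution (fderiv ℝ (η.normed volume)) (D.indicator v)
      ((ContinuousLinearMap.lsmul ℝ ℝ).precompL (Vec d)) volume z (EuclideanSpace.single j 1)|
      ≤ C := fun j => by
    rw [(hvg j).convolution_fderiv_apply hD.measurableSet hv η.contDiff_normed
      η.hasCompactSupport_normed ((tsupport_normed_comp_sub_subset η z).trans (hxy z hz))]
    exact abs_setIntegral_mul_normed_le (hg j) η (hxy z hz)
  simpa using opNorm_le_card_mul _ hC hpartial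

lemma exists_lipschitz_set (hD : IsOpen D) (hDc : Convex ℝ D) (hC : 0 ≤ C)
    (hv : MemLp v ⊤ (volume.restrict D)) (hg : ∀ j, ∀ᵐ x ∂(volume.restrict D), |g j x| ≤ C)
    (hvg : ∀ j, HasWeakDirDeriv volume D v (g j) (EuclideanSpace.single j 1)) :
    ∃ S : Set (Vec d), (∀ᵐ x ∂(volume.restrict D), x ∈ S) ∧
      ∀ x ∈ S, ∀ y ∈ S, |v x - v y| ≤ d * C * ‖x - y‖ := by
  have hint : LocallyIntegrable (D.indicator v) :=
    ((memLp_indicator_iff_restrict hD.measurableSet).2 hv).locallyIntegrable le_top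
  let η : ℕ → ContDiffBump (0 : Vec d) := fun k =>
    ⟨1 / ((k : ℝ) + 1), 2 * (1 / ((k : ℝ) + 1)), by positivity,
      lt_mul_of_one_lt_left (by positivity) one_lt_two⟩
  have hη : Tendsto (fun k => (η k).rOut) atTop (𝓝 0) := by
    simpa only [mul_zero] using (tendsto_one_div_add_atTop_nhds_zero_nat (𝕜 := ℝ)).const_mul 2
  let W : ℕ → Vec d → ℝ := fun k => convolution ((η k).normed volume) (D.indicator v)
    (ContinuousLinearMap.lsmul ℝ ℝ) volume
  have hW : ∀ᵐ x, Tendsto (fun k => W k x) atTop (𝓝 (D.indicator v x)) :=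
    ContDiffBump.ae_convolution_tendsto_right_of_locallyIntegrable (φ := η) (K := 2) hη
      (Eventually.of_forall fun k => le_rfl) hint
  refine ⟨{x | Tendsto (fun k => W k x) atTop (𝓝 (v x))} ∩ D, ?_, ?_⟩
  · filter_upwards [ae_restrict_of_ae hW, ae_restrict_mem hD.measurableSet] with x hx hxD
    rw [Set.indicator_of_mem hxD] at hx
    exact ⟨hx, hxD⟩
  rintro x ⟨hx, hxD⟩ y ⟨hy, hyD⟩
  have hcomp : IsCompact (segment ℝ x y) := by
    rw [segment_eq_image_lineMap]
    exact isCompact_Icc.image AffineMap.lineMap_continuous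
  obtain ⟨δ, hδ, hδD⟩ := hcomp.exists_cthickening_subset_open hD (hDc.segment_subset hxD hyD)
  refine le_of_tendsto (hx.sub hy).abs ?_
  filter_upwards [hη.eventually (gt_mem_nhds hδ)] with k hk
  exact abs_convolution_normed_sub_le hD hC hint hg hvg (η k) fun z hz =>
    (Metric.closedBall_subset_closedBall hk.le).trans
      ((Metric.closedBall_subset_cthickening hz δ).trans hδD)

end LipschitzRepresentative

section WeakGradient

variable {Ω D : Set (Vec d)} {u v w : Vec d → Vec m} {g g' : Vec d → Mat m d} {K : ℝ≥0}

lemma hasWeakGradient_iff : HasWeakGradient Ω u g ↔ ∀ (i : Fin m) (j : Fin d),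
    HasWeakDirDeriv volume Ω (fun x => u x i) (fun x => g x (i, j))
      (EuclideanSpace.single j 1) :=
  ⟨fun h i j φ hφ hc hs => h φ hφ hc hs i j, fun h φ hφ hc hs i j => h i j φ hφ hc hs⟩

lemma HasWeakGradient.congr_left (h : HasWeakGradient Ω u g)
    (huv : u =ᵐ[volume.restrict Ω] v) : HasWeakGradient Ω v g :=
  hasWeakGradient_iff.2 fun i j => (hasWeakGradient_iff.1 h i j).congr_left <| by
    filter_upwards [huv] with x hx
    rw [hx]

lemma HasWeakGradient.mono (h : HasWeakGradient Ω u g) (hD : D ⊆ Ω) : HasWeakGradient D u g :=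
  hasWeakGradient_iff.2 fun i j => (hasWeakGradient_iff.1 h i j).mono hD

lemma HasWeakGradient.add (h : HasWeakGradient Ω u g) (h' : HasWeakGradient Ω v g')
    (hu : MemLp u ⊤ (volume.restrict Ω)) (hv : MemLp v ⊤ (volume.restrict Ω))
    (hg : MemLp g ⊤ (volume.restrict Ω)) (hg' : MemLp g' ⊤ (volume.restrict Ω)) :
    HasWeakGradient Ω (u + v) (g + g') :=
  hasWeakGradient_iff.2 fun i j => (hasWeakGradient_iff.1 h i j).add
    (hasWeakGradient_iff.1 h' i j) (memLp_apply hu i) (memLp_apply hv i) (memLp_apply hg _)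
    (memLp_apply hg' _)

lemma HasWeakGradient.ae_eq (hΩ : IsOpen Ω) (h : HasWeakGradient Ω u g)
    (h' : HasWeakGradient Ω u g') (hg : MemLp g ⊤ (volume.restrict Ω))
    (hg' : MemLp g' ⊤ (volume.restrict Ω)) : g =ᵐ[volume.restrict Ω] g' := by
  have hentry : ∀ p : Fin m × Fin d, ∀ᵐ x ∂(volume.restrict Ω), g x p = g' x p := fun p =>
    (hasWeakGradient_iff.1 h p.1 p.2).ae_eq hΩ (hasWeakGradient_iff.1 h' p.1 p.2)
      (memLp_apply hg p) (memLp_apply hg' p)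
  filter_upwards [ae_all_iff.2 hentry] with x hx
  ext p
  exact hx p

lemma lineDeriv_apply_ae_eq_grad (hw : LipschitzWith K w) (i : Fin m) (j : Fin d) :
    (fun x => lineDeriv ℝ (fun y => w y i) x (EuclideanSpace.single j 1)) =ᵐ[volume]
      fun x => grad w x (i, j) := by
  filter_upwards [hw.ae_differentiableAt (μ := volume)] with x hx
  have hcomp : HasFDerivAt (fun y => w y i)
      ((EuclideanSpace.proj i : Vec m →L[ℝ] ℝ).comp (fderiv ℝ w x)) x :=
    (EuclideanSpace.proj i : Vec m →L[ℝ] ℝ).hasFDerivAt.comp x hx.hasFDerivAt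
  rw [(hcomp.hasLineDerivAt _).lineDeriv, grad_apply]
  rfl

lemma hasWeakGradient_of_lipschitz (hw : LipschitzWith K w) (Ω : Set (Vec d)) :
    HasWeakGradient Ω w (grad w) := by
  refine hasWeakGradient_iff.2 fun i j φ hφ hc hs => ?_
  rw [hasWeakDirDeriv_of_lipschitz (lipschitzWith_apply hw i) Ω _ φ hφ hc hs]
  congr 1
  refine integral_congr_ae ?_
  filter_upwards [ae_restrict_of_ae (lineDeriv_apply_ae_eq_grad hw i j)] with x hx
  rw [hx]

lemma memLp_top_of_lipschitz (hw : LipschitzWith K w) (hΩ : MeasurableSet Ω)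
    (hΩb : Bornology.IsBounded Ω) : MemLp w ⊤ (volume.restrict Ω) := by
  obtain ⟨R, hR⟩ := (hw.isBounded_image hΩb).exists_norm_le
  refine memLp_top_of_bound hw.continuous.aestronglyMeasurable R ?_
  filter_upwards [ae_restrict_mem hΩ] with x hx using hR _ (Set.mem_image_of_mem w hx)

lemma memLp_top_grad (hw : LipschitzWith K w) (μ : Measure (Vec d)) : MemLp (grad w) ⊤ μ :=
  memLp_top_of_bound (measurable_grad w).aestronglyMeasurable _
    (Eventually.of_forall fun x => norm_grad_le hw x)

lemma exists_lipschitz_representative (m d : ℕ) (C : ℝ≥0) : ∃ K : ℝ≥0, ∀ D : Set (Vec d),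
    IsOpen D → Convex ℝ D → ∀ u : W1inf D m,
    (∀ᵐ x ∂(volume.restrict D), ‖u.grad x‖ ≤ C) →
    ∃ w : Vec d → Vec m, LipschitzWith K w ∧ u.toFun =ᵐ[volume.restrict D] w ∧
      u.grad =ᵐ[volume.restrict D] grad w := by
  refine ⟨lipschitzExtensionConstant (Vec m) * (m * (d * C)), fun D hD hDc u hu => ?_⟩
  have hcomponent : ∀ i : Fin m, ∃ S : Set (Vec d), (∀ᵐ x ∂(volume.restrict D), x ∈ S) ∧
      ∀ x ∈ S, ∀ y ∈ S, |u.toFun x i - u.toFun y i| ≤ d * C * ‖x - y‖ := fun i =>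
    exists_lipschitz_set hD hDc C.2 (memLp_apply u.memLp_toFun i)
      (fun j => hu.mono fun x hx => (PiLp.norm_apply_le (u.grad x) (i, j)).trans hx)
      (hasWeakGradient_iff.1 u.hasWeakGradient i)
  choose S hS hlipS using hcomponent
  have hlip : LipschitzOnWith (m * (d * C)) u.toFun (⋂ i, S i) :=
    LipschitzOnWith.of_dist_le_mul fun x hx y hy => by
      rw [dist_eq_norm, dist_eq_norm]
      refine (norm_le_card_mul (u.toFun x - u.toFun y) fun i =>
        hlipS i x (Set.mem_iInter.1 hx i) y (Set.mem_iInter.1 hy i)).trans_eq ?_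
      rw [Fintype.card_fin]
      push_cast
      ring
  obtain ⟨w, hw, hwu⟩ := hlip.extend_finite_dimension
  have hae : u.toFun =ᵐ[volume.restrict D] w :=
    (ae_all_iff.2 hS).mono fun x hx => hwu (Set.mem_iInter.2 hx)
  exact ⟨w, hw, hae, (u.hasWeakGradient.congr_left hae).ae_eq hD
    (hasWeakGradient_of_lipschitz hw D) u.memLp_grad (memLp_top_grad hw _)⟩

end WeakGradient

section ExtensionByZero

lemma inter_frontier_nonempty_of_isPreconnected {X : Type*} [TopologicalSpace X] {T D : Set X}
    (hT : IsPreconnected T) {x y : X} (hx : x ∈ T) (hxD : x ∈ D) (hy : y ∈ T) (hyD : y ∉ D) :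
    (T ∩ frontier D).Nonempty := by
  by_contra hempty
  have hcover : ∀ z ∈ T, z ∈ closure D → z ∈ interior D := fun z hz hzc => by
    by_contra hzi
    exact hempty ⟨z, hz, hzc, hzi⟩
  obtain ⟨z, -, hzi, hzc⟩ := hT (interior D) (closure D)ᶜ isOpen_interior
    isClosed_closure.isOpen_compl
    (fun z hz => (em (z ∈ closure D)).imp (hcover z hz) id)
    ⟨x, hx, hcover x hx (subset_closure hxD)⟩
    ⟨y, hy, fun hyc => hyD (interior_subset (hcover y hy hyc))⟩
  exact hzc (interior_subset_closure hzi)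

lemma lipschitzWith_indicator {E F : Type*} [NormedAddCommGroup E] [NormedSpace ℝ E]
    [PseudoMetricSpace F] [Zero F] {w : E → F} {K : ℝ≥0} (hw : LipschitzWith K w) {D : Set E}
    (h0 : ∀ x ∈ frontier D, w x = 0) : LipschitzWith K (D.indicator w) := by
  have hcross : ∀ x ∈ D, ∀ y ∉ D, dist (w x) 0 ≤ K * dist x y := fun x hx y hy => by
    obtain ⟨z, hz, hzD⟩ := inter_frontier_nonempty_of_isPreconnected
      (convex_segment (𝕜 := ℝ) x y).isPreconnected (left_mem_segment ℝ x y) hx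
      (right_mem_segment ℝ x y) hy
    calc dist (w x) 0 = dist (w x) (w z) := by rw [h0 z hzD]
      _ ≤ K * dist x z := hw.dist_le_mul x z
      _ ≤ K * dist x y := by
        gcongr
        exact (le_add_of_nonneg_right dist_nonneg).trans_eq (dist_add_dist_of_mem_segment hz)
  refine LipschitzWith.of_dist_le_mul fun x y => ?_
  by_cases hx : x ∈ D <;> by_cases hy : y ∈ D
  · simpa [hx, hy] using hw.dist_le_mul x y
  · simpa [hx, hy] using hcross x hx y hy
  · rw [dist_comm, dist_comm x y]
    simpa [hx, hy] using hcross y hy x hx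
  · simp only [Set.indicator_of_notMem hx, Set.indicator_of_notMem hy, dist_self]
    positivity

end ExtensionByZero

namespace W1inf

variable {Ω D : Set (Vec d)} {w : Vec d → Vec m} {K : ℝ≥0}

/-- A Lipschitz function as an element of `W^{1,∞}(Ω)`, for bounded `Ω`. -/
def ofLipschitz (hw : LipschitzWith K w) (hΩ : MeasurableSet Ω)
    (hΩb : Bornology.IsBounded Ω) : W1inf Ω m where
  toFun := w
  grad := SemiHom.grad w
  memLp_toFun := memLp_top_of_lipschitz hw hΩ hΩb
  memLp_grad := memLp_top_grad hw _
  hasWeakGradient := hasWeakGradient_of_lipschitz hw Ω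

/-- The restriction of an element of `W^{1,∞}(Ω)` to a smaller set. -/
def restrict (u : W1inf Ω m) (hD : D ⊆ Ω) : W1inf D m where
  toFun := u.toFun
  grad := u.grad
  memLp_toFun := u.memLp_toFun.mono_measure (Measure.restrict_mono hD le_rfl)
  memLp_grad := u.memLp_grad.mono_measure (Measure.restrict_mono hD le_rfl)
  hasWeakGradient := u.hasWeakGradient.mono hD

lemma ae_enorm_grad_le (u : W1inf Ω m) :
    ∀ᵐ x ∂(volume.restrict Ω), ‖u.grad x‖ₑ ≤ u.gradNorm := by
  rw [gradNorm, eLpNorm_exponent_top]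
  exact ae_le_eLpNormEssSup

lemma exists_ae_norm_grad_le (u : W1inf Ω m) :
    ∃ C : ℝ≥0, ∀ᵐ x ∂(volume.restrict Ω), ‖u.grad x‖ ≤ C := by
  refine ⟨u.gradNorm.toNNReal, ?_⟩
  filter_upwards [u.ae_enorm_grad_le] with x hx
  have hfin : u.gradNorm ≠ ⊤ := u.memLp_grad.2.ne
  rw [← ENNReal.coe_toNNReal hfin] at hx
  exact_mod_cast hx

lemma IsZeroOnBoundary.exists_extension (hD : IsOpen D) (hDc : Convex ℝ D) {u : W1inf D m}
    (hu : u.IsZeroOnBoundary) :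
    ∃ (K : ℝ≥0) (w : Vec d → Vec m), LipschitzWith K w ∧ (∀ x ∉ D, w x = 0) ∧
      u.grad =ᵐ[volume.restrict D] SemiHom.grad w := by
  obtain ⟨C, hC⟩ := u.exists_ae_norm_grad_le
  obtain ⟨K, hK⟩ := exists_lipschitz_representative m d C
  obtain ⟨w, hw, huw, hgw⟩ := hK D hD hDc u hC
  obtain ⟨v, hv, hv0, huv⟩ := hu
  have hvw : Set.EqOn v w (closure D) :=
    (Measure.eqOn_open_of_ae_eq (huv.symm.trans huw) hD (hv.mono subset_closure)
      hw.continuous.continuousOn).of_subset_closure hv hw.continuous.continuousOn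
        subset_closure le_rfl
  refine ⟨K, D.indicator w, lipschitzWith_indicator hw fun x hx => ?_,
    fun x hx => Set.indicator_of_notMem hx _, ?_⟩
  · rw [← hvw (frontier_subset_closure hx), hv0 x hx]
  · filter_upwards [hgw, ae_restrict_mem hD.measurableSet] with x hx hxD
    rw [hx]
    exact grad_congr_of_eqOn hD (fun y hy => (Set.indicator_of_mem hy w).symm) hxD

lemma isZeroOnBoundary_ofLipschitz (hw : LipschitzWith K w) (hΩ : IsOpen Ω)
    (hΩb : Bornology.IsBounded Ω) (h0 : ∀ x ∉ Ω, w x = 0) :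
    (ofLipschitz hw hΩ.measurableSet hΩb).IsZeroOnBoundary := by
  refine ⟨w, hw.continuous.continuousOn, fun x hx => h0 x ?_, ae_eq_refl _⟩
  rw [hΩ.frontier_eq] at hx
  exact hx.2

end W1inf

section CellFormula

variable {f : Vec d → Mat m d → ℝ≥0∞} {ξ : Mat m d} {w : Vec d → Vec m} {K : ℝ≥0} {ε : ℝ}

lemma homog_le (f : Vec d → Mat m d → ℝ≥0∞) (ξ : Mat m d) {n : ℕ} (hn : 1 ≤ n)
    (hw : LipschitzWith K w) (h0 : ∀ x ∉ cube d n, w x = 0) :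
    homog f ξ ≤ ((n : ℝ≥0∞) ^ d)⁻¹ * ∫⁻ x in cube d n, f x (ξ + grad w x) := by
  refine iInf₂_le_of_le n hn ?_
  gcongr
  exact iInf₂_le_of_le (W1inf.ofLipschitz hw (measurableSet_cube n) (isBounded_cube n))
    (W1inf.isZeroOnBoundary_ofLipschitz hw (isOpen_cube n) (isBounded_cube n) h0) le_rfl

lemma homog_eq_homogBdd_top (f : Vec d → Mat m d → ℝ≥0∞) (ξ : Mat m d) :
    homog f ξ = homogBdd ⊤ f ξ := by
  simp [homog, homogBdd]

lemma exists_of_homogBdd_lt {r a : ℝ≥0∞} (h : homogBdd r f ξ < a) :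
    ∃ n : ℕ, 1 ≤ n ∧ ∃ (K : ℝ≥0) (w : Vec d → Vec m),
      LipschitzWith K w ∧ (∀ x ∉ cube d n, w x = 0) ∧
      (∀ᵐ x ∂(volume.restrict (cube d n)), ‖grad w x‖ₑ ≤ r) ∧
      ((n : ℝ≥0∞) ^ d)⁻¹ * ∫⁻ x in cube d n, f x (ξ + grad w x) < a := by
  simp only [homogBdd, iInf_lt_iff] at h
  obtain ⟨n, hn, h⟩ := h
  have hn0 : ((n : ℝ≥0∞) ^ d)⁻¹ ≠ 0 :=
    ENNReal.inv_ne_zero.2 (ENNReal.pow_ne_top (ENNReal.natCast_ne_top n))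
  have hnt : ((n : ℝ≥0∞) ^ d)⁻¹ ≠ ⊤ :=
    ENNReal.inv_ne_top.2 (pow_ne_zero _ (by exact_mod_cast (by omega : n ≠ 0)))
  simp only [ENNReal.mul_iInf_of_ne hn0 hnt, iInf_lt_iff] at h
  obtain ⟨φ, h0, hr, h⟩ := h
  obtain ⟨K, w, hw, hw0, hg⟩ := h0.exists_extension (isOpen_cube n) (convex_cube n)
  refine ⟨n, hn, K, w, hw, hw0, ?_, ?_⟩
  · filter_upwards [hg, φ.ae_enorm_grad_le] with x hx hx'
    exact hx ▸ hx'.trans hr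
  · rwa [← lintegral_congr_ae (f := fun x => f x (ξ + φ.grad x))]
    filter_upwards [hg] with x hx
    rw [hx]

/-- `f(·, ξ)` is `1`-periodic in each coordinate direction. -/
def IsYPeriodic (f : Vec d → Mat m d → ℝ≥0∞) : Prop :=
  ∀ (ξ : Mat m d) (x : Vec d) (j : Fin d), f (x + EuclideanSpace.single j 1) ξ = f x ξ

lemma IsYPeriodic.sub_intVec (hper : IsYPeriodic f) (ξ : Mat m d) (x : Vec d) (z : Fin d → ℤ) :
    f (x - intVec z) ξ = f x ξ := by
  have hsingle : ∀ j, Function.Periodic (fun x => f x ξ)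
      (z j • EuclideanSpace.single j (1 : ℝ)) :=
    fun j => Function.Periodic.zsmul (fun x => hper ξ x j) (z j)
  have hz : Function.Periodic (fun x => f x ξ) (intVec z) := by
    rw [intVec_eq_sum]
    exact Finset.sum_induction _ (Function.Periodic fun x => f x ξ)
      (fun a b ha hb => ha.add_period hb) (fun x => by simp) fun j _ => hsingle j
  exact hz.sub_eq x

/-- Local boundedness of the integrand: `b R` bounds `f x ξ` for all `x` and all gradients `ξ` of
norm at most `R`. -/
def IsBoundedBy (f : Vec d → Mat m d → ℝ≥0∞) (b : ℝ → ℝ≥0) : Prop :=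
  ∀ ⦃R : ℝ⦄ (x : Vec d) ⦃ξ : Mat m d⦄, ‖ξ‖ ≤ R → f x ξ ≤ b R

lemma setLIntegral_scaledCube_eq (hper : IsYPeriodic f) (hε : 0 < ε) (n : ℕ)
    (z : Fin d → ℤ) (ζ : Vec d → Mat m d) :
    ∫⁻ x in scaledCube ε n z, f (ε⁻¹ • x) (ζ (ε⁻¹ • x - intVec z))
      = ENNReal.ofReal ε ^ d * ∫⁻ y in cube d n, f y (ζ y) := by
  rw [← setLIntegral_comp_scale hε (intVec z) (cube d n)]
  exact lintegral_congr fun x => (hper.sub_intVec _ _ _).symm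

lemma volume_scaledCube_mul_homog_le (hper : IsYPeriodic f) (hε : 0 < ε) {n : ℕ} (hn : 1 ≤ n)
    (z : Fin d → ℤ) (hw : LipschitzWith K w) (h0 : ∀ x ∉ scaledCube ε n z, w x = 0) :
    volume (scaledCube ε n z) * homog f ξ
      ≤ ∫⁻ x in scaledCube ε n z, f (ε⁻¹ • x) (ξ + grad w x) := by
  let Φ : Vec d → Vec m := fun y => ε⁻¹ • w (ε⁻¹⁻¹ • y - -(ε • intVec z))
  have hpoint : ∀ x : Vec d, ε⁻¹⁻¹ • (ε⁻¹ • x - intVec z) - -(ε • intVec z) = x := fun x => by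
    rw [inv_inv, smul_sub, smul_smul, mul_inv_cancel₀ hε.ne', one_smul]
    abel
  have hΦ0 : ∀ y ∉ cube d n, Φ y = 0 := fun y hy => by
    have hy' : ε⁻¹ • (ε⁻¹⁻¹ • y - -(ε • intVec z)) - intVec z = y := by
      rw [inv_inv, sub_neg_eq_add, smul_add, smul_smul, smul_smul, inv_mul_cancel₀ hε.ne',
        one_smul, one_smul, add_sub_cancel_right]
    simp only [Φ, h0 _ fun hmem => hy (hy' ▸ hmem), smul_zero]
  have hn0 : ((n : ℝ≥0∞) ^ d) ≠ 0 :=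
    pow_ne_zero _ (Nat.cast_ne_zero.2 (Nat.one_le_iff_ne_zero.1 hn))
  calc volume (scaledCube ε n z) * homog f ξ
      ≤ (ENNReal.ofReal ε ^ d * (n : ℝ≥0∞) ^ d) *
        (((n : ℝ≥0∞) ^ d)⁻¹ * ∫⁻ y in cube d n, f y (ξ + grad Φ y)) := by
        rw [volume_scaledCube hε]
        gcongr
        exact homog_le f ξ hn (lipschitzWith_scale (inv_ne_zero hε.ne') _ hw) hΦ0
    _ = ENNReal.ofReal ε ^ d * ∫⁻ y in cube d n, f y (ξ + grad Φ y) := by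
        rw [mul_assoc, ← mul_assoc ((n : ℝ≥0∞) ^ d), ENNReal.mul_inv_cancel hn0 (by finiteness),
          one_mul]
    _ = ∫⁻ x in scaledCube ε n z, f (ε⁻¹ • x) (ξ + grad w x) := by
        rw [← setLIntegral_scaledCube_eq hper hε]
        refine lintegral_congr fun x => ?_
        rw [grad_scale (inv_ne_zero hε.ne'), hpoint]

lemma setLIntegral_compl_le_of_eq_zero {A : ℝ≥0∞} (hA : ∀ x, f x ξ ≤ A) {D Q : Set (Vec d)}
    (hD : MeasurableSet D) (hQ : MeasurableSet Q) (hDf : volume (frontier D) = 0)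
    (h0 : ∀ x ∉ D, w x = 0) (ε : ℝ) :
    ∫⁻ x in Q \ D, f (ε⁻¹ • x) (ξ + grad w x) ≤ A * volume (Q \ D) := by
  rw [← setLIntegral_const]
  refine lintegral_mono_ae ?_
  rw [ae_restrict_iff' (hQ.diff hD)]
  filter_upwards [grad_ae_eq_zero hDf h0] with x hx hxQ
  rw [hx hxQ.2, add_zero]
  exact hA _

lemma volume_mul_homog_le (hper : IsYPeriodic f) {A : ℝ≥0∞} (hA : ∀ x, f x ξ ≤ A) (a : Vec d)
    {ρ : ℝ} (hρ : 0 < ρ) (hε : 0 < ε) (hw : LipschitzWith K w) (h0 : ∀ x ∉ box a ρ, w x = 0) :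
    ENNReal.ofReal ρ ^ d * homog f ξ ≤ (∫⁻ x in box a ρ, f (ε⁻¹ • x) (ξ + grad w x)) +
      A * (ENNReal.ofReal (ρ + 2 * ε) ^ d - ENNReal.ofReal ρ ^ d) := by
  obtain ⟨n, z, hn, hle, hsub⟩ := exists_box_subset_scaledCube a hρ hε
  have hlayer : volume (scaledCube ε n z \ box a ρ)
      ≤ ENNReal.ofReal (ρ + 2 * ε) ^ d - ENNReal.ofReal ρ ^ d := by
    rw [measure_sdiff hsub (measurableSet_box a ρ).nullMeasurableSet
      (by rw [volume_box]; finiteness), volume_scaledCube hε, volume_box,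
      ← ENNReal.ofReal_natCast, ← mul_pow, ← ENNReal.ofReal_mul hε.le]
    gcongr
  calc ENNReal.ofReal ρ ^ d * homog f ξ ≤ volume (scaledCube ε n z) * homog f ξ := by
        rw [← volume_box a ρ]
        gcongr
    _ ≤ ∫⁻ x in scaledCube ε n z, f (ε⁻¹ • x) (ξ + grad w x) :=
        volume_scaledCube_mul_homog_le hper hε hn z hw fun x hx => h0 x fun hmem => hx (hsub hmem)
    _ = (∫⁻ x in box a ρ, f (ε⁻¹ • x) (ξ + grad w x))
        + ∫⁻ x in scaledCube ε n z \ box a ρ, f (ε⁻¹ • x) (ξ + grad w x) := by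
        rw [← lintegral_inter_add_sdiff _ (scaledCube ε n z) (measurableSet_box a ρ),
          Set.inter_eq_right.2 hsub]
    _ ≤ _ := by
        gcongr
        refine (setLIntegral_compl_le_of_eq_zero hA (measurableSet_box a ρ)
          (measurableSet_scaledCube ε n z) ((convex_box a ρ).addHaar_frontier volume) h0 ε).trans ?_
        gcongr

end CellFormula

section Cutoff

lemma norm_smul_sub_smul_le {E : Type*} [SeminormedAddCommGroup E] [NormedSpace ℝ E] (a b : ℝ)
    (x y : E) : ‖a • x - b • y‖ ≤ |a - b| * ‖x‖ + |b| * ‖x - y‖ := by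
  have hsplit : a • x - b • y = (a - b) • x + b • (x - y) := by
    rw [sub_smul, smul_sub]
    abel
  rw [hsplit, ← Real.norm_eq_abs, ← Real.norm_eq_abs, ← norm_smul, ← norm_smul]
  exact norm_add_le _ _

lemma abs_min_one_infDist_div_sub_le {X : Type*} [PseudoMetricSpace X] (S : Set X) {s : ℝ}
    (hs : 0 < s) (x y : X) :
    |min 1 (Metric.infDist x S / s) - min 1 (Metric.infDist y S / s)| ≤ dist x y / s := by
  refine (abs_min_sub_min_le_max _ _ _ _).trans ?_
  rw [sub_self, abs_zero, ← sub_div, abs_div, abs_of_pos hs]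
  refine max_le (by positivity) ?_
  gcongr
  simpa [Real.dist_eq] using (Metric.lipschitz_infDist_pt S).dist_le_mul x y

lemma exists_cutoff {X E : Type*} [PseudoMetricSpace X] [SeminormedAddCommGroup E]
    [NormedSpace ℝ E] {D : Set X} (hD : Dᶜ.Nonempty) {v : X → E} {K : ℝ≥0}
    (hv : LipschitzWith K v) {M s : ℝ≥0} (hs : 0 < s) (hM : ∀ x ∈ D, ‖v x‖ ≤ M) :
    ∃ p : X → E, LipschitzWith (K + M / s) p ∧ (∀ x ∉ D, p x = 0) ∧
      ∀ x ∉ Metric.cthickening s Dᶜ, p x = v x := by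
  let θ : X → ℝ := fun x => min 1 (Metric.infDist x Dᶜ / s)
  have hs' : (0 : ℝ) < s := hs
  have hθ0 : ∀ x, 0 ≤ θ x := fun x => le_min zero_le_one (div_nonneg Metric.infDist_nonneg hs'.le)
  have hθD : ∀ x ∉ D, θ x = 0 := fun x hx => by
    simp [θ, Metric.infDist_zero_of_mem (show x ∈ Dᶜ from hx)]
  have hlip : ∀ x ∈ D, ∀ y, ‖θ x • v x - θ y • v y‖ ≤ (K + M / s) * dist x y := fun x hx y =>
    calc ‖θ x • v x - θ y • v y‖ ≤ |θ x - θ y| * ‖v x‖ + |θ y| * ‖v x - v y‖ :=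
          norm_smul_sub_smul_le _ _ _ _
      _ ≤ dist x y / s * M + 1 * (K * dist x y) := by
          gcongr
          · exact abs_min_one_infDist_div_sub_le Dᶜ hs' x y
          · exact hM x hx
          · exact (abs_of_nonneg (hθ0 y)).trans_le (min_le_left _ _)
          · rw [← dist_eq_norm]
            exact hv.dist_le_mul x y
      _ = (K + M / s) * dist x y := by ring
  refine ⟨fun x => θ x • v x, LipschitzWith.of_dist_le_mul fun x y => ?_,
    fun x hx => by simp only [hθD x hx, zero_smul], fun x hx => ?_⟩
  · rw [dist_eq_norm]
    push_cast
    by_cases hx : x ∈ D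
    · exact hlip x hx y
    by_cases hy : y ∈ D
    · rw [norm_sub_rev, dist_comm]
      exact hlip y hy x
    · rw [hθD x hx, hθD y hy, zero_smul, zero_smul, sub_zero, norm_zero]
      positivity
  · have hfar : (s : ℝ) < Metric.infDist x Dᶜ := by
      contrapose! hx
      rwa [Metric.mem_cthickening_iff, ENNReal.le_ofReal_iff_toReal_le
        (Metric.infEDist_ne_top hD) hs'.le]
    have hone : θ x = 1 := min_eq_left ((one_le_div hs').2 hfar.le)
    simp only [hone, one_smul]

lemma tendsto_measure_inter_cthickening_compl {X : Type*} [PseudoEMetricSpace X]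
    [MeasurableSpace X] [OpensMeasurableSpace X] {μ : Measure X} {D : Set X} (hD : IsOpen D)
    (hDμ : μ D ≠ ⊤) : Tendsto (fun s => μ (D ∩ Metric.cthickening s Dᶜ)) (𝓝 0) (𝓝 0) := by
  have : IsFiniteMeasure (μ.restrict D) := ⟨by simpa using hDμ.lt_top⟩
  have hlim := tendsto_measure_cthickening_of_isClosed (μ := μ.restrict D) (s := Dᶜ)
    ⟨1, one_pos, measure_ne_top _ _⟩ hD.isClosed_compl
  rw [Measure.restrict_apply hD.measurableSet.compl, Set.compl_inter_self, measure_empty] at hlim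
  refine hlim.congr fun s => ?_
  rw [Measure.restrict_apply Metric.isClosed_cthickening.measurableSet, Set.inter_comm]

end Cutoff

section DisjointSupport

variable {ι : Type*} {s : Finset ι} {w : ι → Vec d → Vec m} {D : ι → Set (Vec d)}

lemma lipschitzWith_sum {X E : Type*} [PseudoEMetricSpace X] [SeminormedAddCommGroup E]
    {w : ι → X → E} {K : ι → ℝ≥0} (hw : ∀ i ∈ s, LipschitzWith (K i) (w i)) :
    LipschitzWith (∑ i ∈ s, K i) (fun x => ∑ i ∈ s, w i x) := by
  classical
  induction s using Finset.induction_on with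
  | empty => exact LipschitzWith.const 0
  | insert i s hi ih =>
    simp only [Finset.sum_insert hi]
    exact (hw i (Finset.mem_insert_self i s)).add
      (ih fun j hj => hw j (Finset.mem_insert_of_mem hj))

lemma sum_eq_of_pairwiseDisjoint {X E : Type*} [AddCommMonoid E] {w : ι → X → E} {D : ι → Set X}
    (hdisj : (s : Set ι).PairwiseDisjoint D) (h0 : ∀ i ∈ s, ∀ x ∉ D i, w i x = 0) {i : ι}
    (hi : i ∈ s) {x : X} (hx : x ∈ D i) : ∑ j ∈ s, w j x = w i x :=
  Finset.sum_eq_single_of_mem i hi fun j hj hji =>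
    h0 j hj x fun hxj => Set.disjoint_left.1 (hdisj hj hi hji) hxj hx

lemma sum_eq_zero_of_notMem_biUnion {X E : Type*} [AddCommMonoid E] {w : ι → X → E}
    {D : ι → Set X} (h0 : ∀ i ∈ s, ∀ x ∉ D i, w i x = 0) {x : X} (hx : x ∉ ⋃ i ∈ s, D i) :
    ∑ i ∈ s, w i x = 0 :=
  Finset.sum_eq_zero fun i hi => h0 i hi x fun hxi => hx (Set.mem_biUnion hi hxi)

lemma norm_sum_le_of_pairwiseDisjoint {X E : Type*} [SeminormedAddCommGroup E] {w : ι → X → E}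
    {D : ι → Set X} {M : ℝ} (hM : 0 ≤ M) (hdisj : (s : Set ι).PairwiseDisjoint D)
    (h0 : ∀ i ∈ s, ∀ x ∉ D i, w i x = 0) (hw : ∀ i ∈ s, ∀ x, ‖w i x‖ ≤ M) (x : X) :
    ‖∑ i ∈ s, w i x‖ ≤ M := by
  by_cases hx : x ∈ ⋃ i ∈ s, D i
  · obtain ⟨i, hi, hxi⟩ := Set.mem_iUnion₂.1 hx
    rw [sum_eq_of_pairwiseDisjoint hdisj h0 hi hxi]
    exact hw i hi x
  · rwa [sum_eq_zero_of_notMem_biUnion h0 hx, norm_zero]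

lemma measure_frontier_biUnion_finset {X : Type*} [TopologicalSpace X] [MeasurableSpace X]
    {μ : Measure X} {D : ι → Set X} (hD : ∀ i ∈ s, μ (frontier (D i)) = 0) :
    μ (frontier (⋃ i ∈ s, D i)) = 0 := by
  classical
  induction s using Finset.induction_on with
  | empty => simp
  | insert i s _ ih =>
    rw [Finset.set_biUnion_insert]
    refine measure_mono_null ((frontier_union_subset _ _).trans
      (Set.union_subset_union Set.inter_subset_left Set.inter_subset_right)) ?_
    exact measure_union_null (hD i (Finset.mem_insert_self i s))
      (ih fun j hj => hD j (Finset.mem_insert_of_mem hj))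

lemma grad_sum_eq_of_mem (hD : ∀ i ∈ s, IsOpen (D i)) (hdisj : (s : Set ι).PairwiseDisjoint D)
    (h0 : ∀ i ∈ s, ∀ x ∉ D i, w i x = 0) {i : ι} (hi : i ∈ s) {x : Vec d} (hx : x ∈ D i) :
    grad (fun y => ∑ j ∈ s, w j y) x = grad (w i) x :=
  grad_congr_of_eqOn (hD i hi) (fun _ hy => sum_eq_of_pairwiseDisjoint hdisj h0 hi hy) hx

lemma ae_enorm_grad_sum_le (hD : ∀ i ∈ s, IsOpen (D i))
    (hDf : ∀ i ∈ s, volume (frontier (D i)) = 0) (hdisj : (s : Set ι).PairwiseDisjoint D)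
    (h0 : ∀ i ∈ s, ∀ x ∉ D i, w i x = 0) {C : ℝ≥0∞}
    (hC : ∀ i ∈ s, ∀ᵐ x ∂(volume.restrict (D i)), ‖grad (w i) x‖ₑ ≤ C) :
    ∀ᵐ x, ‖grad (fun y => ∑ i ∈ s, w i y) x‖ₑ ≤ C := by
  have hC' : ∀ᵐ x, ∀ i ∈ s, x ∈ D i → ‖grad (w i) x‖ₑ ≤ C :=
    (ae_ball_iff s.countable_toSet).2 fun i hi =>
      (ae_restrict_iff' (hD i hi).measurableSet).1 (hC i hi)
  filter_upwards [hC', grad_ae_eq_zero (measure_frontier_biUnion_finset hDf)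
    fun x => sum_eq_zero_of_notMem_biUnion h0] with x hxC hx0
  by_cases hx : x ∈ ⋃ i ∈ s, D i
  · obtain ⟨i, hi, hxi⟩ := Set.mem_iUnion₂.1 hx
    rw [grad_sum_eq_of_mem hD hdisj h0 hi hxi]
    exact hxC i hi hxi
  · rw [hx0 hx, enorm_zero]
    exact zero_le

end DisjointSupport

section Tiling

variable {Φ : Vec d → Vec m} {K : ℝ≥0} {ε : ℝ} {n : ℕ} {D : Set (Vec d)}

/-- The sum of the copies of a cell function `Φ`, which lives on `cube d n`, rescaled to the tiles
`tile ε n z` with `z ∈ S`. -/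
def tiling (Φ : Vec d → Vec m) (ε : ℝ) (n : ℕ) (S : Finset (Fin d → ℤ)) (x : Vec d) : Vec m :=
  ∑ z ∈ S, ε • Φ (ε⁻¹ • x - intVec (n • z))

lemma lipschitzWith_tiling (hΦ : LipschitzWith K Φ) (hε : ε ≠ 0) (n : ℕ)
    (S : Finset (Fin d → ℤ)) : LipschitzWith (∑ _z ∈ S, K) (tiling Φ ε n S) :=
  lipschitzWith_sum fun _ _ => lipschitzWith_scale hε _ hΦ

lemma smul_comp_scale_eq_zero (h0 : ∀ x ∉ cube d n, Φ x = 0) (ε : ℝ) {z : Fin d → ℤ} {x : Vec d}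
    (hx : x ∉ tile ε n z) : ε • Φ (ε⁻¹ • x - intVec (n • z)) = 0 := by
  rw [h0 _ hx, smul_zero]

lemma tiling_eq_zero (h0 : ∀ x ∉ cube d n, Φ x = 0) (ε : ℝ) {S : Finset (Fin d → ℤ)} {x : Vec d}
    (hx : x ∉ ⋃ z ∈ S, tile ε n z) : tiling Φ ε n S x = 0 :=
  sum_eq_zero_of_notMem_biUnion (fun _ _ _ => smul_comp_scale_eq_zero h0 ε) hx

lemma norm_tiling_le (hn : 1 ≤ n) (h0 : ∀ x ∉ cube d n, Φ x = 0) (hε : 0 ≤ ε) {M : ℝ}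
    (hM : ∀ x, ‖Φ x‖ ≤ M) (S : Finset (Fin d → ℤ)) (x : Vec d) : ‖tiling Φ ε n S x‖ ≤ ε * M := by
  have hM0 : 0 ≤ M := (norm_nonneg _).trans (hM 0)
  refine norm_sum_le_of_pairwiseDisjoint (by positivity)
    ((pairwise_disjoint_tile ε hn).set_pairwise _)
    (fun _ _ _ => smul_comp_scale_eq_zero h0 ε) (fun z _ x => ?_) x
  rw [norm_smul, Real.norm_of_nonneg hε]
  gcongr
  exact hM _

lemma grad_tiling_eq (hn : 1 ≤ n) (h0 : ∀ x ∉ cube d n, Φ x = 0) (hε : ε ≠ 0)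
    {S : Finset (Fin d → ℤ)} {z : Fin d → ℤ} (hz : z ∈ S) {x : Vec d} (hx : x ∈ tile ε n z) :
    grad (tiling Φ ε n S) x = grad Φ (ε⁻¹ • x - intVec (n • z)) :=
  (grad_sum_eq_of_mem (fun z _ => isOpen_scaledCube ε n (n • z))
    ((pairwise_disjoint_tile ε hn).set_pairwise _) (fun _ _ _ => smul_comp_scale_eq_zero h0 ε)
    hz hx).trans (grad_scale hε _ _ _)

lemma ae_enorm_grad_tiling_le (hn : 1 ≤ n) (h0 : ∀ x ∉ cube d n, Φ x = 0) (hε : 0 < ε)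
    {C : ℝ≥0∞} (hC : ∀ᵐ x ∂(volume.restrict (cube d n)), ‖grad Φ x‖ₑ ≤ C)
    (S : Finset (Fin d → ℤ)) : ∀ᵐ x, ‖grad (tiling Φ ε n S) x‖ₑ ≤ C := by
  refine ae_enorm_grad_sum_le (fun z _ => isOpen_scaledCube ε n (n • z))
    (fun z _ => (convex_scaledCube ε n (n • z)).addHaar_frontier volume)
    ((pairwise_disjoint_tile ε hn).set_pairwise _) (fun _ _ _ => smul_comp_scale_eq_zero h0 ε)
    fun z _ => ?_
  rw [ae_restrict_iff' (measurableSet_cube n), ae_iff] at hC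
  have hscale := volume_scale hε (intVec (n • z)) {y | ¬(y ∈ cube d n → ‖grad Φ y‖ₑ ≤ C)}
  rw [hC, mul_zero] at hscale
  rw [ae_restrict_iff' (measurableSet_scaledCube ε n (n • z)), ae_iff]
  simp only [grad_scale hε.ne']
  exact hscale

lemma setLIntegral_tile_tiling_eq {f : Vec d → Mat m d → ℝ≥0∞} (hper : IsYPeriodic f)
    (hn : 1 ≤ n) (h0 : ∀ x ∉ cube d n, Φ x = 0) (hε : 0 < ε) (ξ : Mat m d)
    {S : Finset (Fin d → ℤ)} {z : Fin d → ℤ} (hz : z ∈ S) :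
    ∫⁻ x in tile ε n z, f (ε⁻¹ • x) (ξ + grad (tiling Φ ε n S) x) =
      volume (tile ε n z) * (((n : ℝ≥0∞) ^ d)⁻¹ * ∫⁻ y in cube d n, f y (ξ + grad Φ y)) := by
  have hn0 : ((n : ℝ≥0∞) ^ d) ≠ 0 :=
    pow_ne_zero _ (Nat.cast_ne_zero.2 (Nat.one_le_iff_ne_zero.1 hn))
  rw [volume_scaledCube hε, mul_assoc, ← mul_assoc ((n : ℝ≥0∞) ^ d),
    ENNReal.mul_inv_cancel hn0 (by finiteness), one_mul,
    ← setLIntegral_scaledCube_eq hper hε n (n • z)]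
  refine setLIntegral_congr_fun (measurableSet_scaledCube ε n _) fun x hx => ?_
  simp only [grad_tiling_eq hn h0 hε.ne' hz hx]

lemma finite_tile_subset (hn : 1 ≤ n) (hε : 0 < ε) (hD : volume D ≠ ⊤) :
    {z | tile ε n z ⊆ D}.Finite := by
  have : IsFiniteMeasure (volume.restrict D) := ⟨by simpa using hD.lt_top⟩
  have hpos : 0 < ENNReal.ofReal ε ^ d * (n : ℝ≥0∞) ^ d := by
    have : (0 : ℝ≥0∞) < n := by exact_mod_cast hn
    have : 0 < ENNReal.ofReal ε := by simpa using hε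
    positivity
  refine (Measure.finite_const_le_meas_of_disjoint_iUnion (volume.restrict D) hpos
    (fun z => measurableSet_scaledCube ε n (n • z)) (pairwise_disjoint_tile ε hn)
    (measure_ne_top _ _)).subset fun z (hz : tile ε n z ⊆ D) => ?_
  rw [Set.mem_ofPred_eq, Measure.restrict_apply (measurableSet_scaledCube ε n _),
    Set.inter_eq_left.2 hz, volume_scaledCube hε]

lemma volume_diff_tiles_le (hn : 1 ≤ n) (hε : 0 < ε) {S : Finset (Fin d → ℤ)}
    (hS : ∀ z, tile ε n z ⊆ D → z ∈ S) :
    volume (D \ ⋃ z ∈ S, tile ε n z) ≤ volume (D ∩ Metric.cthickening (d * (ε * n)) Dᶜ) := by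
  refine measure_mono_ae ?_
  filter_upwards [ae_exists_mem_tile hε hn] with x ⟨z, hxz⟩ hx
  have hz : ¬tile ε n z ⊆ D := fun hzD => hx.2 (Set.mem_biUnion (hS z hzD) hxz)
  obtain ⟨y, hy, hyD⟩ := Set.not_subset.1 hz
  exact ⟨hx.1, Metric.mem_cthickening_of_dist_le x y _ _ hyD (dist_le_of_mem_scaledCube hε hxz hy)⟩

lemma setLIntegral_tiling_le {f : Vec d → Mat m d → ℝ≥0∞} (hper : IsYPeriodic f) {ξ : Mat m d}
    {A : ℝ≥0∞} (hA : ∀ x, f x ξ ≤ A) (hn : 1 ≤ n) (h0 : ∀ x ∉ cube d n, Φ x = 0) (hε : 0 < ε)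
    (hD : MeasurableSet D) {S : Finset (Fin d → ℤ)} (hS : ∀ z, z ∈ S ↔ tile ε n z ⊆ D) :
    ∫⁻ x in D, f (ε⁻¹ • x) (ξ + grad (tiling Φ ε n S) x) ≤
      volume D * (((n : ℝ≥0∞) ^ d)⁻¹ * ∫⁻ x in cube d n, f x (ξ + grad Φ x)) +
        A * volume (D ∩ Metric.cthickening (d * (ε * n)) Dᶜ) := by
  let U : Set (Vec d) := ⋃ z ∈ S, tile ε n z
  have htile : ∀ z ∈ S, MeasurableSet (tile ε n z) := fun z _ => measurableSet_scaledCube ε n _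
  have hU : MeasurableSet U := Finset.measurableSet_biUnion S htile
  have hUD : U ⊆ D := Set.iUnion₂_subset fun z hz => (hS z).1 hz
  have hdisj : (S : Set (Fin d → ℤ)).PairwiseDisjoint (tile ε n) :=
    (pairwise_disjoint_tile ε hn).set_pairwise _
  rw [← lintegral_inter_add_sdiff _ D hU, Set.inter_eq_right.2 hUD]
  gcongr
  · rw [lintegral_biUnion_finset hdisj htile, Finset.sum_congr rfl fun z hz =>
      setLIntegral_tile_tiling_eq hper hn h0 hε ξ hz, ← Finset.sum_mul,
      ← measure_biUnion_finset hdisj htile]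
    gcongr
  · refine (setLIntegral_compl_le_of_eq_zero hA hU hD (measure_frontier_biUnion_finset fun z _ =>
      (convex_scaledCube ε n (n • z)).addHaar_frontier volume)
      (fun x => tiling_eq_zero h0 ε) ε).trans ?_
    exact mul_le_mul_right (volume_diff_tiles_le hn hε fun z => (hS z).2) A

end Tiling

section Perturbation

variable {Ω : Set (Vec d)} {w : Vec d → Vec m} {K : ℝ≥0} {ψ : ℝ → Vec d → Vec m} {M R : ℝ}

lemma abs_integral_grad_mul_le (hw : LipschitzWith K w) (hM : ∀ x, ‖w x‖ ≤ M) {φ : Vec d → ℝ}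
    (hφ : ContDiff ℝ ∞ φ) (hc : HasCompactSupport φ) (i : Fin m) (j : Fin d) :
    |∫ x, grad w x (i, j) * φ x| ≤ M * ∫ x, |fderiv ℝ φ x (EuclideanSpace.single j 1)| := by
  have hdφ : Integrable fun x => fderiv ℝ φ x (EuclideanSpace.single j 1) :=
    ((hφ.continuous_fderiv (by simp)).clm_apply continuous_const).integrable_of_hasCompactSupport
      (hc.fderiv_apply ℝ _)
  have hparts := hasWeakGradient_of_lipschitz hw Set.univ φ hφ hc (Set.subset_univ _) i j
  rw [setIntegral_univ, setIntegral_univ] at hparts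
  rw [← abs_neg, ← hparts, ← integral_const_mul, ← Real.norm_eq_abs]
  refine norm_integral_le_of_norm_le (hdφ.abs.const_mul M) (Eventually.of_forall fun x => ?_)
  rw [norm_mul, Real.norm_eq_abs (fderiv ℝ φ x _)]
  gcongr
  exact (PiLp.norm_apply_le _ _).trans (hM x)

lemma abs_integral_grad_mul_le_add (hw : LipschitzWith K w) (hM : ∀ x, ‖w x‖ ≤ M)
    (hR : ∀ᵐ x, ‖grad w x‖ ≤ R) {h φ : Vec d → ℝ} (hh : Integrable h) (hφ : ContDiff ℝ ∞ φ)
    (hc : HasCompactSupport φ) (i : Fin m) (j : Fin d) :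
    |∫ x, grad w x (i, j) * h x| ≤ R * (∫ x, |h x - φ x|) +
      M * ∫ x, |fderiv ℝ φ x (EuclideanSpace.single j 1)| := by
  have hφi : Integrable φ := hφ.continuous.integrable_of_hasCompactSupport hc
  have hg : MemLp (fun x => grad w x (i, j)) ⊤ volume := memLp_apply (memLp_top_grad hw _) _
  have hsplit : ∫ x, grad w x (i, j) * h x =
      (∫ x, grad w x (i, j) * (h x - φ x)) + ∫ x, grad w x (i, j) * φ x := by
    refine Eq.trans ?_ (integral_add ((hh.sub hφi).mul_of_top_right hg) (hφi.mul_of_top_right hg))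
    exact integral_congr_ae (Eventually.of_forall fun x => by ring)
  rw [hsplit]
  refine (abs_add_le _ _).trans (add_le_add ?_ (abs_integral_grad_mul_le hw hM hφ hc i j))
  rw [← integral_const_mul, ← Real.norm_eq_abs]
  refine norm_integral_le_of_norm_le ((hh.sub hφi).norm.const_mul R) ?_
  filter_upwards [hR] with x hx
  rw [norm_mul]
  exact mul_le_mul_of_nonneg_right ((PiLp.norm_apply_le _ _).trans hx) (norm_nonneg _)

lemma tendsto_integral_grad_mul (hL : ∀ ε > 0, ∃ K, LipschitzWith K (ψ ε))
    (hM : ∀ ε > 0, ∀ x, ‖ψ ε x‖ ≤ ε * M) (hR : ∀ ε > 0, ∀ᵐ x, ‖grad (ψ ε) x‖ ≤ R)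
    {h : Vec d → ℝ} (hh : Integrable h) (i : Fin m) (j : Fin d) :
    Tendsto (fun ε => ∫ x, grad (ψ ε) x (i, j) * h x) (𝓝[>] 0) (𝓝 0) := by
  have hR0 : 0 ≤ R := by
    obtain ⟨x, hx⟩ := (hR 1 one_pos).exists
    exact (norm_nonneg _).trans hx
  rw [Metric.tendsto_nhds]
  intro η hη
  let δ : ℝ := η / (2 * (R + 1))
  have hδ : 0 < δ := by positivity
  obtain ⟨φ, hc, hφ, hhφ⟩ := (memLp_one_iff_integrable.2 hh).exist_eLpNorm_sub_le
    ENNReal.one_ne_top le_rfl hδ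
  have hhφ' : ∫ x, |h x - φ x| ≤ δ := by
    have hsub : Integrable (h - φ) := hh.sub (hφ.continuous.integrable_of_hasCompactSupport hc)
    refine (integral_norm_eq_lintegral_enorm hsub.aestronglyMeasurable).trans_le ?_
    refine ENNReal.toReal_le_of_le_ofReal hδ.le ?_
    rwa [eLpNorm_one_eq_lintegral_enorm] at hhφ
  let B : ℝ := ∫ x, |fderiv ℝ φ x (EuclideanSpace.single j 1)|
  have hlim : Tendsto (fun ε : ℝ => R * δ + ε * M * B) (𝓝[>] 0) (𝓝 (R * δ + 0 * M * B)) :=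
    tendsto_nhdsWithin_of_tendsto_nhds (Continuous.tendsto (by fun_prop) 0)
  have hlt : R * δ + 0 * M * B < η := by
    have : 2 * (R + 1) * δ = η := mul_div_cancel₀ η (by positivity)
    nlinarith
  filter_upwards [hlim.eventually (gt_mem_nhds hlt), self_mem_nhdsWithin] with ε hε hε0
  obtain ⟨K, hK⟩ := hL ε hε0
  rw [dist_zero_right]
  refine ((abs_integral_grad_mul_le_add hK (hM ε hε0) (hR ε hε0) hh hφ hc i j).trans ?_).trans_lt hε
  gcongr

lemma integral_add_mul {X : Type*} [MeasurableSpace X] {μ : Measure X} {g₁ g₂ h : X → ℝ}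
    (hg₁ : MemLp g₁ ⊤ μ) (hg₂ : MemLp g₂ ⊤ μ) (hh : Integrable h μ) :
    ∫ x, (g₁ x + g₂ x) * h x ∂μ = (∫ x, g₁ x * h x ∂μ) + ∫ x, g₂ x * h x ∂μ := by
  simp only [add_mul]
  exact integral_add (hh.mul_of_top_right hg₁) (hh.mul_of_top_right hg₂)

lemma tendsto_integral_apply_mul
    (hM : ∀ ε > 0, ∀ x, ‖ψ ε x‖ ≤ ε * M) {μ : Measure (Vec d)} {h : Vec d → ℝ}
    (hh : Integrable h μ) (i : Fin m) :
    Tendsto (fun ε => ∫ x, ψ ε x i * h x ∂μ) (𝓝[>] 0) (𝓝 0) := by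
  have hlim : Tendsto (fun ε : ℝ => ε * M * ∫ x, ‖h x‖ ∂μ) (𝓝[>] 0)
      (𝓝 (0 * M * ∫ x, ‖h x‖ ∂μ)) :=
    tendsto_nhdsWithin_of_tendsto_nhds (Continuous.tendsto (by fun_prop) 0)
  rw [zero_mul, zero_mul] at hlim
  refine squeeze_zero_norm' ?_ hlim
  filter_upwards [self_mem_nhdsWithin] with ε hε
  rw [← integral_const_mul]
  refine norm_integral_le_of_norm_le (hh.norm.const_mul _) (Eventually.of_forall fun x => ?_)
  rw [norm_mul]
  gcongr
  exact (PiLp.norm_apply_le _ _).trans (hM ε hε x)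

namespace W1inf

/-- The perturbation of an element of `W^{1,∞}` by a bounded Lipschitz function. -/
def addLipschitz (u : W1inf Ω m) (hw : LipschitzWith K w) (hM : ∀ x, ‖w x‖ ≤ M) : W1inf Ω m where
  toFun := u.toFun + w
  grad := u.grad + SemiHom.grad w
  memLp_toFun := u.memLp_toFun.add (memLp_top_of_bound hw.continuous.aestronglyMeasurable M
    (Eventually.of_forall hM))
  memLp_grad := u.memLp_grad.add (memLp_top_grad hw _)
  hasWeakGradient := u.hasWeakGradient.add (hasWeakGradient_of_lipschitz hw Ω) u.memLp_toFun
    (memLp_top_of_bound hw.continuous.aestronglyMeasurable M (Eventually.of_forall hM))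
    u.memLp_grad (memLp_top_grad hw _)

lemma gradNorm_addLipschitz_le (u : W1inf Ω m) (hw : LipschitzWith K w) (hM : ∀ x, ‖w x‖ ≤ M)
    {r : ℝ≥0∞} (hr : ∀ᵐ x, ‖SemiHom.grad w x‖ₑ ≤ r) :
    (u.addLipschitz hw hM).gradNorm ≤ r + u.gradNorm := by
  rw [add_comm]
  refine (eLpNorm_add_le u.memLp_grad.1 (memLp_top_grad hw _).1 le_top).trans
    (add_le_add le_rfl ?_)
  rw [eLpNorm_exponent_top]
  exact essSup_le_of_ae_le _ (ae_restrict_of_ae hr)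

lemma weakStarTendsto_of_lipschitz_perturbation (hΩ : MeasurableSet Ω) {u : W1inf Ω m}
    {v : ℝ → W1inf Ω m} (hL : ∀ ε > 0, ∃ K, LipschitzWith K (ψ ε))
    (hM : ∀ ε > 0, ∀ x, ‖ψ ε x‖ ≤ ε * M) (hR : ∀ ε > 0, ∀ᵐ x, ‖SemiHom.grad (ψ ε) x‖ ≤ R)
    (hv : ∀ ε > 0, (v ε).toFun = u.toFun + ψ ε)
    (hgv : ∀ ε > 0, (v ε).grad = u.grad + SemiHom.grad (ψ ε)) : WeakStarTendsto v u := by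
  refine fun h hh => ⟨fun i => ?_, fun i j => ?_⟩
  · have hsplit : ∀ ε > 0, (∫ x in Ω, u.toFun x i * h x) + ∫ x in Ω, ψ ε x i * h x =
        ∫ x in Ω, (v ε).toFun x i * h x := fun ε hε => by
      obtain ⟨K, hK⟩ := hL ε hε
      have hψ : MemLp (ψ ε) ⊤ (volume.restrict Ω) := memLp_top_of_bound
        hK.continuous.aestronglyMeasurable _ (Eventually.of_forall (hM ε hε))
      rw [hv ε hε]
      exact (integral_add_mul (memLp_apply u.memLp_toFun i) (memLp_apply hψ i) hh).symm
    have hlim := (tendsto_integral_apply_mul hM hh i).const_add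
      (∫ x in Ω, u.toFun x i * h x)
    rw [add_zero] at hlim
    exact hlim.congr' (eventually_nhdsWithin_of_forall hsplit)
  · have hindicator : ∀ ε, ∫ x, SemiHom.grad (ψ ε) x (i, j) * Ω.indicator h x =
        ∫ x in Ω, SemiHom.grad (ψ ε) x (i, j) * h x := fun ε => by
      rw [← integral_indicator hΩ]
      simp only [Set.indicator_mul_right]
    have hsplit : ∀ ε > 0, (∫ x in Ω, u.grad x (i, j) * h x) +
        ∫ x, SemiHom.grad (ψ ε) x (i, j) * Ω.indicator h x =
        ∫ x in Ω, (v ε).grad x (i, j) * h x := fun ε hε => by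
      obtain ⟨K, hK⟩ := hL ε hε
      rw [hindicator, hgv ε hε]
      exact (integral_add_mul (memLp_apply u.memLp_grad _) (memLp_apply (memLp_top_grad hK _) _)
        hh).symm
    have hlim := (tendsto_integral_grad_mul hL hM hR ((integrable_indicator_iff hΩ).2 hh) i
      j).const_add (∫ x in Ω, u.grad x (i, j) * h x)
    rw [add_zero] at hlim
    exact hlim.congr' (eventually_nhdsWithin_of_forall hsplit)

end W1inf

lemma H_le_limsup {f : Vec d → Mat m d → ℝ≥0∞} (hΩ : MeasurableSet Ω) (u : W1inf Ω m) {r : ℝ≥0}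
    {g : ℝ → ℝ≥0∞} (h : ∀ ε > 0, ∃ (K : ℝ≥0) (ψ : Vec d → Vec m), LipschitzWith K ψ ∧
      (∀ x, ‖ψ x‖ ≤ ε * M) ∧ (∀ᵐ x, ‖grad ψ x‖ₑ ≤ r) ∧
      ∫⁻ x in Ω, f (ε⁻¹ • x) (u.grad x + grad ψ x) ≤ g ε) :
    H f (r + u.gradNorm) u ≤ limsup g (𝓝[>] 0) := by
  classical
  choose! K ψ hL hM hr hg using h
  let v : ℝ → W1inf Ω m := fun ε =>
    if hε : 0 < ε then u.addLipschitz (hL ε hε) (hM ε hε) else u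
  have hv : ∀ (ε : ℝ) (hε : 0 < ε), v ε = u.addLipschitz (hL ε hε) (hM ε hε) :=
    fun ε hε => dif_pos hε
  have hweak : W1inf.WeakStarTendsto v u := by
    refine W1inf.weakStarTendsto_of_lipschitz_perturbation hΩ (R := r)
      (fun ε hε => ⟨K ε, hL ε hε⟩) hM (fun ε hε => ?_) (fun ε hε => by rw [hv ε hε]; rfl)
      fun ε hε => by rw [hv ε hε]; rfl
    filter_upwards [hr ε hε] with x hx
    exact_mod_cast hx
  refine iInf_le_of_le v (iInf₂_le_of_le hweak (fun ε hε => ?_) (limsup_le_limsup ?_))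
  · rw [hv ε hε]
    exact u.gradNorm_addLipschitz_le _ _ (hr ε hε)
  · filter_upwards [self_mem_nhdsWithin] with ε hε
    rw [hv ε hε]
    exact hg ε hε

end Perturbation

section UpperBound

variable {f : Vec d → Mat m d → ℝ≥0∞}

lemma homogBdd_le (r : ℝ≥0∞) {ξ : Mat m d} {A : ℝ≥0∞} (hA : ∀ x, f x ξ ≤ A) :
    homogBdd r f ξ ≤ A := by
  have hzero : LipschitzWith 0 (fun _ : Vec d => (0 : Vec m)) := LipschitzWith.const 0
  have hgrad : grad (fun _ : Vec d => (0 : Vec m)) = 0 := funext fun x => grad_const 0 x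
  refine iInf₂_le_of_le 1 le_rfl ?_
  rw [Nat.cast_one, one_pow, inv_one, one_mul]
  refine iInf_le_of_le (W1inf.ofLipschitz hzero (measurableSet_cube 1) (isBounded_cube 1))
    (iInf₂_le_of_le (W1inf.isZeroOnBoundary_ofLipschitz hzero (isOpen_cube 1) (isBounded_cube 1)
      fun _ _ => rfl) ?_ ?_)
  · simp [W1inf.gradNorm, W1inf.ofLipschitz, hgrad]
  · calc ∫⁻ x in cube d 1, f x (ξ + grad (fun _ => 0) x) ≤ ∫⁻ _ in cube d 1, A := by
          refine lintegral_mono fun x => ?_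
          rw [hgrad, Pi.zero_apply, add_zero]
          exact hA x
      _ = A := by simp [volume_cube]

lemma exists_norm_le_of_eq_zero_off {X E : Type*} [PseudoMetricSpace X]
    [SeminormedAddCommGroup E] {w : X → E} {K : ℝ≥0} (hw : LipschitzWith K w) {D : Set X}
    (hD : Bornology.IsBounded D) (h0 : ∀ x ∉ D, w x = 0) : ∃ M : ℝ≥0, ∀ x, ‖w x‖ ≤ M := by
  obtain ⟨R, hR⟩ := (hw.isBounded_image hD).exists_norm_le
  refine ⟨R.toNNReal, fun x => ?_⟩
  by_cases hx : x ∈ D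
  · exact (hR _ (Set.mem_image_of_mem w hx)).trans (Real.le_coe_toNNReal R)
  · rw [h0 x hx, norm_zero]
    positivity

lemma exists_piecewise_tiling {ι : Type*} [Finite ι] {D : ι → Set (Vec d)}
    (hD : ∀ i, IsOpen (D i)) (hDf : ∀ i, volume (frontier (D i)) = 0)
    (hDv : ∀ i, volume (D i) ≠ ⊤) (hdisj : Pairwise fun i j => Disjoint (D i) (D j))
    {n : ι → ℕ} (hn : ∀ i, 1 ≤ n i) {Φ : ι → Vec d → Vec m} {K : ι → ℝ≥0}
    (hΦ : ∀ i, LipschitzWith (K i) (Φ i)) (h0 : ∀ i, ∀ x ∉ cube d (n i), Φ i x = 0) {M : ℝ}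
    (hM0 : 0 ≤ M) (hM : ∀ i x, ‖Φ i x‖ ≤ M) {r : ℝ≥0∞}
    (hr : ∀ i, ∀ᵐ x ∂(volume.restrict (cube d (n i))), ‖grad (Φ i) x‖ₑ ≤ r)
    (hper : IsYPeriodic f) {ξ : ι → Mat m d} {A : ι → ℝ≥0∞} (hA : ∀ i x, f x (ξ i) ≤ A i)
    {ε : ℝ} (hε : 0 < ε) :
    ∃ (K' : ℝ≥0) (ψ : Vec d → Vec m), LipschitzWith K' ψ ∧ (∀ x, ‖ψ x‖ ≤ ε * M) ∧
      (∀ᵐ x, ‖grad ψ x‖ₑ ≤ r) ∧ ∀ i, ∫⁻ x in D i, f (ε⁻¹ • x) (ξ i + grad ψ x) ≤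
        volume (D i) * (((n i : ℝ≥0∞) ^ d)⁻¹ * ∫⁻ x in cube d (n i), f x (ξ i + grad (Φ i) x)) +
          A i * volume (D i ∩ Metric.cthickening (d * (ε * n i)) (D i)ᶜ) := by
  cases nonempty_fintype ι
  let S : ι → Finset (Fin d → ℤ) := fun i => (finite_tile_subset (hn i) hε (hDv i)).toFinset
  have hS : ∀ i z, z ∈ S i ↔ tile ε (n i) z ⊆ D i := fun i z => by simp [S]
  let τ : ι → Vec d → Vec m := fun i => tiling (Φ i) ε (n i) (S i)
  have hτ0 : ∀ i, ∀ x ∉ D i, τ i x = 0 := fun i x hx =>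
    tiling_eq_zero (h0 i) ε fun hmem => by
      obtain ⟨z, hz, hxz⟩ := Set.mem_iUnion₂.1 hmem
      exact hx ((hS i z).1 hz hxz)
  have hdisj' : ((Finset.univ : Finset ι) : Set ι).PairwiseDisjoint D := hdisj.set_pairwise _
  refine ⟨∑ i, ∑ _z ∈ S i, K i, fun x => ∑ i, τ i x,
    lipschitzWith_sum fun i _ => lipschitzWith_tiling (hΦ i) hε.ne' (n i) (S i),
    norm_sum_le_of_pairwiseDisjoint (by positivity) hdisj' (fun i _ => hτ0 i) fun i _ =>
      norm_tiling_le (hn i) (h0 i) hε.le (hM i) (S i),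
    ae_enorm_grad_sum_le (fun i _ => hD i) (fun i _ => hDf i) hdisj' (fun i _ => hτ0 i)
      fun i _ => ae_restrict_of_ae (ae_enorm_grad_tiling_le (hn i) (h0 i) hε (hr i) (S i)),
    fun i => ?_⟩
  refine le_of_eq_of_le (setLIntegral_congr_fun (hD i).measurableSet fun x hx => ?_)
    (setLIntegral_tiling_le hper (hA i) (hn i) (h0 i) hε (hD i).measurableSet (hS i))
  simp only [grad_sum_eq_of_mem (fun i _ => hD i) hdisj' (fun i _ => hτ0 i) (Finset.mem_univ i) hx,
    τ]

lemma le_of_forall_pos_le_add_mul {a b V : ℝ≥0∞} (hV : V ≠ ⊤)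
    (h : ∀ δ : ℝ≥0, 0 < δ → a ≤ b + δ * V) : a ≤ b := by
  refine ENNReal.le_of_forall_pos_le_add fun η hη _ => ?_
  lift V to ℝ≥0 using hV
  refine (h (η / (V + 1)) (by positivity)).trans ?_
  gcongr
  norm_cast
  rw [div_mul_eq_mul_div]
  exact div_le_of_le_mul₀ (by positivity) (by positivity) (by gcongr; exact le_self_add)

lemma tendsto_layer_energy {ι : Type*} [Fintype ι] {D : ι → Set (Vec d)} (hD : ∀ i, IsOpen (D i))
    (hDv : ∀ i, volume (D i) ≠ ⊤) {a A : ι → ℝ≥0∞} (hA : ∀ i, A i ≠ ⊤) (n : ι → ℕ) :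
    Tendsto (fun ε : ℝ => ∑ i, (a i +
      A i * volume (D i ∩ Metric.cthickening (d * (ε * n i)) (D i)ᶜ))) (𝓝[>] 0)
      (𝓝 (∑ i, a i)) := by
  refine tendsto_finsetSum _ fun i _ => ?_
  have hwidth : Tendsto (fun ε : ℝ => (d : ℝ) * (ε * n i)) (𝓝[>] 0) (𝓝 0) := by
    have hcont : Continuous fun ε : ℝ => (d : ℝ) * (ε * n i) := by fun_prop
    simpa using tendsto_nhdsWithin_of_tendsto_nhds (hcont.tendsto 0)
  simpa using tendsto_const_nhds.add (ENNReal.Tendsto.const_mul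
    ((tendsto_measure_inter_cthickening_compl (hD i) (hDv i)).comp hwidth) (Or.inr (hA i)))

lemma setLIntegral_eq_sum_of_cover {X ι : Type*} [MeasurableSpace X] {μ : Measure X} [Fintype ι]
    {S : Set X} {D : ι → Set X} (hD : ∀ i, MeasurableSet (D i)) (hDS : ∀ i, D i ⊆ S)
    (hdisj : Pairwise fun i j => Disjoint (D i) (D j)) (hcov : μ (S \ ⋃ i, D i) = 0)
    (F : X → ℝ≥0∞) : ∫⁻ x in S, F x ∂μ = ∑ i, ∫⁻ x in D i, F x ∂μ := by
  have hae : S =ᵐ[μ] ⋃ i, D i :=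
    (ae_le_set.2 hcov).antisymm (LE.le.eventuallyLE (Set.iUnion_subset hDS))
  rw [Measure.restrict_congr_set hae, lintegral_iUnion hD hdisj, tsum_fintype]

theorem H_le_of_isPiecewiseAffine {Ω : Set (Vec d)} (hΩ : MeasurableSet Ω) (hΩv : volume Ω ≠ ⊤)
    (hper : IsYPeriodic f) {A : Mat m d → ℝ≥0} (hA : ∀ ξ x, f x ξ ≤ A ξ)
    {u : W1inf Ω m} (hu : u.IsPiecewiseAffine) (r : ℝ≥0) :
    H f (r + u.gradNorm) u ≤ ∫⁻ x in Ω, homogBdd r f (u.grad x) := by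
  obtain ⟨-, k, D, ξ, hD, hdisj, hcov, hgrad⟩ := hu
  have hDv : ∀ i, volume (D i) ≠ ⊤ := fun i => measure_ne_top_of_subset (hD i).2.1 hΩv
  have hsplit : ∀ F : Vec d → ℝ≥0∞, ∫⁻ x in Ω, F x = ∑ i, ∫⁻ x in D i, F x :=
    setLIntegral_eq_sum_of_cover (fun i => (hD i).1.measurableSet) (fun i => (hD i).2.1) hdisj hcov
  refine le_of_forall_pos_le_add_mul hΩv fun δ hδ => ?_
  have hlt : ∀ i, homogBdd r f (ξ i) < homogBdd r f (ξ i) + δ := fun i =>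
    ENNReal.lt_add_right (ne_top_of_le_ne_top ENNReal.coe_ne_top (homogBdd_le r (hA (ξ i))))
      (by exact_mod_cast hδ.ne')
  choose n hn K Φ hΦ hΦ0 hΦr hΦe using fun i => exists_of_homogBdd_lt (hlt i)
  choose M hM using fun i => exists_norm_le_of_eq_zero_off (hΦ i) (isBounded_cube (n i)) (hΦ0 i)
  obtain ⟨M', hM'⟩ := Finite.exists_le M
  have hlim := tendsto_layer_energy (fun i => (hD i).1) hDv
    (a := fun i => volume (D i) * (homogBdd r f (ξ i) + δ)) (A := fun i => A (ξ i))
    (fun _ => ENNReal.coe_ne_top) n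
  calc H f (r + u.gradNorm) u ≤ ∑ i, volume (D i) * (homogBdd r f (ξ i) + δ) := by
        rw [← hlim.limsup_eq]
        refine H_le_limsup hΩ u (M := M') fun ε hε => ?_
        obtain ⟨K', ψ, hψ, hψM, hψr, hψe⟩ := exists_piecewise_tiling (fun i => (hD i).1)
          (fun i => (hD i).2.2) hDv hdisj hn hΦ hΦ0 M'.2 (fun i x => (hM i x).trans (hM' i)) hΦr
          hper (fun i => hA (ξ i)) hε
        refine ⟨K', ψ, hψ, hψM, hψr, ?_⟩
        rw [hsplit]
        refine Finset.sum_le_sum fun i _ => le_of_eq_of_le (lintegral_congr_ae ?_)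
          ((hψe i).trans (by gcongr; exact (hΦe i).le))
        filter_upwards [hgrad i] with x hx
        rw [hx]
    _ = ∑ i, ∫⁻ x in D i, (homogBdd r f (u.grad x) + δ) := by
        refine Finset.sum_congr rfl fun i _ => ?_
        rw [mul_comm, ← setLIntegral_const]
        refine lintegral_congr_ae ?_
        filter_upwards [hgrad i] with x hx
        rw [hx]
    _ = (∫⁻ x in Ω, homogBdd r f (u.grad x)) + δ * volume Ω := by
        rw [← hsplit, lintegral_add_right _ measurable_const, setLIntegral_const]

end UpperBound

section UpperSemicontinuity

variable {f : Vec d → Mat m d → ℝ≥0∞} {b : ℝ → ℝ≥0}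

lemma homog_le_of_le {ξ : Mat m d} {A : ℝ≥0∞} (hA : ∀ x, f x ξ ≤ A) : homog f ξ ≤ A := by
  rw [homog_eq_homogBdd_top]
  exact homogBdd_le ⊤ hA

lemma IsBoundedBy.homog_le (hb : IsBoundedBy f b) {R : ℝ} {ξ : Mat m d} (hξ : ‖ξ‖ ≤ R) :
    homog f ξ ≤ b R :=
  homog_le_of_le fun x => hb x hξ

lemma IsBoundedBy.homog_ne_top (hb : IsBoundedBy f b) (ξ : Mat m d) : homog f ξ ≠ ⊤ :=
  ne_top_of_le_ne_top ENNReal.coe_ne_top (hb.homog_le le_rfl)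

lemma setLIntegral_le_add_layer {X : Type*} [MeasurableSpace X] {μ : Measure X} {D L : Set X}
    (hD : MeasurableSet D) (hL : MeasurableSet L) {F F' : X → ℝ≥0∞} {B : ℝ≥0∞}
    (hoff : ∀ᵐ x ∂μ, x ∈ D → x ∉ L → F x ≤ F' x) (hB : ∀ᵐ x ∂μ, x ∈ D → F x ≤ B) :
    ∫⁻ x in D, F x ∂μ ≤ (∫⁻ x in D, F' x ∂μ) + B * μ (D ∩ L) := by
  rw [← lintegral_inter_add_sdiff F D hL, add_comm]
  refine add_le_add ?_ ?_
  · refine le_trans ?_ (lintegral_mono_set (Set.sdiff_subset (s := D) (t := L)))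
    refine lintegral_mono_ae ((ae_restrict_iff' (hD.diff hL)).2 ?_)
    filter_upwards [hoff] with x hx hxD using hx hxD.1 hxD.2
  · rw [← setLIntegral_const]
    refine lintegral_mono_ae ((ae_restrict_iff' (hD.inter hL)).2 ?_)
    filter_upwards [hB] with x hx hxD using hx hxD.1

lemma compl_nonempty_of_isBounded (hd : 1 ≤ d) {D : Set (Vec d)} (hD : Bornology.IsBounded D) :
    Dᶜ.Nonempty := by
  have : Nonempty (Fin d) := ⟨⟨0, hd⟩⟩
  rw [Set.nonempty_compl]
  rintro rfl
  exact NormedSpace.unbounded_univ ℝ (Vec d) hD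

lemma norm_add_grad_le {w : Vec d → Vec m} {K : ℝ≥0} (hw : LipschitzWith K w) (ξ : Mat m d)
    (x : Vec d) : ‖ξ + grad w x‖ ≤ ‖ξ‖ + frobConst m d * K :=
  (norm_add_le _ _).trans (add_le_add le_rfl (norm_grad_le hw x))

lemma norm_aff_zero_le (ζ : Mat m d) (n : ℕ) {x : Vec d} (hx : x ∈ cube d n) :
    ‖aff ζ 0 (0 : Vec m) x‖ ≤ ‖matEquiv.symm ζ‖₊ * (d * n) := by
  have haff := (lipschitzWith_aff ζ (0 : Vec d) (0 : Vec m)).dist_le_mul x 0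
  have hzero : aff ζ (0 : Vec d) (0 : Vec m) 0 = 0 := by simp [aff]
  rw [hzero, dist_zero_right] at haff
  rw [cube_eq_box] at hx
  exact haff.trans (mul_le_mul_of_nonneg_left (box_subset_closedBall 0 _ hx) (NNReal.coe_nonneg _))

/-- Adding to `Φ` a cutoff of the affine function with gradient `ξ - ζ` turns a competitor for `ξ`
into one for `ζ`. -/
lemma homog_le_of_near (hd : 1 ≤ d) (hb : IsBoundedBy f b) {ξ ζ : Mat m d} {n : ℕ} (hn : 1 ≤ n)
    {Φ : Vec d → Vec m} {K : ℝ≥0} (hΦ : LipschitzWith K Φ) (h0 : ∀ x ∉ cube d n, Φ x = 0)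
    {s : ℝ≥0} (hs : 0 < s) (hζ : ‖ζ‖ ≤ ‖ξ‖ + 1)
    (hnear : ‖matEquiv.symm (ξ - ζ)‖₊ + ‖matEquiv.symm (ξ - ζ)‖₊ * (d * n) / s ≤ 1) :
    homog f ζ ≤ ((n : ℝ≥0∞) ^ d)⁻¹ * ((∫⁻ x in cube d n, f x (ξ + grad Φ x)) +
      b (‖ξ‖ + 1 + frobConst m d * (K + 1)) *
        volume (cube d n ∩ Metric.cthickening s (cube d n)ᶜ)) := by
  obtain ⟨p, hp, hp0, hpe⟩ := exists_cutoff (compl_nonempty_of_isBounded hd (isBounded_cube n))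
    (lipschitzWith_aff (ξ - ζ) (0 : Vec d) (0 : Vec m)) hs
    (M := ‖matEquiv.symm (ξ - ζ)‖₊ * (d * n)) fun x hx => norm_aff_zero_le (ξ - ζ) n hx
  have hp1 : LipschitzWith 1 p := hp.weaken hnear
  have hΦp : LipschitzWith (K + 1) (fun x => Φ x + p x) := hΦ.add hp1
  refine (homog_le f ζ hn hΦp fun x hx => by rw [h0 x hx, hp0 x hx, add_zero]).trans ?_
  gcongr
  refine setLIntegral_le_add_layer (measurableSet_cube n)
    Metric.isClosed_cthickening.measurableSet ?_ ?_
  · filter_upwards [hΦ.ae_differentiableAt (μ := volume), hp1.ae_differentiableAt (μ := volume)]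
      with x hx hx' _ hxL
    rw [grad_add hx hx', grad_congr_of_eqOn Metric.isClosed_cthickening.isOpen_compl
      (fun y hy => hpe y hy) hxL, grad_aff, add_left_comm, add_sub_cancel, add_comm]
  · refine Eventually.of_forall fun x _ => hb x ((norm_add_grad_le hΦp ζ x).trans ?_)
    push_cast
    gcongr

theorem upperSemicontinuous_homog (hd : 1 ≤ d) (hb : IsBoundedBy f b) :
    UpperSemicontinuous (homog f) := by
  intro ξ a ha
  rw [homog_eq_homogBdd_top] at ha
  obtain ⟨n, hn, K, Φ, hΦ, hΦ0, -, hE⟩ := exists_of_homogBdd_lt ha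
  have hn' : ((n : ℝ≥0∞) ^ d)⁻¹ ≠ ⊤ :=
    ENNReal.inv_ne_top.2 (pow_ne_zero _ (by exact_mod_cast (by omega : n ≠ 0)))
  let B : ℝ≥0 := b (‖ξ‖ + 1 + frobConst m d * (K + 1))
  have hlayer : Tendsto (fun s : ℝ => ((n : ℝ≥0∞) ^ d)⁻¹ * ((∫⁻ x in cube d n, f x (ξ + grad Φ x)) +
      B * volume (cube d n ∩ Metric.cthickening s (cube d n)ᶜ))) (𝓝[>] 0)
      (𝓝 (((n : ℝ≥0∞) ^ d)⁻¹ * ((∫⁻ x in cube d n, f x (ξ + grad Φ x)) + B * 0))) :=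
    ENNReal.Tendsto.const_mul (tendsto_const_nhds.add (ENNReal.Tendsto.const_mul
      (tendsto_nhdsWithin_of_tendsto_nhds (tendsto_measure_inter_cthickening_compl (isOpen_cube n)
        (isBounded_cube n).measure_lt_top.ne)) (Or.inr ENNReal.coe_ne_top))) (Or.inr hn')
  rw [mul_zero, add_zero] at hlayer
  obtain ⟨s, hsE, hs⟩ := ((hlayer.eventually (gt_mem_nhds hE)).and self_mem_nhdsWithin).exists
  lift s to ℝ≥0 using (Set.mem_Ioi.1 hs).le
  have hcont : Continuous fun ζ : Mat m d =>
      ‖matEquiv.symm (ξ - ζ)‖₊ + ‖matEquiv.symm (ξ - ζ)‖₊ * (d * n) / s := by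
    have : Continuous fun ζ : Mat m d => matEquiv.symm (ξ - ζ) :=
      matEquiv.symm.continuous.comp (by fun_prop)
    fun_prop
  have hnear : ∀ᶠ ζ in 𝓝 ξ,
      ‖matEquiv.symm (ξ - ζ)‖₊ + ‖matEquiv.symm (ξ - ζ)‖₊ * (d * n) / s < 1 :=
    hcont.continuousAt.eventually (gt_mem_nhds (by simp))
  have hnorm : ∀ᶠ ζ in 𝓝 ξ, ‖ζ‖ < ‖ξ‖ + 1 :=
    continuous_norm.continuousAt.eventually (gt_mem_nhds (lt_add_one _))
  filter_upwards [hnear, hnorm] with ζ hζ hζn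
  exact (homog_le_of_near hd hb hn hΦ hΦ0 hs hζn.le hζ.le).trans_lt hsE

end UpperSemicontinuity

section Balls

lemma ball_ae_eq_closedBall (x : Vec d) {ρ : ℝ} (hρ : 0 < ρ) :
    (Metric.ball x ρ : Set (Vec d)) =ᵐ[volume] Metric.closedBall x ρ := by
  refine (LE.le.eventuallyLE Metric.ball_subset_closedBall).antisymm (ae_le_set.2 ?_)
  rw [Metric.closedBall_sdiff_ball]
  exact Measure.addHaar_sphere_of_ne_zero volume x hρ.ne'

lemma exists_volume_ball_shell_le (d : ℕ) {δ : ℝ≥0} (hδ : 0 < δ) :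
    ∃ τ : ℝ≥0, 0 < τ ∧ ∀ (x : Vec d) (ρ : ℝ),
      volume (Metric.ball x ρ \ Metric.ball x ((1 - τ) * ρ)) ≤ δ * volume (Metric.ball x ρ) := by
  have hlim : Tendsto (fun τ : ℝ => 1 - (1 - τ) ^ d) (𝓝[>] 0) (𝓝 (1 - (1 - 0) ^ d)) :=
    tendsto_nhdsWithin_of_tendsto_nhds (Continuous.tendsto (by fun_prop) 0)
  have hlt : (1 : ℝ) - (1 - 0) ^ d < δ := by simpa using hδ
  obtain ⟨τ, hτ, hτ0, hτ1⟩ := ((hlim.eventually (gt_mem_nhds hlt)).and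
    (Ioo_mem_nhdsGT (zero_lt_one' ℝ))).exists
  lift τ to ℝ≥0 using hτ0.le
  refine ⟨τ, hτ0, fun x ρ => ?_⟩
  rcases le_or_gt ρ 0 with hρ | hρ
  · rw [Metric.ball_eq_empty.2 hρ, Set.empty_sdiff, measure_empty]
    exact zero_le
  have hτ' : 0 < 1 - (τ : ℝ) := sub_pos.2 hτ1
  have hinner : volume (Metric.ball x ((1 - τ) * ρ)) =
      ENNReal.ofReal ((1 - τ) ^ d) * volume (Metric.ball x ρ) := by
    rw [Measure.addHaar_ball_mul_of_pos volume x hτ', finrank_euclideanSpace, Fintype.card_fin,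
      Measure.addHaar_ball_center volume x ρ]
  rw [measure_sdiff (Metric.ball_subset_ball (by nlinarith)) measurableSet_ball.nullMeasurableSet
    measure_ball_lt_top.ne, hinner, tsub_le_iff_right, ← add_mul]
  refine le_mul_of_one_le_left zero_le ?_
  rw [← ENNReal.ofReal_coe_nnreal, ← ENNReal.ofReal_add (by positivity) (by positivity),
    ENNReal.one_le_ofReal]
  linarith

lemma exists_finset_measure_sdiff_biUnion_le {X ι : Type*} [MeasurableSpace X] {μ : Measure X}
    {Y : Set X} (hY : μ Y ≠ ⊤) {t : Set ι} (ht : t.Countable) {A : ι → Set X}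
    (hA : ∀ i ∈ t, MeasurableSet (A i)) (hdisj : t.PairwiseDisjoint A) (hAY : ∀ i ∈ t, A i ⊆ Y)
    (hcov : μ (Y \ ⋃ i ∈ t, A i) = 0) {δ : ℝ≥0∞} (hδ : δ ≠ 0) :
    ∃ s : Finset ι, ↑s ⊆ t ∧ μ (Y \ ⋃ i ∈ s, A i) ≤ δ := by
  have hsum : ∑' i : t, μ (A i) ≠ ⊤ := by
    rw [← measure_biUnion ht hdisj hA]
    exact measure_ne_top_of_subset (Set.iUnion₂_subset hAY) hY
  obtain ⟨F, hF⟩ := ((ENNReal.tendsto_tsum_compl_atTop_zero hsum).eventually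
    (ge_mem_nhds hδ.bot_lt)).exists
  have : Countable t := ht.to_subtype
  refine ⟨F.map (.subtype _), by simp, ?_⟩
  calc μ (Y \ ⋃ i ∈ F.map (.subtype _), A i)
      ≤ μ ((Y \ ⋃ i ∈ t, A i) ∪ ⋃ i : {i : t // i ∉ F}, A i) := by
        refine measure_mono fun x hx => ?_
        by_cases hxt : x ∈ ⋃ i ∈ t, A i
        · obtain ⟨i, hi, hxi⟩ := Set.mem_iUnion₂.1 hxt
          refine Or.inr (Set.mem_iUnion.2 ⟨⟨⟨i, hi⟩, fun hiF => hx.2 ?_⟩, hxi⟩)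
          exact Set.mem_iUnion₂.2 ⟨i, Finset.mem_map_of_mem _ hiF, hxi⟩
        · exact Or.inl ⟨hx.1, hxt⟩
    _ ≤ 0 + ∑' i : {i : t // i ∉ F}, μ (A i) :=
        (measure_union_le _ _).trans (add_le_add hcov.le (measure_iUnion_le _))
    _ ≤ δ := by rwa [zero_add]

lemma exists_finset_disjoint_closedBall_cover {X : Type*} [MetricSpace X]
    [SecondCountableTopology X] [HasBesicovitchCovering X] [MeasurableSpace X]
    [OpensMeasurableSpace X] {μ : Measure X} [SFinite μ] {Y : Set X} (hY : IsOpen Y)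
    (hYμ : μ Y ≠ ⊤) {P : X → ℝ → Prop} (hP : ∀ᵐ x ∂μ, x ∈ Y → ∀ᶠ r in 𝓝[>] 0, P x r)
    {δ : ℝ≥0∞} (hδ : δ ≠ 0) :
    ∃ (t : Finset X) (ρ : X → ℝ),
      (∀ x ∈ t, 0 < ρ x ∧ Metric.closedBall x (ρ x) ⊆ Y ∧ P x (ρ x)) ∧
      (t : Set X).PairwiseDisjoint (fun x => Metric.closedBall x (ρ x)) ∧
      μ (Y \ ⋃ x ∈ t, Metric.closedBall x (ρ x)) ≤ δ := by
  let s : Set X := {x | x ∈ Y ∧ ∀ᶠ r in 𝓝[>] 0, P x r}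
  have hYs : ∀ᵐ x ∂μ, x ∈ Y → x ∈ s := hP.mono fun x hx hxY => ⟨hxY, hx hxY⟩
  obtain ⟨t, ρ, htc, -, hρ, hcov, hdisj⟩ := Besicovitch.exists_disjoint_closedBall_covering_ae
    μ (fun x => {r | Metric.closedBall x r ⊆ Y ∧ P x r}) s (fun x hx η hη => by
      have hball : ∀ᶠ r in 𝓝[>] (0 : ℝ), Metric.closedBall x r ⊆ Y := by
        obtain ⟨r₀, hr₀, hsub⟩ := Metric.nhds_basis_closedBall.mem_iff.1 (hY.mem_nhds hx.1)
        filter_upwards [Ioo_mem_nhdsGT hr₀] with r hr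
        exact (Metric.closedBall_subset_closedBall hr.2.le).trans hsub
      obtain ⟨r, hr, hrη⟩ := ((hball.and hx.2).and (Ioo_mem_nhdsGT hη)).exists
      exact ⟨r, hr, hrη⟩) (fun _ => 1) fun _ _ => one_pos
  have hcovY : μ (Y \ ⋃ x ∈ t, Metric.closedBall x (ρ x)) = 0 := by
    refine ae_le_set.1 ?_
    filter_upwards [hYs, ae_le_set.2 hcov] with x hxs hxc hxY using hxc (hxs hxY)
  obtain ⟨F, hFt, hF⟩ := exists_finset_measure_sdiff_biUnion_le hYμ htc
    (fun _ _ => measurableSet_closedBall) hdisj (fun x hx => (hρ x hx).1.1) hcovY hδ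
  exact ⟨F, ρ, fun x hx => ⟨(hρ x (hFt hx)).2.1, (hρ x (hFt hx)).1⟩, hdisj.subset hFt, hF⟩

end Balls

section Quasiconvexity

variable {f : Vec d → Mat m d → ℝ≥0∞} {b : ℝ → ℝ≥0} {w : Vec d → Vec m} {K : ℝ≥0}

lemma eventually_exists_energy_lt (hper : IsYPeriodic f) {ξ : Mat m d} {A a : ℝ≥0∞} (hA : A ≠ ⊤)
    (hfA : ∀ x, f x ξ ≤ A) {D : Set (Vec d)} (hD : IsOpen D) (hDv : volume D ≠ ⊤)
    (ha : volume D * homog f ξ < a) :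
    ∀ᶠ ε in 𝓝[>] (0 : ℝ), ∃ (K : ℝ≥0) (ψ : Vec d → Vec m), LipschitzWith K ψ ∧
      (∀ x ∉ D, ψ x = 0) ∧ ∫⁻ x in D, f (ε⁻¹ • x) (ξ + grad ψ x) < a := by
  have hne : (𝓝[>] homog f ξ).NeBot :=
    nhdsGT_neBot_of_exists_gt ⟨⊤, (ne_top_of_le_ne_top hA (homog_le_of_le hfA)).lt_top⟩
  obtain ⟨e, hea, he⟩ : ∃ e, volume D * e < a ∧ homog f ξ < e :=
    ((tendsto_nhdsWithin_of_tendsto_nhds (ENNReal.Tendsto.const_mul tendsto_id (Or.inr hDv))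
      |>.eventually (gt_mem_nhds ha)).and
        (self_mem_nhdsWithin : Set.Ioi (homog f ξ) ∈ 𝓝[>] homog f ξ)).exists
  rw [homog_eq_homogBdd_top] at he
  obtain ⟨n, hn, K, Φ, hΦ, hΦ0, -, hΦe⟩ := exists_of_homogBdd_lt he
  have hlim := tendsto_layer_energy (ι := Unit) (fun _ => hD) (fun _ => hDv)
    (a := fun _ => volume D * e) (fun _ => hA) (fun _ => n)
  simp only [Finset.univ_unique, Finset.sum_singleton] at hlim
  filter_upwards [hlim.eventually (gt_mem_nhds hea), self_mem_nhdsWithin] with ε hεa hε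
  let S : Finset (Fin d → ℤ) := (finite_tile_subset hn hε hDv).toFinset
  have hS : ∀ z, z ∈ S ↔ tile ε n z ⊆ D := fun z => by simp [S]
  refine ⟨_, tiling Φ ε n S, lipschitzWith_tiling hΦ (ne_of_gt hε) n S, fun x hx => ?_, ?_⟩
  · refine tiling_eq_zero hΦ0 ε fun hmem => ?_
    obtain ⟨z, hz, hxz⟩ := Set.mem_iUnion₂.1 hmem
    exact hx ((hS z).1 hz hxz)
  · refine (setLIntegral_tiling_le hper hfA hn hΦ0 hε hD.measurableSet hS).trans_lt
      (lt_of_le_of_lt ?_ hεa)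
    gcongr

lemma exists_replacement_on_ball {X E : Type*} [PseudoMetricSpace X] [SeminormedAddCommGroup E]
    [NormedSpace ℝ E] {v w : X → E} {K L τ : ℝ≥0} (hv : LipschitzWith L v)
    (hw : LipschitzWith K w) {x : X} {ρ : ℝ} (hx : (Metric.ball x ρ)ᶜ.Nonempty) (hτ : 0 < τ)
    (hρ : 0 < ρ) (hvw : ∀ y ∈ Metric.ball x ρ, ‖w y - v y‖ ≤ τ * ρ) :
    ∃ p : X → E, LipschitzWith (L + K + 1) p ∧ (∀ y ∉ Metric.ball x ρ, p y = 0) ∧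
      ∀ y ∈ Metric.ball x ((1 - τ) * ρ), w y + p y = v y := by
  lift ρ to ℝ≥0 using hρ.le
  have hs : 0 < τ * ρ := mul_pos hτ hρ
  obtain ⟨p, hp, hp0, hpe⟩ := exists_cutoff (M := τ * ρ) hx (hv.sub hw) hs fun y hy => by
    rw [norm_sub_rev]
    exact_mod_cast hvw y hy
  rw [div_self hs.ne'] at hp
  refine ⟨p, hp, hp0, fun y hy => ?_⟩
  have hdist : ρ - dist y x ≤ Metric.infDist y (Metric.ball x ρ)ᶜ := by
    refine (Metric.le_infDist hx).2 fun z hz => ?_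
    have hz' : (ρ : ℝ) ≤ dist z x := not_lt.1 hz
    linarith [dist_triangle_left z x y]
  have hfar : y ∉ Metric.cthickening (τ * ρ : ℝ≥0) (Metric.ball x ρ)ᶜ := by
    rw [Metric.mem_cthickening_iff, ENNReal.le_ofReal_iff_toReal_le (Metric.infEDist_ne_top hx)
      (NNReal.coe_nonneg _)]
    have hy' : dist y x < (1 - τ) * ρ := hy
    refine not_le.2 (lt_of_lt_of_le ?_ hdist)
    push_cast
    linarith
  rw [hpe y hfar, add_sub_cancel]

lemma lipschitzWith_aff_grad (hw : LipschitzWith K w) (x : Vec d) (c : Vec m) :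
    LipschitzWith K (aff (grad w x) x c) := by
  refine (lipschitzWith_aff (grad w x) x c).weaken ?_
  rw [grad, ContinuousLinearEquiv.symm_apply_apply]
  exact norm_fderiv_le_of_lipschitz ℝ hw

lemma setLIntegral_grad_add_le (hb : IsBoundedBy f b) (hw : LipschitzWith K w) {B D : Set (Vec d)}
    (hB : MeasurableSet B) (hD : MeasurableSet D) (hDf : volume (frontier D) = 0) (hDB : D ⊆ B)
    {ζ : Mat m d} (hwD : ∀ y ∈ D, grad w y = ζ) {ψ : Vec d → Vec m} {L : ℝ≥0}
    (hψ : LipschitzWith L ψ) (hψ0 : ∀ y ∉ D, ψ y = 0) (ξ : Mat m d) (ε : ℝ) :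
    ∫⁻ y in B, f (ε⁻¹ • y) (ξ + grad (w + ψ) y) ≤
      (∫⁻ y in D, f (ε⁻¹ • y) (ξ + ζ + grad ψ y)) +
        b (‖ξ‖ + frobConst m d * K) * volume (B \ D) := by
  have hgrad : ∀ᵐ y, grad (w + ψ) y = grad w y + grad ψ y := by
    filter_upwards [hw.ae_differentiableAt (μ := volume), hψ.ae_differentiableAt (μ := volume)]
      with y hy hyψ
    exact grad_add hy hyψ
  rw [← lintegral_inter_add_sdiff _ B hD, Set.inter_eq_right.2 hDB, ← setLIntegral_const]
  refine add_le_add (lintegral_mono_ae ((ae_restrict_iff' hD).2 ?_))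
    (lintegral_mono_ae ((ae_restrict_iff' (hB.diff hD)).2 ?_))
  · filter_upwards [hgrad] with y hy hyD
    rw [hy, hwD y hyD, add_assoc]
  · filter_upwards [hgrad, grad_ae_eq_zero hDf hψ0] with y hy hyψ hyD
    rw [hy, hyψ hyD.2, add_zero]
    exact hb _ (norm_add_grad_le hw ξ y)

/-- Where `w` is nearly affine, replace it by its affine approximation plus a fine tiling of a
near-optimal cell function. -/
lemma eventually_exists_ball_replacement (hd : 1 ≤ d) (hper : IsYPeriodic f) (hb : IsBoundedBy f b)
    (ξ : Mat m d) (hw : LipschitzWith K w) {δ τ : ℝ≥0} (hδ : 0 < δ) (hτ : 0 < τ) {x : Vec d}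
    {ρ : ℝ} (hρ : 0 < ρ) (hshell : volume (Metric.ball x ρ \ Metric.ball x ((1 - τ) * ρ)) ≤
      δ * volume (Metric.ball x ρ))
    (haff : ∀ y ∈ Metric.ball x ρ, ‖w y - aff (grad w x) x (w x) y‖ ≤ τ * ρ) :
    ∀ᶠ ε in 𝓝[>] (0 : ℝ), ∃ (K' : ℝ≥0) (q : Vec d → Vec m), LipschitzWith K' q ∧
      (∀ y ∉ Metric.ball x ρ, q y = 0) ∧
      ∫⁻ y in Metric.ball x ρ, f (ε⁻¹ • y) (ξ + grad (w + q) y) ≤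
        volume (Metric.ball x ρ) * (homog f (ξ + grad w x) +
          δ * (1 + b (‖ξ‖ + frobConst m d * (3 * K + 1 : ℝ≥0)))) := by
  let B : Set (Vec d) := Metric.ball x ρ
  let D : Set (Vec d) := Metric.ball x ((1 - τ) * ρ)
  have hDB : D ⊆ B := Metric.ball_subset_ball (by nlinarith [τ.2])
  obtain ⟨p, hp, hp0, hpD⟩ := exists_replacement_on_ball (lipschitzWith_aff_grad hw x (w x)) hw
    (compl_nonempty_of_isBounded hd Metric.isBounded_ball) hτ hρ haff
  have hwp : LipschitzWith (3 * K + 1) (w + p) := (hw.add hp).weaken (le_of_eq (by ring))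
  have hlt : volume D * homog f (ξ + grad w x) <
      volume B * homog f (ξ + grad w x) + δ * volume B := by
    refine (mul_le_mul_left (measure_mono hDB) _).trans_lt (ENNReal.lt_add_right
      (ENNReal.mul_ne_top measure_ball_lt_top.ne (hb.homog_ne_top _)) (mul_ne_zero ?_ ?_))
    · exact_mod_cast hδ.ne'
    · exact (Metric.measure_ball_pos volume x hρ).ne'
  filter_upwards [eventually_exists_energy_lt hper ENNReal.coe_ne_top (fun y => hb y le_rfl)
    Metric.isOpen_ball measure_ball_lt_top.ne hlt] with ε hε
  obtain ⟨Kψ, ψ, hψ, hψ0, hψe⟩ := hε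
  refine ⟨_, p + ψ, hp.add hψ, fun y hy => ?_, ?_⟩
  · rw [Pi.add_apply, hp0 y hy, hψ0 y fun h => hy (hDB h), add_zero]
  have hwpD : ∀ y ∈ D, grad (w + p) y = grad w x := fun y hy =>
    (grad_congr_of_eqOn Metric.isOpen_ball hpD hy).trans (grad_aff _ _ _ y)
  rw [← add_assoc]
  refine (setLIntegral_grad_add_le hb hwp measurableSet_ball measurableSet_ball
    ((convex_ball x _).addHaar_frontier volume) hDB hwpD hψ hψ0 ξ ε).trans ?_
  exact (add_le_add hψe.le (mul_le_mul_right hshell _)).trans (le_of_eq (by ring))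

lemma eventually_norm_sub_aff_le {x : Vec d} (hx : DifferentiableAt ℝ w x) {τ : ℝ} (hτ : 0 < τ) :
    ∀ᶠ r in 𝓝[>] (0 : ℝ), ∀ y ∈ Metric.ball x r, ‖w y - aff (grad w x) x (w x) y‖ ≤ τ * r := by
  obtain ⟨r₀, hr₀, hlittle⟩ :=
    Metric.eventually_nhds_iff_ball.1 (hx.hasFDerivAt.isLittleO.def hτ)
  filter_upwards [Ioo_mem_nhdsGT hr₀] with r hr y hy
  rw [aff, grad, ContinuousLinearEquiv.symm_apply_apply, ← sub_sub]
  refine (hlittle y (Metric.ball_subset_ball hr.2.le hy)).trans ?_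
  rw [← dist_eq_norm]
  gcongr
  exact (Metric.mem_ball.1 hy).le

lemma ae_eventually_volume_ball_mul_le {g : Vec d → ℝ≥0∞} (hg : Measurable g)
    {Y : Set (Vec d)} (hY : MeasurableSet Y) (hfin : ∫⁻ x in Y, g x ≠ ⊤) {δ : ℝ≥0∞} (hδ : δ ≠ 0) :
    ∀ᵐ x, x ∈ Y → ∀ᶠ r in 𝓝[>] (0 : ℝ), volume (Metric.ball x r) * g x ≤
      (∫⁻ y in Metric.ball x r, g y) + δ * volume (Metric.ball x r) := by
  rw [← lintegral_indicator hY] at hfin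
  filter_upwards [(Besicovitch.vitaliFamily volume).ae_tendsto_lintegral_div
    (hg.indicator hY).aemeasurable hfin, ae_lt_top (hg.indicator hY) hfin] with x hx hgx hxY
  have hlim := (hx.comp (Besicovitch.tendsto_filterAt volume x)).add_const δ
  filter_upwards [hlim.eventually (lt_mem_nhds (ENNReal.lt_add_right hgx.ne hδ)),
    self_mem_nhdsWithin] with r hr hr0
  rw [Function.comp_apply, ← Measure.restrict_congr_set (ball_ae_eq_closedBall x hr0),
    ← measure_congr (ball_ae_eq_closedBall x hr0), Set.indicator_of_mem hxY] at hr
  calc volume (Metric.ball x r) * g x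
      ≤ volume (Metric.ball x r) *
          ((∫⁻ y in Metric.ball x r, g y) / volume (Metric.ball x r) + δ) := by
        refine mul_le_mul_right (hr.le.trans ?_) _
        gcongr
        exact Set.indicator_le_self' (fun _ _ => zero_le) _
    _ = (∫⁻ y in Metric.ball x r, g y) + δ * volume (Metric.ball x r) := by
        rw [mul_add, ENNReal.mul_div_cancel (Metric.measure_ball_pos volume x hr0).ne'
          measure_ball_lt_top.ne, mul_comm δ]

lemma setLIntegral_add_sum_le {t : Finset (Vec d)} {ρ : Vec d → ℝ}
    (hρ : ∀ x ∈ t, 0 < ρ x)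
    (hdisj : (t : Set (Vec d)).PairwiseDisjoint (fun x => Metric.closedBall x (ρ x)))
    {q : Vec d → Vec d → Vec m} (hq : ∀ x ∈ t, ∀ y ∉ Metric.ball x (ρ x), q x y = 0)
    (F : Vec d → Mat m d → ℝ≥0∞) {B : ℝ≥0∞} (hB : ∀ y, F y (grad w y) ≤ B) (Y : Set (Vec d)) :
    ∫⁻ y in Y, F y (grad (w + fun y => ∑ x ∈ t, q x y) y) ≤
      (∑ x ∈ t, ∫⁻ y in Metric.ball x (ρ x), F y (grad (w + q x) y)) +
        B * volume (Y \ ⋃ x ∈ t, Metric.closedBall x (ρ x)) := by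
  let U : Set (Vec d) := ⋃ x ∈ t, Metric.closedBall x (ρ x)
  have hU : IsClosed U := isClosed_biUnion_finset fun _ _ => Metric.isClosed_closedBall
  let V : Vec d → Vec m := w + fun y => ∑ x ∈ t, q x y
  have hVU : ∀ y ∉ U, V y = w y := fun y hy => by
    have hsum : ∑ x ∈ t, q x y = 0 := sum_eq_zero_of_notMem_biUnion (fun x hx z hz =>
      hq x hx z fun h => hz (Metric.ball_subset_closedBall h)) hy
    simp only [V, Pi.add_apply, hsum, add_zero]
  have hVball : ∀ x ∈ t, ∀ y ∈ Metric.ball x (ρ x), V y = (w + q x) y := fun x hx y hy => by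
    have hsum : ∑ z ∈ t, q z y = q x y := sum_eq_of_pairwiseDisjoint hdisj (fun x hx z hz =>
      hq x hx z fun h => hz (Metric.ball_subset_closedBall h)) hx (Metric.ball_subset_closedBall hy)
    simp only [V, Pi.add_apply, hsum]
  calc ∫⁻ y in Y, F y (grad V y)
      ≤ (∫⁻ y in U, F y (grad V y)) + ∫⁻ y in Y \ U, F y (grad V y) := by
        rw [← lintegral_inter_add_sdiff _ Y hU.measurableSet]
        gcongr
        exact Set.inter_subset_right
    _ ≤ (∑ x ∈ t, ∫⁻ y in Metric.ball x (ρ x), F y (grad (w + q x) y)) + B * volume (Y \ U) := by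
        refine add_le_add (le_of_eq ?_) ?_
        · rw [lintegral_biUnion_finset hdisj fun _ _ => measurableSet_closedBall]
          refine Finset.sum_congr rfl fun x hx => ?_
          rw [← Measure.restrict_congr_set (ball_ae_eq_closedBall x (hρ x hx))]
          refine setLIntegral_congr_fun measurableSet_ball fun y hy => ?_
          simp only [grad_congr_of_eqOn Metric.isOpen_ball (hVball x hx) hy]
        · rw [← setLIntegral_const]
          refine setLIntegral_mono measurable_const fun y hy => ?_
          rw [grad_congr_of_eqOn hU.isOpen_compl hVU hy.2]
          exact hB y

lemma tendsto_volume_enlarged_cube (A : ℝ≥0) (ρ : ℝ) :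
    Tendsto (fun ε : ℝ => A * (ENNReal.ofReal (ρ + 2 * ε) ^ d - ENNReal.ofReal ρ ^ d))
      (𝓝[>] 0) (𝓝 0) := by
  have hcont : Continuous fun ε : ℝ => ENNReal.ofReal (ρ + 2 * ε) ^ d :=
    (ENNReal.continuous_pow d).comp (ENNReal.continuous_ofReal.comp (by fun_prop))
  have hpow : Tendsto (fun ε : ℝ => ENNReal.ofReal (ρ + 2 * ε) ^ d) (𝓝[>] 0)
      (𝓝 (ENNReal.ofReal ρ ^ d)) := by
    simpa using tendsto_nhdsWithin_of_tendsto_nhds (hcont.tendsto 0)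
  have hsub := ENNReal.Tendsto.sub hpow (tendsto_const_nhds (x := ENNReal.ofReal ρ ^ d))
    (Or.inl (by finiteness))
  simpa using ENNReal.Tendsto.const_mul (a := (A : ℝ≥0∞)) hsub (Or.inr ENNReal.coe_ne_top)

lemma sum_setLIntegral_le {X ι : Type*} [MeasurableSpace X] {μ : Measure X} {t : Finset ι}
    {B : ι → Set X} (hB : ∀ i ∈ t, MeasurableSet (B i))
    (hdisj : (t : Set ι).PairwiseDisjoint B) {Y : Set X} (hBY : ∀ i ∈ t, B i ⊆ Y)
    (h : X → ℝ≥0∞) : ∑ i ∈ t, ∫⁻ x in B i, h x ∂μ ≤ ∫⁻ x in Y, h x ∂μ := by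
  rw [← lintegral_biUnion_finset hdisj hB]
  exact lintegral_mono_set (Set.iUnion₂_subset hBY)

/-- Almost every point of `Y` is the centre of arbitrarily small balls on which `w` is nearly affine
and `g` nearly constant, so such balls form a Vitali cover of `Y`. -/
lemma exists_finset_nearly_affine_ball_cover (hw : LipschitzWith K w) {g : Vec d → ℝ≥0∞}
    (hg : Measurable g) {Y : Set (Vec d)} (hY : IsOpen Y) (hYv : volume Y ≠ ⊤)
    (hgfin : ∫⁻ x in Y, g x ≠ ⊤) {τ : ℝ} (hτ : 0 < τ) {δ : ℝ≥0∞} (hδ : δ ≠ 0) :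
    ∃ (t : Finset (Vec d)) (ρ : Vec d → ℝ),
      (∀ x ∈ t, 0 < ρ x ∧ Metric.closedBall x (ρ x) ⊆ Y ∧
        (∀ y ∈ Metric.ball x (ρ x), ‖w y - aff (grad w x) x (w x) y‖ ≤ τ * ρ x) ∧
        volume (Metric.ball x (ρ x)) * g x ≤
          (∫⁻ y in Metric.ball x (ρ x), g y) + δ * volume (Metric.ball x (ρ x))) ∧
      (t : Set (Vec d)).PairwiseDisjoint (fun x => Metric.closedBall x (ρ x)) ∧
      volume (Y \ ⋃ x ∈ t, Metric.closedBall x (ρ x)) ≤ δ := by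
  refine exists_finset_disjoint_closedBall_cover hY hYv
    (P := fun x r => (∀ y ∈ Metric.ball x r, ‖w y - aff (grad w x) x (w x) y‖ ≤ τ * r) ∧
      volume (Metric.ball x r) * g x ≤
        (∫⁻ y in Metric.ball x r, g y) + δ * volume (Metric.ball x r)) ?_ hδ
  filter_upwards [hw.ae_differentiableAt (μ := volume),
    ae_eventually_volume_ball_mul_le hg hY.measurableSet hgfin hδ] with x hx hxg hxY
  exact (eventually_norm_sub_aff_le hx hτ).and (hxg hxY)

lemma eventually_exists_replacement (hd : 1 ≤ d) (hper : IsYPeriodic f) (hb : IsBoundedBy f b)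
    (ξ : Mat m d) (hw : LipschitzWith K w) {Y : Set (Vec d)} (hY : IsOpen Y) (hYv : volume Y ≠ ⊤)
    {δ : ℝ≥0} (hδ : 0 < δ) :
    ∀ᶠ ε in 𝓝[>] (0 : ℝ), ∃ (K' : ℝ≥0) (v : Vec d → Vec m), LipschitzWith K' v ∧
      (∀ x ∉ Y, v x = w x) ∧
      ∫⁻ x in Y, f (ε⁻¹ • x) (ξ + grad v x) ≤ (∫⁻ x in Y, homog f (ξ + grad w x)) +
        δ * ((2 + b (‖ξ‖ + frobConst m d * (3 * K + 1 : ℝ≥0))) * volume Y +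
          b (‖ξ‖ + frobConst m d * (3 * K + 1 : ℝ≥0))) := by
  let R : ℝ := ‖ξ‖ + frobConst m d * (3 * K + 1 : ℝ≥0)
  let g : Vec d → ℝ≥0∞ := fun x => homog f (ξ + grad w x)
  have hg : Measurable g :=
    (upperSemicontinuous_homog hd hb).measurable.comp ((measurable_grad w).const_add ξ)
  have hR : ∀ x, ‖ξ + grad w x‖ ≤ R := fun x => by
    refine (norm_add_grad_le hw ξ x).trans (add_le_add_right ?_ _)
    exact mul_le_mul_of_nonneg_left (by push_cast; linarith [K.2]) frobConst_nonneg
  have hgfin : ∫⁻ x in Y, g x ≠ ⊤ :=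
    ne_top_of_le_ne_top (ENNReal.mul_ne_top ENNReal.coe_ne_top hYv)
      ((lintegral_mono fun x => hb.homog_le (hR x)).trans_eq (setLIntegral_const Y _))
  obtain ⟨τ, hτ, hshell⟩ := exists_volume_ball_shell_le d hδ
  obtain ⟨t, ρ, hball, hdisj, hrest⟩ := exists_finset_nearly_affine_ball_cover hw hg hY hYv hgfin
    (NNReal.coe_pos.2 hτ) (ENNReal.coe_ne_zero.2 hδ.ne')
  have hbY : ∀ x ∈ t, Metric.ball x (ρ x) ⊆ Y := fun x hx =>
    Metric.ball_subset_closedBall.trans (hball x hx).2.1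
  filter_upwards [(t.eventually_all).2 fun x hx => eventually_exists_ball_replacement hd hper hb ξ
    hw hδ hτ (hball x hx).1 (hshell x (ρ x)) (hball x hx).2.2.1] with ε hε
  choose! Kq q hq hq0 hqe using hε
  refine ⟨_, _, hw.add (lipschitzWith_sum hq), fun x hx => ?_, ?_⟩
  · simp only [Finset.sum_eq_zero fun z hz => hq0 z hz x fun h => hx (hbY z hz h), add_zero]
  refine (setLIntegral_add_sum_le (fun x hx => (hball x hx).1) hdisj hq0
    (fun y ζ => f (ε⁻¹ • y) (ξ + ζ)) (fun y => hb _ (hR y)) Y).trans ?_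
  have hballs : ∑ x ∈ t, ∫⁻ y in Metric.ball x (ρ x), f (ε⁻¹ • y) (ξ + grad (w + q x) y) ≤
      ∫⁻ x in Y, (g x + δ * (2 + b R)) := by
    refine le_trans (Finset.sum_le_sum fun x hx => ?_) (sum_setLIntegral_le (fun x _ =>
      measurableSet_ball) (hdisj.mono fun x => Metric.ball_subset_closedBall) hbY _)
    rw [lintegral_add_left hg, setLIntegral_const]
    calc ∫⁻ y in Metric.ball x (ρ x), f (ε⁻¹ • y) (ξ + grad (w + q x) y)
        ≤ volume (Metric.ball x (ρ x)) * (g x + δ * (1 + b R)) := hqe x hx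
      _ ≤ (∫⁻ y in Metric.ball x (ρ x), g y) + δ * volume (Metric.ball x (ρ x)) +
            volume (Metric.ball x (ρ x)) * (δ * (1 + b R)) := by
          rw [mul_add]
          gcongr
          exact (hball x hx).2.2.2
      _ = _ := by ring
  rw [lintegral_add_left hg, setLIntegral_const] at hballs
  exact (add_le_add hballs (mul_le_mul_right hrest _)).trans (le_of_eq (by ring))

theorem homog_le_lintegral_homog (hd : 1 ≤ d) (hper : IsYPeriodic f) (hb : IsBoundedBy f b)
    (ξ : Mat m d) (hw : LipschitzWith K w) (h0 : ∀ x ∉ cube d 1, w x = 0) :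
    homog f ξ ≤ ∫⁻ x in cube d 1, homog f (ξ + grad w x) := by
  have hY : box (0 : Vec d) 1 = cube d 1 := by rw [cube_eq_box, Nat.cast_one]
  have hYv : volume (cube d 1) = 1 := by rw [volume_cube, Nat.cast_one, one_pow]
  let R : ℝ := ‖ξ‖ + frobConst m d * (3 * K + 1 : ℝ≥0)
  refine le_of_forall_pos_le_add_mul (V := 3 + 2 * b R) (by finiteness) fun δ hδ => ?_
  obtain ⟨ε, ⟨⟨K', v, hv, hvw, hve⟩, hεδ⟩, hε⟩ :=
    (((eventually_exists_replacement hd hper hb ξ hw (isOpen_cube 1)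
      (by rw [hYv]; exact ENNReal.one_ne_top) hδ).and
      ((tendsto_volume_enlarged_cube (d := d) (b ‖ξ‖) 1).eventually
        (gt_mem_nhds (ENNReal.coe_pos.2 hδ)))).and self_mem_nhdsWithin).exists
  have hcell := volume_mul_homog_le (ξ := ξ) hper (fun x => hb x le_rfl) 0 one_pos hε hv
    (fun x hx => by rw [hY] at hx; rw [hvw x hx, h0 x hx])
  rw [hY, ENNReal.ofReal_one, one_pow, one_mul] at hcell
  rw [ENNReal.ofReal_one, one_pow] at hεδ
  refine hcell.trans ((add_le_add hve hεδ.le).trans (le_of_eq ?_))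
  rw [hYv]
  ring

theorem isQuasiconvex_homog (hd : 1 ≤ d) (hper : IsYPeriodic f) (hb : IsBoundedBy f b) :
    IsQuasiconvex (homog f) := by
  refine ⟨hb.homog_ne_top, (upperSemicontinuous_homog hd hb).measurable,
    fun ξ => le_antisymm (le_iInf₂ fun φ hφ => ?_) ?_⟩
  · obtain ⟨K, w, hw, hw0, hgw⟩ := hφ.exists_extension (isOpen_cube 1) (convex_cube 1)
    refine (homog_le_lintegral_homog hd hper hb ξ hw hw0).trans_eq (lintegral_congr_ae ?_)
    filter_upwards [hgw] with x hx
    rw [hx]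
  · have h0 : LipschitzWith 0 (fun _ : Vec d => (0 : Vec m)) := LipschitzWith.const 0
    refine iInf₂_le_of_le (W1inf.ofLipschitz h0 (measurableSet_cube 1) (isBounded_cube 1))
      (W1inf.isZeroOnBoundary_ofLipschitz h0 (isOpen_cube 1) (isBounded_cube 1) fun _ _ => rfl)
      (le_of_eq ?_)
    have hgrad : (W1inf.ofLipschitz h0 (measurableSet_cube (d := d) 1) (isBounded_cube 1)).grad =
        fun _ => 0 := funext (grad_const 0)
    rw [hgrad]
    simp [volume_cube]

end Quasiconvexity

section WeakStarConvergence

lemma ae_abs_le_of_abs_setIntegral_le {X : Type*} [MeasurableSpace X] {μ : Measure X}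
    [IsFiniteMeasure μ] {g : X → ℝ} (hg : Integrable g μ) {C : ℝ}
    (h : ∀ s, MeasurableSet s → |∫ x in s, g x ∂μ| ≤ C * μ.real s) : ∀ᵐ x ∂μ, |g x| ≤ C := by
  have hC : ∀ s, ∫ _ in s, C ∂μ = C * μ.real s := fun s => by
    rw [setIntegral_const, smul_eq_mul, mul_comm]
  have hle : g ≤ᵐ[μ] fun _ => C :=
    ae_le_of_forall_setIntegral_le hg (integrable_const C) fun s hs _ =>
      (le_abs_self _).trans ((h s hs).trans_eq (hC s).symm)
  have hge : -g ≤ᵐ[μ] fun _ => C :=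
    ae_le_of_forall_setIntegral_le hg.neg (integrable_const C) fun s hs _ => by
      simp only [Pi.neg_apply, integral_neg]
      exact (neg_le_abs _).trans ((h s hs).trans_eq (hC s).symm)
  filter_upwards [hle, hge] with x hx hx' using abs_le'.2 ⟨hx, hx'⟩

/-- Banach–Steinhaus in `L^∞`, the dual of `L¹`. -/
lemma exists_ae_abs_le_of_integral_mul_bounded {X ι : Type*} [MeasurableSpace X] {μ : Measure X}
    [IsFiniteMeasure μ] {g : ι → X → ℝ} (hg : ∀ n, MemLp (g n) ⊤ μ)
    (hb : ∀ h : X → ℝ, Integrable h μ → ∃ C, ∀ n, |∫ x, g n x * h x ∂μ| ≤ C) :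
    ∃ C : ℝ, ∀ n, ∀ᵐ x ∂μ, |g n x| ≤ C := by
  let T : ι → (Lp ℝ 1 μ →L[ℝ] ℝ) := fun n =>
    (ContinuousLinearMap.mul ℝ ℝ).lpPairing μ ⊤ 1 (hg n).toLp
  have hT : ∀ n (h : Lp ℝ 1 μ), T n h = ∫ x, g n x * h x ∂μ := fun n h => by
    rw [ContinuousLinearMap.lpPairing_eq_integral]
    refine integral_congr_ae ?_
    filter_upwards [(hg n).coeFn_toLp] with x hx
    rw [hx, ContinuousLinearMap.mul_apply']
  obtain ⟨C, hC⟩ := banach_steinhaus (g := T) fun h => by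
    simpa only [hT, Real.norm_eq_abs] using hb h (L1.integrable_coeFn h)
  refine ⟨C, fun n => ae_abs_le_of_abs_setIntegral_le ((hg n).integrable le_top) fun s hs => ?_⟩
  have hTs : T n (indicatorConstLp 1 hs (measure_ne_top μ s) 1) = ∫ x in s, g n x ∂μ := by
    rw [hT, ← integral_indicator hs]
    refine integral_congr_ae ?_
    filter_upwards [indicatorConstLp_coeFn (p := 1) (hs := hs) (hμs := measure_ne_top μ s)
      (c := (1 : ℝ))] with x hx
    rw [hx, ← Set.indicator_mul_right]
    simp only [mul_one]
  calc |∫ x in s, g n x ∂μ| ≤ ‖T n‖ * ‖indicatorConstLp 1 hs (measure_ne_top μ s) (1 : ℝ)‖ := by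
        rw [← hTs]
        exact (T n).le_opNorm _
    _ ≤ C * μ.real s := by
        rw [norm_indicatorConstLp one_ne_zero ENNReal.one_ne_top]
        simpa using mul_le_mul_of_nonneg_right (hC n) measureReal_nonneg

lemma exists_ae_norm_grad_le_of_tendsto {Ω : Set (Vec d)} (hΩ : volume Ω ≠ ⊤) {v : ℕ → W1inf Ω m}
    {u : W1inf Ω m}
    (hv : ∀ h : Vec d → ℝ, Integrable h (volume.restrict Ω) → ∀ (i : Fin m) (j : Fin d),
      Tendsto (fun n => ∫ x in Ω, (v n).grad x (i, j) * h x) atTop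
        (𝓝 (∫ x in Ω, u.grad x (i, j) * h x))) :
    ∃ C : ℝ≥0, ∀ n, ∀ᵐ x ∂(volume.restrict Ω), ‖(v n).grad x‖ ≤ C := by
  have : IsFiniteMeasure (volume.restrict Ω) := isFiniteMeasure_restrict.2 hΩ
  have hentry : ∀ p : Fin m × Fin d, ∃ C : ℝ, ∀ n, ∀ᵐ x ∂(volume.restrict Ω),
      |(v n).grad x p| ≤ C := fun p =>
    exists_ae_abs_le_of_integral_mul_bounded (fun n => memLp_apply (v n).memLp_grad p) fun h hh =>
      let ⟨C, hC⟩ := (hv h hh p.1 p.2).norm.bddAbove_range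
      ⟨C, fun n => hC ⟨n, rfl⟩⟩
  choose C hC using hentry
  obtain ⟨M, hM⟩ := (Set.finite_range C).bddAbove
  refine ⟨Real.toNNReal (Fintype.card (Fin m × Fin d) * M), fun n => ?_⟩
  filter_upwards [ae_all_iff.2 fun p => hC p n] with x hx
  exact (norm_le_card_mul _ fun p => (hx p).trans (hM ⟨p, rfl⟩)).trans (Real.le_coe_toNNReal _)

variable {X E ι : Type*} [PseudoMetricSpace X] [NormedAddCommGroup E] {K : ℝ≥0} {l : Filter ι}
  {w : ι → X → E} {w₀ : X → E}

lemma dist_setAverage_ball_le [NormedSpace ℝ E] [CompleteSpace E] [ProperSpace X]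
    [MeasurableSpace X] [OpensMeasurableSpace X] {μ : Measure X} [μ.IsOpenPosMeasure]
    [IsFiniteMeasureOnCompacts μ] {g : X → E} (hg : LipschitzWith K g) (x : X) {r : ℝ}
    (hr : 0 < r) : dist (⨍ y in Metric.ball x r, g y ∂μ) (g x) ≤ K * r := by
  refine Metric.mem_closedBall.1 ((convex_closedBall (g x) (K * r)).set_average_mem
    Metric.isClosed_closedBall (Metric.measure_ball_pos μ x hr).ne' measure_ball_lt_top.ne ?_ ?_)
  · filter_upwards [ae_restrict_mem measurableSet_ball] with y hy
    exact (hg.dist_le_mul y x).trans (by gcongr; exact (Metric.mem_ball.1 hy).le)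
  · exact (hg.continuous.continuousOn.integrableOn_compact' (isCompact_closedBall x r)
      measurableSet_closedBall).mono_set Metric.ball_subset_closedBall

lemma tendsto_of_tendsto_setIntegral_ball [NormedSpace ℝ E] [CompleteSpace E] [ProperSpace X]
    [MeasurableSpace X] [OpensMeasurableSpace X] {μ : Measure X} [μ.IsOpenPosMeasure]
    [IsFiniteMeasureOnCompacts μ] (hw : ∀ n, LipschitzWith K (w n)) (hw₀ : LipschitzWith K w₀)
    {x : X} (hconv : ∀ᶠ r in 𝓝[>] (0 : ℝ), Tendsto (fun n => ∫ y in Metric.ball x r, w n y ∂μ) l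
      (𝓝 (∫ y in Metric.ball x r, w₀ y ∂μ))) :
    Tendsto (fun n => w n x) l (𝓝 (w₀ x)) := by
  rw [Metric.tendsto_nhds]
  intro η hη
  have hsmall : ∀ᶠ r in 𝓝[>] (0 : ℝ), K * r < η / 3 := by
    have hlim : Tendsto (fun r : ℝ => K * r) (𝓝[>] 0) (𝓝 (K * 0)) :=
      tendsto_nhdsWithin_of_tendsto_nhds (Continuous.tendsto (by fun_prop) 0)
    exact hlim.eventually (gt_mem_nhds (by rw [mul_zero]; positivity))
  obtain ⟨r, ⟨hr, hKr⟩, hr0⟩ := ((hconv.and hsmall).and self_mem_nhdsWithin).exists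
  have havg : Tendsto (fun n => ⨍ y in Metric.ball x r, w n y ∂μ) l
      (𝓝 (⨍ y in Metric.ball x r, w₀ y ∂μ)) := by
    simp only [setAverage_eq]
    exact hr.const_smul _
  filter_upwards [Metric.tendsto_nhds.1 havg (η / 3) (by positivity)] with n hn
  have hwn := dist_setAverage_ball_le (μ := μ) (hw n) x hr0
  have hw₀' := dist_setAverage_ball_le (μ := μ) hw₀ x hr0
  rw [dist_comm] at hwn
  linarith [dist_triangle4 (w n x) (⨍ y in Metric.ball x r, w n y ∂μ)
    (⨍ y in Metric.ball x r, w₀ y ∂μ) (w₀ x)]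

lemma tendstoUniformlyOn_of_lipschitzWith {Y : Type*} [PseudoMetricSpace Y] {w : ι → X → Y}
    {w₀ : X → Y} (hw : ∀ n, LipschitzWith K (w n)) {S : Set X} (hS : IsCompact S)
    (hconv : ∀ x ∈ S, Tendsto (fun n => w n x) l (𝓝 (w₀ x))) : TendstoUniformlyOn w w₀ l S := by
  refine UniformOnFun.tendsto_iff_tendstoUniformlyOn.1
    ((EquicontinuousOn.tendsto_uniformOnFun_iff_pi' (𝔖 := {S}) (by simpa using hS)
      (fun _ _ => (LipschitzWith.uniformEquicontinuous w K hw).equicontinuous.equicontinuousOn _)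
      l w₀).2 ?_) S rfl
  rw [tendsto_pi_nhds]
  rintro ⟨x, hx⟩
  exact hconv x (by simpa using hx)

end WeakStarConvergence

section CubeAverages

lemma eventually_box_subset {B : Set (Vec d)} {x : Vec d} (hB : B ∈ 𝓝 x) :
    ∀ᶠ ρ in 𝓝[>] (0 : ℝ), box x ρ ⊆ B := by
  obtain ⟨r, hr, hrB⟩ := Metric.nhds_basis_closedBall.mem_iff.1 hB
  have hlim : Tendsto (fun ρ : ℝ => d * ρ) (𝓝[>] 0) (𝓝 0) :=
    tendsto_nhdsWithin_of_tendsto_nhds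
      ((continuous_const_mul (d : ℝ)).tendsto' 0 0 (mul_zero (d : ℝ)))
  filter_upwards [hlim.eventually (gt_mem_nhds hr)] with ρ hρ
  exact (box_subset_closedBall x ρ).trans ((Metric.closedBall_subset_closedBall hρ.le).trans hrB)

lemma setLIntegral_box_eq (F : Vec d → ℝ≥0∞) (a : Vec d) (ρ : ℝ) :
    ∫⁻ x in box a ρ, F x = ∫⁻ y in box 0 ρ, F (a + y) := by
  have hbox : (fun y => a + y) ⁻¹' box a ρ = box 0 ρ := by
    ext y
    simp [box]
  rw [← hbox]
  exact ((measurePreserving_add_left volume a).setLIntegral_comp_preimage_emb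
    (measurableEmbedding_addLeft a) F _).symm

lemma setLAverage_box_eq {F : Vec d → ℝ≥0∞} (hF : AEMeasurable F) (a : Vec d) (ρ : ℝ) :
    ⨍⁻ x in box a ρ, F x ∂volume =
      (∫⁻ y in box 0 ρ, hF.mk F (a + y)) / ENNReal.ofReal ρ ^ d := by
  rw [setLAverage_eq, volume_box, lintegral_congr_ae (ae_restrict_of_ae hF.ae_eq_mk),
    setLIntegral_box_eq]

lemma measurable_setLAverage_box {F : Vec d → ℝ≥0∞} (hF : AEMeasurable F) (ρ : ℝ) :
    Measurable fun a => ⨍⁻ x in box a ρ, F x ∂volume := by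
  simp only [setLAverage_box_eq hF]
  exact (hF.measurable_mk.comp measurable_add).lintegral_prod_right'.div_const _

lemma lintegral_setLAverage_box {F : Vec d → ℝ≥0∞} (hF : AEMeasurable F) {ρ : ℝ} (hρ : 0 < ρ) :
    ∫⁻ a, ⨍⁻ x in box a ρ, F x ∂volume = ∫⁻ x, F x := by
  have hV : ENNReal.ofReal ρ ^ d ≠ 0 := pow_ne_zero _ (ENNReal.ofReal_pos.2 hρ).ne'
  have hG : Measurable fun p : Vec d × Vec d => hF.mk F (p.1 + p.2) :=
    hF.measurable_mk.comp measurable_add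
  simp only [setLAverage_box_eq hF, div_eq_mul_inv]
  rw [lintegral_mul_const _ hG.lintegral_prod_right', lintegral_lintegral_swap hG.aemeasurable]
  simp only [lintegral_add_right_eq_self]
  rw [setLIntegral_const, volume_box, mul_assoc, ENNReal.mul_inv_cancel hV (by finiteness), mul_one,
    lintegral_congr_ae hF.ae_eq_mk]

/-- Fatou's lemma twice, since averaging over cubes preserves the integral. -/
lemma setLIntegral_le_of_le_liminf_setLAverage {F : ℕ → Vec d → ℝ≥0∞}
    (hF : ∀ n, AEMeasurable (F n)) {a : ℝ≥0∞} (ha : ∀ n, ∫⁻ x, F n x ≤ a) {S : Set (Vec d)}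
    {g : Vec d → ℝ≥0∞} (hg : ∀ᵐ x ∂(volume.restrict S), g x ≤
      liminf (fun ρ : ℝ => liminf (fun n => ⨍⁻ y in box x ρ, F n y ∂volume) atTop) (𝓝[>] 0)) :
    ∫⁻ x in S, g x ≤ a := by
  let A : ℝ → Vec d → ℝ≥0∞ := fun ρ x => liminf (fun n => ⨍⁻ y in box x ρ, F n y ∂volume) atTop
  have hA : ∀ ρ ∈ Set.Ioi (0 : ℝ), ∫⁻ x, A ρ x ≤ a := fun ρ hρ =>
    (lintegral_liminf_le fun n => measurable_setLAverage_box (hF n) ρ).trans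
      (liminf_le_of_frequently_le' (Frequently.of_forall fun n =>
        (lintegral_setLAverage_box (hF n) hρ).trans_le (ha n)))
  calc ∫⁻ x in S, g x
      ≤ ∫⁻ x, liminf (fun ρ => A ρ x) (𝓝[>] 0) :=
        (lintegral_mono_ae hg).trans (setLIntegral_le_lintegral _ _)
    _ ≤ liminf (fun ρ => ∫⁻ x, A ρ x) (𝓝[>] 0) :=
        lintegral_liminf_le fun ρ => .liminf fun n => measurable_setLAverage_box (hF n) ρ
    _ ≤ a := liminf_le_of_frequently_le' (eventually_mem_nhdsWithin.mono hA).frequently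

lemma box_inter_cthickening_compl_subset (a : Vec d) (ρ : ℝ) {t : ℝ} (ht : 0 < t) :
    box a ρ ∩ Metric.cthickening t (box a ρ)ᶜ ⊆
      box a ρ \ box (WithLp.toLp 2 fun j => a j + 2 * t) (ρ - 4 * t) := by
  refine fun x hx => ⟨hx.1, fun hxI => ?_⟩
  obtain ⟨y, hy, hxy⟩ := Metric.mem_thickening_iff.1
    (Metric.cthickening_subset_thickening' (δ₂ := 2 * t) (by positivity) (by linarith) _ hx.2)
  refine hy (closedBall_subset_box (x := x) (t := 2 * t) (fun j => ?_) ?_)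
  · have := hxI j
    constructor <;> linarith
  · rw [Metric.mem_closedBall, dist_comm]
    exact hxy.le

lemma exists_volume_box_shell_le (d : ℕ) {δ : ℝ≥0} (hδ : 0 < δ) :
    ∃ τ : ℝ≥0, 0 < τ ∧ ∀ (a : Vec d) (ρ : ℝ), 0 < ρ →
      volume (box a ρ ∩ Metric.cthickening (τ * ρ) (box a ρ)ᶜ) ≤ ENNReal.ofReal ρ ^ d * δ := by
  have hlim : Tendsto (fun τ : ℝ => 1 - (1 - 4 * τ) ^ d) (𝓝[>] 0) (𝓝 (1 - (1 - 4 * 0) ^ d)) :=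
    tendsto_nhdsWithin_of_tendsto_nhds (Continuous.tendsto (by fun_prop) 0)
  have hlt : (1 : ℝ) - (1 - 4 * 0) ^ d < δ := by simpa using hδ
  obtain ⟨τ, hτ, hτ0, hτ4⟩ := ((hlim.eventually (gt_mem_nhds hlt)).and
    (Ioo_mem_nhdsGT (by norm_num : (0 : ℝ) < 1 / 4))).exists
  lift τ to ℝ≥0 using hτ0.le
  refine ⟨τ, hτ0, fun a ρ hρ => ?_⟩
  have hτρ : 0 < τ * ρ := mul_pos hτ0 hρ
  have hτ' : 0 < 1 - 4 * (τ : ℝ) := by linarith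
  have hinner : box (WithLp.toLp 2 fun j => a j + 2 * (τ * ρ)) (ρ - 4 * (τ * ρ)) ⊆ box a ρ :=
    fun x hx j => by
      have := hx j
      constructor <;> linarith
  refine (measure_mono (box_inter_cthickening_compl_subset a ρ hτρ)).trans ?_
  rw [measure_sdiff hinner (measurableSet_box _ _).nullMeasurableSet
      (by rw [volume_box]; finiteness), volume_box, volume_box, tsub_le_iff_right,
    show ρ - 4 * (τ * ρ) = ρ * (1 - 4 * τ) by ring, ENNReal.ofReal_mul hρ.le, mul_pow, ← mul_add]
  refine le_mul_of_one_le_right zero_le ?_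
  rw [← ENNReal.ofReal_coe_nnreal, ← ENNReal.ofReal_pow hτ'.le,
    ← ENNReal.ofReal_add (by positivity) (by positivity), ENNReal.one_le_ofReal]
  linarith

end CubeAverages

section BlowUp

variable {f : Vec d → Mat m d → ℝ≥0∞} {b : ℝ → ℝ≥0} {K : ℝ≥0}

/-- Cutting off `w - aff ξ a c` near the boundary of a cube turns `w` into a competitor for `ξ`. -/
lemma volume_mul_homog_le_of_near_aff (hd : 1 ≤ d) (hper : IsYPeriodic f) (hb : IsBoundedBy f b)
    {w : Vec d → Vec m} (hw : LipschitzWith K w) (ξ : Mat m d) (a : Vec d) (c : Vec m)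
    {ρ ε : ℝ} (hρ : 0 < ρ) (hε : 0 < ε) {t : ℝ≥0} (ht : 0 < t)
    (hnear : ∀ y ∈ box a ρ, ‖w y - aff ξ a c y‖ ≤ t) :
    ENNReal.ofReal ρ ^ d * homog f ξ ≤ (∫⁻ x in box a ρ, f (ε⁻¹ • x) (grad w x)) +
      b (‖ξ‖ + frobConst m d * (K + ‖matEquiv.symm ξ‖₊ + 1)) *
        volume (box a ρ ∩ Metric.cthickening t (box a ρ)ᶜ) +
      b ‖ξ‖ * (ENNReal.ofReal (ρ + 2 * ε) ^ d - ENNReal.ofReal ρ ^ d) := by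
  obtain ⟨p, hp, hp0, hpe⟩ := exists_cutoff (compl_nonempty_of_isBounded hd (isBounded_box a ρ))
    (hw.sub (lipschitzWith_aff ξ a c)) ht hnear
  rw [div_self ht.ne'] at hp
  refine (volume_mul_homog_le hper (fun x => hb x le_rfl) a hρ hε hp hp0).trans
    (add_le_add_left ?_ _)
  refine setLIntegral_le_add_layer (measurableSet_box _ _)
    Metric.isClosed_cthickening.measurableSet ?_
    (Eventually.of_forall fun x _ => hb _ (norm_add_grad_le hp ξ x))
  filter_upwards [hw.ae_differentiableAt (μ := volume)] with x hx _ hxL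
  have hgrad : grad p x = grad w x - ξ := by
    rw [grad_congr_of_eqOn Metric.isClosed_cthickening.isOpen_compl (fun y hy => hpe y hy) hxL,
      grad_eq_of_hasFDerivAt (hx.hasFDerivAt.fun_sub (hasFDerivAt_aff ξ a c x)), map_sub,
      ContinuousLinearEquiv.apply_symm_apply, grad]
  rw [hgrad, add_sub_cancel]

variable {ε : ℕ → ℝ} {w : ℕ → Vec d → Vec m} {w₀ : Vec d → Vec m} {x₀ : Vec d}

lemma eventually_eventually_norm_sub_aff_le (hw : ∀ n, LipschitzWith K (w n))
    (hconv : ∀ᶠ x in 𝓝 x₀, Tendsto (fun n => w n x) atTop (𝓝 (w₀ x)))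
    (hdiff : DifferentiableAt ℝ w₀ x₀) {τ : ℝ} (hτ : 0 < τ) :
    ∀ᶠ ρ in 𝓝[>] (0 : ℝ), ∀ᶠ n in atTop, ∀ y ∈ box x₀ ρ,
      ‖w n y - aff (grad w₀ x₀) x₀ (w₀ x₀) y‖ ≤ τ * ρ := by
  have hscale : Tendsto (fun ρ : ℝ => (d + 1) * ρ) (𝓝[>] 0) (𝓝[>] 0) :=
    tendsto_nhdsWithin_iff.2 ⟨tendsto_nhdsWithin_of_tendsto_nhds
      ((continuous_const_mul ((d : ℝ) + 1)).tendsto' 0 0 (mul_zero ((d : ℝ) + 1))),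
      eventually_mem_nhdsWithin.mono fun ρ hρ => mul_pos (by positivity : (0 : ℝ) < d + 1) hρ⟩
  obtain ⟨r, hr, hball⟩ := Metric.nhds_basis_closedBall.eventually_iff.1 hconv
  filter_upwards [hscale.eventually (eventually_norm_sub_aff_le hdiff
    (τ := τ / (2 * (d + 1))) (by positivity)),
    hscale.eventually (Ioo_mem_nhdsGT hr), self_mem_nhdsWithin] with ρ haff hρr hρ
  rw [Set.mem_Ioi] at hρ
  have hbox : box x₀ ρ ⊆ Metric.ball x₀ ((d + 1) * ρ) :=
    (box_subset_closedBall x₀ ρ).trans (Metric.closedBall_subset_ball (by nlinarith))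
  have hunif := tendstoUniformlyOn_of_lipschitzWith hw (isCompact_closedBall x₀ r) hball
  filter_upwards [Metric.tendstoUniformlyOn_iff.1 hunif (τ * ρ / 2) (by positivity)] with n hn y hy
  have hy' := hbox hy
  have hny := hn y ((Metric.ball_subset_closedBall.trans
    (Metric.closedBall_subset_closedBall hρr.2.le)) hy')
  rw [dist_comm, dist_eq_norm] at hny
  calc ‖w n y - aff (grad w₀ x₀) x₀ (w₀ x₀) y‖
      ≤ ‖w n y - w₀ y‖ + ‖w₀ y - aff (grad w₀ x₀) x₀ (w₀ x₀) y‖ :=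
        norm_sub_le_norm_sub_add_norm_sub _ _ _
    _ ≤ τ * ρ / 2 + τ / (2 * (d + 1)) * ((d + 1) * ρ) := add_le_add hny.le (haff y hy')
    _ = τ * ρ := by field_simp; ring

lemma eventually_eventually_homog_le (hd : 1 ≤ d) (hper : IsYPeriodic f) (hb : IsBoundedBy f b)
    (hε : Tendsto ε atTop (𝓝[>] 0)) (hw : ∀ n, LipschitzWith K (w n))
    (hconv : ∀ᶠ x in 𝓝 x₀, Tendsto (fun n => w n x) atTop (𝓝 (w₀ x)))
    (hdiff : DifferentiableAt ℝ w₀ x₀) {δ : ℝ≥0} (hδ : 0 < δ) :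
    ∀ᶠ ρ in 𝓝[>] (0 : ℝ), ∀ᶠ n in atTop, homog f (grad w₀ x₀) ≤
      (⨍⁻ x in box x₀ ρ, f ((ε n)⁻¹ • x) (grad (w n) x) ∂volume) + δ * (1 + b (‖grad w₀ x₀‖ +
        frobConst m d * (K + ‖matEquiv.symm (grad w₀ x₀)‖₊ + 1))) := by
  let ξ : Mat m d := grad w₀ x₀
  let B : ℝ≥0 := b (‖ξ‖ + frobConst m d * (K + ‖matEquiv.symm ξ‖₊ + 1))
  obtain ⟨τ, hτ0, hτ⟩ := exists_volume_box_shell_le d hδ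
  filter_upwards [eventually_eventually_norm_sub_aff_le hw hconv hdiff (NNReal.coe_pos.2 hτ0),
    self_mem_nhdsWithin] with ρ hρaff hρ
  lift ρ to ℝ≥0 using (Set.mem_Ioi.1 hρ).le
  let V : ℝ≥0∞ := ENNReal.ofReal ρ ^ d
  have hV : V ≠ 0 := pow_ne_zero _ (ENNReal.ofReal_pos.2 hρ).ne'
  have hV' : V ≠ ⊤ := by finiteness
  have hsmall : ∀ᶠ n in atTop, (b ‖ξ‖ : ℝ≥0∞) * (ENNReal.ofReal (ρ + 2 * ε n) ^ d - V) < V * δ :=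
    ((tendsto_volume_enlarged_cube (b ‖ξ‖) ρ).comp hε).eventually
      (gt_mem_nhds (ENNReal.mul_pos hV (by exact_mod_cast hδ.ne')))
  filter_upwards [hρaff, hsmall, hε.eventually self_mem_nhdsWithin] with n hn hns hεn
  have hnear := volume_mul_homog_le_of_near_aff hd hper hb (hw n) ξ x₀ (w₀ x₀) hρ hεn
    (t := τ * ρ) (mul_pos hτ0 hρ) (by exact_mod_cast hn)
  rw [setLAverage_eq, volume_box]
  have hmul : V * homog f ξ ≤
      (∫⁻ x in box x₀ ρ, f ((ε n)⁻¹ • x) (grad (w n) x)) + V * (δ * (1 + B)) :=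
    calc V * homog f ξ ≤ (∫⁻ x in box x₀ ρ, f ((ε n)⁻¹ • x) (grad (w n) x)) + B * (V * δ) + V * δ :=
          hnear.trans (add_le_add (add_le_add_right (mul_le_mul_right (hτ x₀ ρ hρ) _) _) hns.le)
      _ = (∫⁻ x in box x₀ ρ, f ((ε n)⁻¹ • x) (grad (w n) x)) + V * (δ * (1 + B)) := by ring
  calc homog f ξ ≤ ((∫⁻ x in box x₀ ρ, f ((ε n)⁻¹ • x) (grad (w n) x)) + V * (δ * (1 + B))) / V :=
        (ENNReal.le_div_iff_mul_le (Or.inl hV) (Or.inl hV')).2 (by rwa [mul_comm])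
    _ = (∫⁻ x in box x₀ ρ, f ((ε n)⁻¹ • x) (grad (w n) x)) / V + δ * (1 + B) := by
        rw [ENNReal.add_div, mul_comm V, ENNReal.mul_div_cancel_right hV hV']

theorem homog_grad_le_liminf_setLAverage (hd : 1 ≤ d) (hper : IsYPeriodic f) (hb : IsBoundedBy f b)
    (hε : Tendsto ε atTop (𝓝[>] 0)) (hw : ∀ n, LipschitzWith K (w n))
    (hconv : ∀ᶠ x in 𝓝 x₀, Tendsto (fun n => w n x) atTop (𝓝 (w₀ x)))
    (hdiff : DifferentiableAt ℝ w₀ x₀) :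
    homog f (grad w₀ x₀) ≤ liminf (fun ρ => liminf (fun n =>
      ⨍⁻ x in box x₀ ρ, f ((ε n)⁻¹ • x) (grad (w n) x) ∂volume) atTop) (𝓝[>] (0 : ℝ)) := by
  refine le_of_forall_pos_le_add_mul (V := 1 + b (‖grad w₀ x₀‖ +
    frobConst m d * (K + ‖matEquiv.symm (grad w₀ x₀)‖₊ + 1))) (by finiteness) fun δ hδ => ?_
  rw [← tsub_le_iff_right]
  refine le_liminf_of_le (by isBoundedDefault) ?_
  filter_upwards [eventually_eventually_homog_le hd hper hb hε hw hconv hdiff hδ] with ρ hρ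
  exact le_liminf_of_le (by isBoundedDefault) (hρ.mono fun n hn => tsub_le_iff_right.2 hn)

end BlowUp

section LowerBound

variable {Ω : Set (Vec d)} {ι κ : Type*} {l : Filter ι}

/-- Weak* convergence in `W^{1,∞}(Ω; ℝ^m)` along an arbitrary filter, so that subsequences can be
extracted; `W1inf.WeakStarTendsto` is the case of the filter `𝓝[>] 0`. -/
def W1inf.TendstoWeakStar (v : ι → W1inf Ω m) (l : Filter ι) (u : W1inf Ω m) : Prop :=
  ∀ h : Vec d → ℝ, Integrable h (volume.restrict Ω) →
    (∀ i : Fin m, Tendsto (fun k => ∫ x in Ω, (v k).toFun x i * h x) l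
      (𝓝 (∫ x in Ω, u.toFun x i * h x))) ∧
    (∀ (i : Fin m) (j : Fin d), Tendsto (fun k => ∫ x in Ω, (v k).grad x (i, j) * h x) l
      (𝓝 (∫ x in Ω, u.grad x (i, j) * h x)))

lemma W1inf.TendstoWeakStar.comp {v : ι → W1inf Ω m} {u : W1inf Ω m}
    (hv : W1inf.TendstoWeakStar v l u) {k : κ → ι} {l' : Filter κ} (hk : Tendsto k l' l) :
    W1inf.TendstoWeakStar (v ∘ k) l' u :=
  fun h hh => ⟨fun i => ((hv h hh).1 i).comp hk, fun i j => ((hv h hh).2 i j).comp hk⟩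

lemma setIntegral_mul_indicator_one {X : Type*} [MeasurableSpace X] {μ : Measure X} {S s : Set X}
    (hs : MeasurableSet s) (hsS : s ⊆ S) {g q : X → ℝ} (hgq : g =ᵐ[μ.restrict s] q) :
    ∫ x in S, g x * s.indicator 1 x ∂μ = ∫ x in s, q x ∂μ := by
  have hind : ∀ x, g x * s.indicator 1 x = s.indicator g x := fun x => by
    by_cases hx : x ∈ s <;> simp [hx]
  simp only [hind]
  rw [setIntegral_indicator hs, Set.inter_eq_right.2 hsS, integral_congr_ae hgq]

lemma W1inf.TendstoWeakStar.tendsto_representative {v : ι → W1inf Ω m} {u : W1inf Ω m}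
    (hv : W1inf.TendstoWeakStar v l u) {B : Set (Vec d)} (hB : IsOpen B) (hBΩ : B ⊆ Ω) {K : ℝ≥0}
    {w : ι → Vec d → Vec m} {w₀ : Vec d → Vec m} (hw : ∀ k, LipschitzWith K (w k))
    (hw₀ : LipschitzWith K w₀) (hvw : ∀ k, (v k).toFun =ᵐ[volume.restrict B] w k)
    (huw : u.toFun =ᵐ[volume.restrict B] w₀) {x : Vec d} (hx : x ∈ B) :
    Tendsto (fun k => w k x) l (𝓝 (w₀ x)) := by
  refine (EuclideanSpace.equiv (Fin m) ℝ).toHomeomorph.isInducing.tendsto_nhds_iff.2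
    (tendsto_pi_nhds.2 fun i => ?_)
  refine tendsto_of_tendsto_setIntegral_ball (μ := volume)
    (fun k => lipschitzWith_apply (hw k) i) (lipschitzWith_apply hw₀ i) ?_
  obtain ⟨r₀, hr₀, hball⟩ := Metric.isOpen_iff.1 hB x hx
  filter_upwards [Ioo_mem_nhdsGT hr₀] with r hr
  have hrB : Metric.ball x r ⊆ B := (Metric.ball_subset_ball hr.2.le).trans hball
  have hint : Integrable ((Metric.ball x r).indicator (1 : Vec d → ℝ)) (volume.restrict Ω) :=
    ((integrable_indicator_iff measurableSet_ball).2
      (integrableOn_const measure_ball_lt_top.ne)).restrict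
  have htest : ∀ {g q : Vec d → Vec m}, g =ᵐ[volume.restrict B] q →
      ∫ y in Ω, g y i * (Metric.ball x r).indicator 1 y = ∫ y in Metric.ball x r, q y i :=
    fun hgq => setIntegral_mul_indicator_one measurableSet_ball (hrB.trans hBΩ)
      ((hgq.filter_mono (ae_mono (Measure.restrict_mono hrB le_rfl))).fun_comp fun z => z i)
  simpa only [htest huw, htest (hvw _)] using (hv _ hint).1 i

variable {f : Vec d → Mat m d → ℝ≥0∞} {b : ℝ → ℝ≥0} {ε : ℕ → ℝ} {v : ℕ → W1inf Ω m}
  {u : W1inf Ω m}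

lemma ae_homog_grad_le_liminf_of_convex (hd : 1 ≤ d) (hper : IsYPeriodic f) (hb : IsBoundedBy f b)
    (hε : Tendsto ε atTop (𝓝[>] 0)) (hv : W1inf.TendstoWeakStar v atTop u) {C : ℝ≥0}
    (hvC : ∀ n, ∀ᵐ x ∂(volume.restrict Ω), ‖(v n).grad x‖ ≤ C)
    (huC : ∀ᵐ x ∂(volume.restrict Ω), ‖u.grad x‖ ≤ C)
    {B : Set (Vec d)} (hB : IsOpen B) (hBc : Convex ℝ B) (hBΩ : B ⊆ Ω) :
    ∀ᵐ x, x ∈ B → homog f (u.grad x) ≤ liminf (fun ρ : ℝ => liminf (fun n =>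
      ⨍⁻ y in box x ρ, Ω.indicator (fun y => f ((ε n)⁻¹ • y) ((v n).grad y)) y ∂volume) atTop)
        (𝓝[>] 0) := by
  obtain ⟨K, hK⟩ := exists_lipschitz_representative m d C
  have hle : volume.restrict B ≤ volume.restrict Ω := Measure.restrict_mono hBΩ le_rfl
  obtain ⟨w₀, hw₀, huw, hugrad⟩ := hK B hB hBc (u.restrict hBΩ) (ae_mono hle huC)
  choose w hw hvw hvgrad using fun n => hK B hB hBc ((v n).restrict hBΩ) (ae_mono hle (hvC n))
  filter_upwards [(ae_restrict_iff' hB.measurableSet).1 hugrad,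
    hw₀.ae_differentiableAt (μ := volume)] with x hux hdiff hxB
  have hgrad : u.grad x = grad w₀ x := hux hxB
  have hconv : ∀ᶠ y in 𝓝 x, Tendsto (fun n => w n y) atTop (𝓝 (w₀ y)) :=
    (hB.eventually_mem hxB).mono fun y hy => hv.tendsto_representative hB hBΩ hw hw₀ hvw huw hy
  rw [hgrad]
  refine (homog_grad_le_liminf_setLAverage hd hper hb hε hw hconv hdiff).trans_eq
    (liminf_congr ?_)
  filter_upwards [eventually_box_subset (hB.mem_nhds hxB)] with ρ hρ
  refine congrArg (liminf · atTop) (funext fun n => laverage_congr ?_)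
  filter_upwards [ae_mono (Measure.restrict_mono hρ le_rfl) (hvgrad n),
    ae_restrict_mem (measurableSet_box x ρ)] with y hy hyρ
  rw [Set.indicator_of_mem (hBΩ (hρ hyρ)), ← hy]
  rfl

lemma ae_homog_grad_le_liminf (hd : 1 ≤ d) (hΩ : IsOpen Ω) (hΩv : volume Ω ≠ ⊤)
    (hper : IsYPeriodic f) (hb : IsBoundedBy f b) (hε : Tendsto ε atTop (𝓝[>] 0))
    (hv : W1inf.TendstoWeakStar v atTop u) :
    ∀ᵐ x ∂(volume.restrict Ω), homog f (u.grad x) ≤ liminf (fun ρ : ℝ => liminf (fun n =>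
      ⨍⁻ y in box x ρ, Ω.indicator (fun y => f ((ε n)⁻¹ • y) ((v n).grad y)) y ∂volume) atTop)
        (𝓝[>] 0) := by
  obtain ⟨C₁, hC₁⟩ := exists_ae_norm_grad_le_of_tendsto hΩv fun h hh => (hv h hh).2
  obtain ⟨C₂, hC₂⟩ := u.exists_ae_norm_grad_le
  rw [ae_restrict_iff' hΩ.measurableSet, ae_iff]
  refine measure_null_of_locally_null _ fun x hx => ?_
  obtain ⟨r, hr, hball⟩ := Metric.isOpen_iff.1 hΩ x (Classical.not_imp.1 hx).1
  have hloc := ae_homog_grad_le_liminf_of_convex hd hper hb hε hv (C := max C₁ C₂)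
    (fun n => (hC₁ n).mono fun y hy => hy.trans (by exact_mod_cast le_max_left C₁ C₂))
    (hC₂.mono fun y hy => hy.trans (by exact_mod_cast le_max_right C₁ C₂))
    Metric.isOpen_ball (convex_ball x r) hball
  refine ⟨_, inter_mem_nhdsWithin _ (Metric.ball_mem_nhds x hr), ?_⟩
  refine measure_mono_null ?_ (ae_iff.1 hloc)
  exact fun y hy himp => hy.1 fun _ => himp hy.2

lemma lintegral_homog_le_of_tendsto (hd : 1 ≤ d) (hΩ : IsOpen Ω) (hΩv : volume Ω ≠ ⊤)
    (hf : Measurable (Function.uncurry f)) (hper : IsYPeriodic f) (hb : IsBoundedBy f b)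
    (hε : Tendsto ε atTop (𝓝[>] 0)) (hv : W1inf.TendstoWeakStar v atTop u) {a : ℝ≥0∞}
    (ha : ∀ n, energy f (ε n) (v n) ≤ a) :
    ∫⁻ x in Ω, homog f (u.grad x) ≤ a := by
  refine setLIntegral_le_of_le_liminf_setLAverage (fun n => ?_) (fun n => ?_)
    (ae_homog_grad_le_liminf hd hΩ hΩv hper hb hε hv)
  · exact (aemeasurable_indicator_iff hΩ.measurableSet).2 <|
      hf.comp_aemeasurable <| (measurable_const_smul (ε n)⁻¹).aemeasurable.prodMk
        (v n).memLp_grad.aestronglyMeasurable.aemeasurable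
  · rw [lintegral_indicator hΩ.measurableSet]
    exact ha n

theorem lintegral_homog_le_G (hd : 1 ≤ d) (hΩ : IsOpen Ω) (hΩv : volume Ω ≠ ⊤)
    (hf : Measurable (Function.uncurry f)) (hper : IsYPeriodic f) (hb : IsBoundedBy f b)
    (u : W1inf Ω m) (r : ℝ≥0∞) : ∫⁻ x in Ω, homog f (u.grad x) ≤ G f r u := by
  refine le_iInf fun v => le_iInf₂ fun hv _ => le_of_forall_gt_imp_ge_of_dense fun a ha => ?_
  obtain ⟨ε, hε, hεa⟩ :=
    exists_seq_forall_of_frequently (frequently_lt_of_liminf_lt (by isBoundedDefault) ha)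
  exact lintegral_homog_le_of_tendsto hd hΩ hΩv hf hper hb hε
    (W1inf.TendstoWeakStar.comp (l := 𝓝[>] (0 : ℝ)) hv hε) fun n => (hεa n).le

end LowerBound

end SemiHom

end

theorem theorem3p1_general {m d : ℕ} (hd : 1 ≤ d) {Ω : Set (SemiHom.Vec d)} (hΩ : IsOpen Ω)
    (hΩv : volume Ω ≠ ⊤) {f : SemiHom.Vec d → SemiHom.Mat m d → ℝ≥0∞}
    (hf : Measurable (Function.uncurry f)) (hper : SemiHom.IsYPeriodic f)
    (hbdd : ∀ R : ℝ, ∃ C : ℝ≥0, ∀ x ξ, ‖ξ‖ ≤ R → f x ξ ≤ C) :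
    (∀ (u : SemiHom.W1inf Ω m) (r : ℝ≥0∞),
      ∫⁻ x in Ω, SemiHom.homog f (u.grad x) ≤ SemiHom.G f r u) ∧
    (∀ u : SemiHom.W1inf Ω m, u.IsPiecewiseAffine → ∀ r : ℝ≥0,
      SemiHom.H f (r + u.gradNorm) u ≤ ∫⁻ x in Ω, SemiHom.homogBdd r f (u.grad x)) ∧
    SemiHom.IsQuasiconvex (SemiHom.homog f) := by
  choose b hb using hbdd
  have hbound : SemiHom.IsBoundedBy f b := fun R x ξ hξ => hb R x ξ hξ
  exact ⟨SemiHom.lintegral_homog_le_G hd hΩ hΩv hf hper hbound,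
    fun u hu r => SemiHom.H_le_of_isPiecewiseAffine hΩ.measurableSet hΩv hper
      (fun ξ x => hbound x (le_refl ‖ξ‖)) hu r,
    SemiHom.isQuasiconvex_homog hd hper hbound⟩

theorem theorem3p1 {m d : ℕ} (hm : 1 ≤ m) (hd : 1 ≤ d)
    (Ω : Set (SemiHom.Vec d)) (hΩ : IsOpen Ω) (hΩb : Bornology.IsBounded Ω)
    (f : SemiHom.Vec d → SemiHom.Mat m d → ℝ≥0∞)
    (hf : Measurable (Function.uncurry f))
    (hper : ∀ (ξ : SemiHom.Mat m d) (x : SemiHom.Vec d) (j : Fin d),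
      f (x + EuclideanSpace.single j 1) ξ = f x ξ)
    (hgrowth : ∃ c : ℝ, 0 < c ∧ ∀ (x : SemiHom.Vec d) (ξ : SemiHom.Mat m d),
      f x ξ ≤ ENNReal.ofReal (c * (1 + ‖ξ‖))) :
    (∀ (u : SemiHom.W1inf Ω m) (r : ℝ≥0∞),
      ∫⁻ x in Ω, SemiHom.homog f (u.grad x) ≤ SemiHom.G f r u) ∧
    (∀ u : SemiHom.W1inf Ω m, u.IsPiecewiseAffine → ∀ r : ℝ≥0,
      SemiHom.H f (r + u.gradNorm) u ≤ ∫⁻ x in Ω, SemiHom.homogBdd r f (u.grad x)) ∧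
    SemiHom.IsQuasiconvex (SemiHom.homog f) := by
  obtain ⟨c, -, hfc⟩ := hgrowth
  exact theorem3p1_general hd hΩ hΩb.measure_lt_top.ne hf hper fun R =>
    ⟨(|c| * (1 + R)).toNNReal, fun x ξ hξ => (hfc x ξ).trans (ENNReal.ofReal_le_ofReal (by
      gcongr; exact le_abs_self c))⟩
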